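/- Let $\mathbb T=\mathbb R/\mathbb Z$ with Lebesgue probability measure, and let $k\ge 1$. Fix a real Schwartz function $\varphi$ on $\mathbb R$ with $\int\varphi=1$, and let $\varphi_n$ be the function on $\mathbb T$ obtained by periodizing $2^n\varphi(2^n\,\cdot)$. For pairwise distinct $b_0,\dots,b_k\in\mathbb R$, functions $f_0,\dots,f_k$ on $\mathbb T$ and $g$ on $\mathbb T\times\mathbb T$ put $$\Lambda_{k+1}(g;f_0,\dots,f_k)=\int_{\mathbb T}\int_0^1 g(x,r)\prod_{i=0}^{k}f_i(x-rb_i)\,dr\,dx,\qquad \Lambda_{k+1}(g;f)=\Lambda_{k+1}(g;f,\dots,f).$$ For $f:\mathbb T\to\mathbb R$ let $\triangle^kf(x;u)=\prod_{\iota\in\{0,1\}^k}f(x+\iota\cdot u)$ for $x\in\mathbb T$, $u\in\mathbb T^k$. For a finite signed measure $\mu$ on $\mathbb T$, $\triangle^k\mu$ denotes the finite signed measure on $\mathbb T\times\mathbb T^k$ which is the weak limit of $\triangle^k(\varphi_n*\mu)(x;u)\,dx\,du$ as $n\to\infty$, if there is one. **Proposition.** For every $k\ge1$ there is $\varepsilon>0$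 (depending only on $k$) such that the following holds for all pairwise distinct $b_0,\dots,b_k\in\mathbb R$, all $\varphi$ as above and all $\alpha,\beta>1-\varepsilon$. Let $\mu$ be a finite signed measure on $\mathbb T$ such that, for some constants $C_1,C_2$, (a) $|\mu|(B(x,r))\le C_1r^{\alpha}$ for all $x\in\mathbb T$, $r>0$; (b) $\triangle^k\mu$ exists and $|\widehat{\triangle^k\mu}(0;\eta)|\le C_2(1+|\eta|)^{-(k+1)\beta/2}$ for all $\eta\in\mathbb Z^k$. Then $\lim_{n\to\infty}\Lambda_{k+1}(g;\varphi_n*\mu)$ exists for every $g\in C(\mathbb T\times\mathbb T)$, and $g\mapsto\lim_n\Lambda_{k+1}(g;\varphi_n*\mu)$ is a bounded linear functional on $C(\mathbb T\times\mathbb T)$. Consequently there is exactly one finite signed measure $\cap^{k+1}\mu$ on $\mathbb T\times\mathbb T$ with $$\int g\,d(\cap^{k+1}\mu)=\lim_{n\to\infty}\Lambda_{k+1}(g;\varphi_n*\mu)\qquad\text{for all }g\in C(\mathbb T\times\mathbb T),$$ and it is a nonnegative measure if $\mu$ is. -/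

import Mathlib

open MeasureTheory Filter Topology

noncomputable section

/-- The circle `ℝ/ℤ`; its `volume` is the Lebesgue (Haar) probability measure. -/
abbrev Circ : Type := UnitAddCircle

/-- The representative in `[0,1)` of a point of the circle. -/
def rep (x : Circ) : ℝ := (AddCircle.equivIco (1 : ℝ) 0 x : ℝ)

/-- The kernel `φ_n = 2^n φ(2^n ·)` on the real line, periodized to a function on the circle. -/
def dilatedKernel (φ : SchwartzMap ℝ ℝ) (n : ℕ) (x : Circ) : ℝ :=
  ∑' m : ℤ, (2 : ℝ) ^ n * φ ((2 : ℝ) ^ n * (rep x + m))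

/-- The function `φ_n ∗ μ` on the circle. -/
def mollify (φ : SchwartzMap ℝ ℝ) (n : ℕ) (μ : SignedMeasure Circ) (x : Circ) : ℝ :=
  ∫ᵛ y, dilatedKernel φ n (x - y) ∂<•μ

/-- The multilinear form
`Λ_{k+1}(g; f_0, …, f_k) = ∫∫ g(x,r) ∏_i f_i(x - r b_i) dx dr`; since the `b_i` are real, `r` runs
over the fundamental domain `[0,1]` of the circle. -/
def countForm {k : ℕ} (b : Fin (k + 1) → ℝ) (g : Circ × Circ → ℂ)
    (f : Fin (k + 1) → Circ → ℝ) : ℂ :=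
  ∫ x : Circ, ∫ r in (0 : ℝ)..1,
    g (x, (r : Circ)) * ∏ i, ((f i (x - ((r * b i : ℝ) : Circ)) : ℝ) : ℂ)

/-- `△^k f (x; u) = ∏_{ι ∈ {0,1}^k} f(x + ι·u)`, where `ι ∈ {0,1}^k` is recorded by the set of
indices at which it equals one. -/
def cubeProduct (k : ℕ) (f : Circ → ℝ) (x : Circ) (u : Fin k → Circ) : ℝ :=
  ∏ s : Finset (Fin k), f (x + ∑ i ∈ s, u i)

/-- The finite measure `ν` is `△^k μ`: it is the weak limit of the measures
`△^k (φ_n ∗ μ)(x; u) dx du` on the `(k+1)`-dimensional torus. -/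
def IsCubeMeasure (φ : SchwartzMap ℝ ℝ) (μ : SignedMeasure Circ) (k : ℕ)
    (ν : SignedMeasure (Circ × (Fin k → Circ))) : Prop :=
  ∀ g : C(Circ × (Fin k → Circ), ℝ),
    Tendsto (fun n : ℕ => ∫ x : Circ, ∫ u : Fin k → Circ,
        g (x, u) * cubeProduct k (mollify φ n μ) x u) atTop
      (𝓝 (∫ᵛ p, g p ∂<•ν))

/-- The Fourier coefficient of `ν` at the frequency `(0; η)`. -/
def cubeFourier {k : ℕ} (ν : SignedMeasure (Circ × (Fin k → Circ))) (η : Fin k → ℤ) : ℂ :=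
  ∫ᵛ p, (∏ i, fourier (-(η i)) (p.2 i) : ℂ) ∂<•ν

/-- The ball condition `|μ|(B(x,r)) ≤ C r^α`. -/
def HasBallBound (μ : SignedMeasure Circ) (α : ℝ) : Prop :=
  ∃ C : ℝ, ∀ (x : Circ) (r : ℝ), 0 < r →
    (μ.totalVariation (Metric.ball x r)).toReal ≤ C * r ^ α

/-- Fourier decay of order `k` and exponent `β`: the measure `△^k μ` exists and satisfies
`|(△^k μ)^(0; η)| ≤ C (1 + |η|)^{-(k+1)β/2}` for all `η ∈ ℤ^k`. -/
def HasCubeDecay (φ : SchwartzMap ℝ ℝ) (μ : SignedMeasure Circ) (k : ℕ) (β : ℝ) : Prop :=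
  ∃ ν : SignedMeasure (Circ × (Fin k → Circ)), IsCubeMeasure φ μ k ν ∧
    ∃ C : ℝ, ∀ η : Fin k → ℤ,
      ‖cubeFourier ν η‖ ≤
        C * (1 + Real.sqrt (∑ i, (η i : ℝ) ^ 2)) ^ (-((k + 1 : ℝ) * β / 2))

end

/-!
With `ε = 1/(k+1)` the decay exponent of `△^k μ` exceeds `k/2`. What this buys
depends on whether `k ≥ 2`.

*Case `k ≥ 2`.* Put `j = ⌊k/2⌋ ≥ 1`. The decay exponent exceeds `j`, so it is summable over
frequencies `η` supported on `j` of the `k` directions. Test `△^k μ` against `∏_{i < j} χ(u_i)`,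
where `χ` is the autocorrelation of a probability density `ψ`: its Fourier coefficients lie in
`[0, 1]`, so the integral is bounded uniformly in `ψ`
(`norm_signedIntegral_directionProd_le`). For a smooth `f` in place of `μ` the same quantity
dominates, by iterated Cauchy–Schwarz, a power of the moment of order `2^j` of the `j`-fold
`ψ`-average of `f` (`pow_integral_averageOp_le_cubeAverage`). Letting `f` run through the
mollifications of `μ` and `ψ` through an approximate identity gives `μ` a density in `L^{2^j}`
(`exists_memLp_of_cubeDecay`). On the other side, Hölder's inequality applied to the cyclic pairs
`f_i f_{i+1}` bounds `Λ_{k+1}` on `L^q` for every `q ≥ (k+1)/2`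
(`exists_lintegral_prod_translates_le`), and `2^j ≥ (k+1)/2`. Hence `Λ_{k+1}(g; φ_n ∗ μ)` converges
to the value of `Λ_{k+1}(g; ·)` at the density (`exists_tendsto_countForm_of_density`).

*Case `k = 1`.* Here `μ` need not have a density. The hypothesis reads `|μ̂(ξ)|² ≲ (1+|ξ|)^{-β}`
with `β > 0`. At a product of characters, Parseval's identity writes `Λ_2` as a sum over `ξ` of
`f̂(-j-ξ) f̂(ξ)` times an oscillatory integral of size `O(1/(1+|ξ|))`, and dominated convergence
gives the limit (`exists_tendsto_countForm_of_measureCoeff`). Density of trigonometric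
polynomials and the uniform bound of `Λ_2` on `L¹` extend this to continuous `g`.

In both cases the densities `∏_i (φ_n ∗ μ)(x - r b_i)` are bounded in `L¹`, so weak compactness
represents the limit functional by a finite signed measure, which continuous functions determine.
The limit does not depend on the mollifier; when `μ ≥ 0` it can be computed with a nonnegative one,
so the measure is nonnegative (`exists_intersection_measure`).
-/

noncomputable section

/-! ### Integration against finite signed measures -/

section SignedIntegral

theorem Continuous.integrable_of_compact {X E : Type*} [MeasurableSpace X]
    [TopologicalSpace X] [CompactSpace X] [BorelSpace X] [NormedAddCommGroup E]
    [SecondCountableTopologyEither X E]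
    (ρ : Measure X) [IsFiniteMeasure ρ]
    {f : X → E} (hf : Continuous f) : MeasureTheory.Integrable f ρ :=
  hf.integrable_of_hasCompactSupport (HasCompactSupport.of_compactSpace f)

variable {X E : Type*} [MeasurableSpace X] [NormedAddCommGroup E] [NormedSpace ℝ E]

theorem signedIntegral_eq_sub (μ : SignedMeasure X) {f : X → E}
    (hf : MeasureTheory.Integrable f μ.totalVariation) :
    ∫ᵛ x, f x ∂<•μ = ∫ x, f x ∂μ.toJordanDecomposition.posPart
      - ∫ x, f x ∂μ.toJordanDecomposition.negPart := by
  have hP : MeasureTheory.Integrable f μ.toJordanDecomposition.posPart :=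
    hf.mono_measure (Measure.le_add_right le_rfl)
  have hN : MeasureTheory.Integrable f μ.toJordanDecomposition.negPart :=
    hf.mono_measure (Measure.le_add_left le_rfl)
  conv_lhs => rw [← μ.toSignedMeasure_toJordanDecomposition]
  rw [JordanDecomposition.toSignedMeasure, VectorMeasure.integral_sub_vectorMeasure,
    VectorMeasure.integral_toSignedMeasure, VectorMeasure.integral_toSignedMeasure]
  · simpa [VectorMeasure.Integrable] using hP
  · simpa [VectorMeasure.Integrable] using hN

theorem norm_signedIntegral_le (μ : SignedMeasure X) {f : X → E}
    (hf : MeasureTheory.Integrable f μ.totalVariation) :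
    ‖∫ᵛ x, f x ∂<•μ‖ ≤ ∫ x, ‖f x‖ ∂μ.totalVariation := by
  have hP : MeasureTheory.Integrable f μ.toJordanDecomposition.posPart :=
    hf.mono_measure (Measure.le_add_right le_rfl)
  have hN : MeasureTheory.Integrable f μ.toJordanDecomposition.negPart :=
    hf.mono_measure (Measure.le_add_left le_rfl)
  rw [signedIntegral_eq_sub μ hf, SignedMeasure.totalVariation,
    integral_add_measure hP.norm hN.norm]
  exact (norm_sub_le _ _).trans
    (add_le_add (norm_integral_le_integral_norm _) (norm_integral_le_integral_norm _))

theorem signedIntegral_ofReal (μ : SignedMeasure X) {f : X → ℝ}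
    (hf : MeasureTheory.Integrable f μ.totalVariation) :
    ∫ᵛ x, (f x : ℂ) ∂<•μ = ((∫ᵛ x, f x ∂<•μ : ℝ) : ℂ) := by
  rw [signedIntegral_eq_sub μ hf, signedIntegral_eq_sub μ hf.ofReal, integral_complex_ofReal,
    integral_complex_ofReal]
  push_cast
  rfl

instance totalVariation_isFiniteMeasure (μ : SignedMeasure X) :
    IsFiniteMeasure μ.totalVariation := by
  unfold SignedMeasure.totalVariation
  infer_instance

variable [TopologicalSpace X] [CompactSpace X] [BorelSpace X]

/-- Integration of continuous complex functions against a finite signed measure on a compact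
space, as a bounded linear functional. -/
def signedIntegralCLM (μ : SignedMeasure X) : C(X, ℂ) →L[ℂ] ℂ :=
  LinearMap.mkContinuous
    { toFun := fun g => ∫ᵛ x, g x ∂<•μ
      map_add' := fun g h => by
        have hg := g.continuous.integrable_of_compact μ.totalVariation
        have hh := h.continuous.integrable_of_compact μ.totalVariation
        simp only [ContinuousMap.add_apply]
        refine VectorMeasure.integral_fun_add ?_ ?_
        · simpa [VectorMeasure.Integrable, ← SignedMeasure.totalVariation_eq_variation] using hg
        · simpa [VectorMeasure.Integrable, ← SignedMeasure.totalVariation_eq_variation] using hh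
      map_smul' := fun c g => by
        have hg := g.continuous.integrable_of_compact μ.totalVariation
        have hcg := (c • g).continuous.integrable_of_compact μ.totalVariation
        rw [signedIntegral_eq_sub μ hg, signedIntegral_eq_sub μ hcg]
        simp only [ContinuousMap.smul_apply, integral_smul, RingHom.id_apply, smul_sub] }
    (μ.totalVariation.real Set.univ) (fun g => by
      have hg := g.continuous.integrable_of_compact μ.totalVariation
      refine (norm_signedIntegral_le μ hg).trans ?_
      refine (integral_mono hg.norm (integrable_const ‖g‖) (fun x => g.norm_coe_le_norm x)).trans ?_
      simp)

@[simp] theorem signedIntegralCLM_apply (μ : SignedMeasure X) (g : C(X, ℂ)) :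
    signedIntegralCLM μ g = ∫ᵛ x, g x ∂<•μ := rfl

variable [HasOuterApproxClosed X]

/-- A finite signed measure on a compact metrizable space is determined by the integrals of
continuous functions. -/
theorem signedMeasure_ext_of_integral {ν₁ ν₂ : SignedMeasure X}
    (h : ∀ g : C(X, ℝ), ∫ᵛ x, g x ∂<•ν₁ = ∫ᵛ x, g x ∂<•ν₂) : ν₁ = ν₂ := by
  have key : ν₁.toJordanDecomposition.posPart + ν₂.toJordanDecomposition.negPart
      = ν₂.toJordanDecomposition.posPart + ν₁.toJordanDecomposition.negPart := by
    refine ext_of_forall_integral_eq_of_IsFiniteMeasure fun f => ?_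
    have hf := f.continuous
    have := h f.toContinuousMap
    simp only [BoundedContinuousFunction.coe_toContinuousMap] at this
    rw [signedIntegral_eq_sub _ (hf.integrable_of_compact _),
      signedIntegral_eq_sub _ (hf.integrable_of_compact _)] at this
    rw [integral_add_measure (hf.integrable_of_compact _) (hf.integrable_of_compact _),
      integral_add_measure (hf.integrable_of_compact _) (hf.integrable_of_compact _)]
    linarith
  rw [← ν₁.toSignedMeasure_toJordanDecomposition, ← ν₂.toSignedMeasure_toJordanDecomposition,
    JordanDecomposition.toSignedMeasure, JordanDecomposition.toSignedMeasure,
    sub_eq_sub_iff_add_eq_add, ← Measure.toSignedMeasure_add, ← Measure.toSignedMeasure_add]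
  congr 1

end SignedIntegral

/-! ### Fourier coefficients on the circle -/

theorem haarAddCircle_eq_volume : (AddCircle.haarAddCircle : Measure Circ) = volume := by
  rw [AddCircle.volume_eq_smul_haarAddCircle]; simp

instance isProbabilityMeasure_volume_circ : IsProbabilityMeasure (volume : Measure Circ) :=
  ⟨UnitAddCircle.measure_univ⟩

theorem fourierCoeff_eq_integral (f : Circ → ℂ) (n : ℤ) :
    fourierCoeff f n = ∫ x : Circ, fourier (-n) x * f x := by
  rw [fourierCoeff, haarAddCircle_eq_volume]; rfl

theorem norm_fourier_apply (n : ℤ) (x : Circ) : ‖fourier n x‖ = 1 := by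
  rw [fourier_apply]; exact Circle.norm_coe _

theorem norm_fourierCoeff_le (f : Circ → ℂ) (n : ℤ) : ‖fourierCoeff f n‖ ≤ ∫ x, ‖f x‖ := by
  rw [fourierCoeff_eq_integral]
  refine (norm_integral_le_integral_norm _).trans (le_of_eq ?_)
  simp only [norm_mul, norm_fourier_apply, one_mul]

theorem fourier_add_apply (n : ℤ) (x y : Circ) :
    fourier n (x + y) = fourier n x * (fourier n y : ℂ) := by
  simp only [fourier_apply, smul_add, AddCircle.toCircle_add, Circle.coe_mul]

theorem fourier_neg_apply (n : ℤ) (x : Circ) :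
    (fourier n (-x) : ℂ) = fourier (-n) x := by
  simp only [fourier_apply, smul_neg, neg_smul]

/-- The Fourier coefficients of a finite signed measure on the circle. -/
def measureCoeff (μ : SignedMeasure Circ) (n : ℤ) : ℂ := ∫ᵛ x, fourier (-n) x ∂<•μ

theorem continuousLinearMap_ext_fourier {T₁ T₂ : C(Circ, ℂ) →L[ℂ] ℂ}
    (h : ∀ n, T₁ (fourier n) = T₂ (fourier n)) : T₁ = T₂ := by
  refine ContinuousLinearMap.ext_on (s := Set.range (fourier (T := (1 : ℝ)))) ?_ ?_
  · rw [Submodule.dense_iff_topologicalClosure_eq_top]; exact span_fourier_closure_eq_top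
  · rintro _ ⟨n, rfl⟩; exact h n

/-- Integration against an integrable density, as a functional on continuous functions. -/
def densityCLM (f : Circ → ℂ) (hf : MeasureTheory.Integrable f) : C(Circ, ℂ) →L[ℂ] ℂ :=
  LinearMap.mkContinuous
    { toFun := fun g => ∫ x, g x * f x
      map_add' := fun g h => by
        simp only [ContinuousMap.add_apply, add_mul]
        exact integral_add (hf.bdd_mul (c := ‖g‖) g.continuous.aestronglyMeasurable
            (ae_of_all _ g.norm_coe_le_norm))
          (hf.bdd_mul (c := ‖h‖) h.continuous.aestronglyMeasurable
            (ae_of_all _ h.norm_coe_le_norm))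
      map_smul' := fun c g => by
        simp only [ContinuousMap.smul_apply, smul_eq_mul, mul_assoc, integral_const_mul,
          RingHom.id_apply] }
    (∫ x, ‖f x‖) (fun g => by
      refine (norm_integral_le_integral_norm _).trans ?_
      simp only [norm_mul]
      rw [mul_comm, ← integral_const_mul]
      refine integral_mono_of_nonneg (ae_of_all _ fun x => by positivity)
        (hf.norm.const_mul _) (ae_of_all _ fun x => ?_)
      exact mul_le_mul_of_nonneg_right (g.norm_coe_le_norm x) (norm_nonneg _))

/-- A signed measure and an integrable function with the same Fourier coefficients have the same
integrals against continuous functions. -/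
theorem signedIntegral_eq_integral_of_coeff {μ : SignedMeasure Circ} {f : Circ → ℂ}
    (hf : MeasureTheory.Integrable f) (h : ∀ n, measureCoeff μ n = fourierCoeff f n)
    (g : C(Circ, ℂ)) : ∫ᵛ x, g x ∂<•μ = ∫ x, g x * f x := by
  have : signedIntegralCLM μ = densityCLM f hf := by
    refine continuousLinearMap_ext_fourier fun n => ?_
    have := h (-n)
    rw [fourierCoeff_eq_integral, measureCoeff, neg_neg] at this
    exact this
  exact congrArg (fun T : C(Circ, ℂ) →L[ℂ] ℂ => T g) this

/-! ### Periodized kernels as approximate identities -/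

section Periodization

open scoped FourierTransform

/-- Periodization of a continuous function on the line with quadratic decay: the sum over
translates is a continuous function on the circle whose Fourier coefficients are the values of the
Fourier transform at the integers. -/
theorem exists_periodization {f : C(ℝ, ℂ)}
    (hf : f =O[cocompact ℝ] fun x : ℝ => |x| ^ (-2 : ℝ)) :
    ∃ F : C(Circ, ℂ), (∀ x, HasSum (fun m : ℤ => f (rep x + m)) (F x)) ∧
      ∀ ξ : ℤ, fourierCoeff F ξ = 𝓕 (f : ℝ → ℂ) ξ := by
  have h_norm : ∀ K : TopologicalSpace.Compacts ℝ,
      Summable fun n : ℤ => ‖(f.comp <| ContinuousMap.addRight n).restrict K‖ := fun K =>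
    summable_of_isBigO (Real.summable_abs_int_rpow one_lt_two)
      ((isBigO_norm_restrict_cocompact f two_pos hf K).comp_tendsto
        Int.tendsto_coe_cofinite)
  let F : C(Circ, ℂ) :=
    ⟨(f.periodic_tsum_comp_add_zsmul 1).lift, continuous_coinduced_dom.mpr (map_continuous _)⟩
  refine ⟨F, fun x => ?_, fun ξ => Real.fourierCoeff_tsum_comp_add h_norm ξ⟩
  have h1 := ContinuousMap.hasSum_apply
    (ContinuousMap.summable_of_locally_summable_norm h_norm).hasSum (rep x)
  have hx : ((rep x : ℝ) : Circ) = x := AddCircle.coe_equivIco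
  have h2 : F x = (∑' n : ℤ, f.comp (ContinuousMap.addRight (n : ℝ))) (rep x) := by
    have : F x = F ((rep x : ℝ) : Circ) := by rw [hx]
    rw [this]
    simp only [F, ContinuousMap.coe_mk, Function.Periodic.lift_coe, zsmul_one]
  rw [h2]
  exact h1

/-- Dilating by `2^n` preserves quadratic decay. -/
theorem isBigO_dilate {φ : ℝ → ℝ} (hφ : φ =O[cocompact ℝ] fun x : ℝ => |x| ^ (-2 : ℝ)) (n : ℕ) :
    (fun x : ℝ => (2 : ℝ) ^ n * φ ((2 : ℝ) ^ n * x)) =O[cocompact ℝ]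
      fun x : ℝ => |x| ^ (-2 : ℝ) := by
  have h2 : (2 : ℝ) ^ n ≠ 0 := by positivity
  have ht : Tendsto (fun x : ℝ => (2 : ℝ) ^ n * x) (cocompact ℝ) (cocompact ℝ) :=
    (Homeomorph.mulLeft₀ _ h2).isClosedEmbedding.tendsto_cocompact
  have := (hφ.comp_tendsto ht).const_mul_left ((2 : ℝ) ^ n)
  refine this.trans ?_
  have he : ((fun x : ℝ => |x| ^ (-2 : ℝ)) ∘ fun x : ℝ => (2 : ℝ) ^ n * x)
      = fun x : ℝ => |(2 : ℝ) ^ n| ^ (-2 : ℝ) * |x| ^ (-2 : ℝ) := by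
    ext x
    simp only [Function.comp_apply, abs_mul]
    rw [Real.mul_rpow (abs_nonneg _) (abs_nonneg _)]
  rw [he]
  exact Asymptotics.isBigO_const_mul_self _ _ _

/-- A family of continuous kernels on the circle, bounded in `L¹`, each of whose Fourier
coefficients tends to one. The kernels need not be nonnegative. -/
structure IsApproxIdentity (D : ℕ → C(Circ, ℝ)) : Prop where
  bound : ∃ K : ℝ, ∀ n, ∫ x, |D n x| ≤ K
  coeff : ∀ ξ : ℤ, Tendsto (fun n => fourierCoeff (fun x => (D n x : ℂ)) ξ) atTop (𝓝 1)

theorem schwartz_isBigO (φ : SchwartzMap ℝ ℝ) :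
    φ =O[cocompact ℝ] fun x : ℝ => |x| ^ (-2 : ℝ) := φ.isBigO_cocompact_rpow (-2)

/-- The periodized kernel `φ_n` is continuous, its Fourier coefficient at `ξ` is
`∫ e(-tξ/2^n) φ(t) dt`, and its `L¹` norm is at most that of `φ`. -/
theorem exists_dilatedKernel_periodization (φ : SchwartzMap ℝ ℝ) (n : ℕ) :
    ∃ F : C(Circ, ℂ), (∀ x, F x = (dilatedKernel φ n x : ℂ)) ∧
      (∀ ξ : ℤ, fourierCoeff F ξ = ∫ t : ℝ, Complex.exp (-2 * Real.pi * Complex.I *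
        (t * ξ / 2 ^ n)) * φ t) ∧ ∫ x, ‖F x‖ ≤ ∫ t, |φ t| := by
  let f : C(ℝ, ℂ) := ⟨fun x => (((2 : ℝ) ^ n * φ ((2 : ℝ) ^ n * x) : ℝ) : ℂ), by
    have := φ.continuous; fun_prop⟩
  have hfO : f =O[cocompact ℝ] fun x : ℝ => |x| ^ (-2 : ℝ) := by
    refine (Asymptotics.isBigO_norm_left.1 ?_)
    simp only [f, ContinuousMap.coe_mk, Complex.norm_real]
    exact Asymptotics.isBigO_norm_left.2 (isBigO_dilate (schwartz_isBigO φ) n)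
  -- The periodization of `|2^n φ(2^n ·)|` dominates `F`, and its mean is its Fourier coefficient at
  -- zero, that is `∫ |φ|`.
  let g : C(ℝ, ℂ) := ⟨fun x => ((|(2 : ℝ) ^ n * φ ((2 : ℝ) ^ n * x)| : ℝ) : ℂ), by
    have := φ.continuous; fun_prop⟩
  have hgO : g =O[cocompact ℝ] fun x : ℝ => |x| ^ (-2 : ℝ) := by
    refine (Asymptotics.isBigO_norm_left.1 ?_)
    simp only [g, ContinuousMap.coe_mk, Complex.norm_real, norm_abs_eq_norm]
    exact Asymptotics.isBigO_norm_left.2 (isBigO_dilate (schwartz_isBigO φ) n)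
  obtain ⟨F, hF, hFc⟩ := exists_periodization hfO
  obtain ⟨G, hG, hGc⟩ := exists_periodization hgO
  have h2 : (0 : ℝ) < 2 ^ n := by positivity
  refine ⟨F, fun x => ?_, fun ξ => ?_, ?_⟩
  · rw [← (hF x).tsum_eq, dilatedKernel, Complex.ofReal_tsum]
    rfl
  · rw [hFc, Real.fourier_real_eq_integral_exp_smul]
    have := Measure.integral_comp_mul_left (fun t : ℝ => Complex.exp (-2 * Real.pi * Complex.I *
        (t * ξ / 2 ^ n)) * φ t) ((2 : ℝ) ^ n)
    rw [abs_of_pos (by positivity)] at this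
    have h3 := congrArg (fun z : ℂ => ((2 : ℝ) ^ n) • z) this
    simp only [smul_smul, mul_inv_cancel₀ h2.ne', one_smul] at h3
    rw [← h3, ← integral_smul]
    refine integral_congr_ae (ae_of_all _ fun t => ?_)
    simp only [f, ContinuousMap.coe_mk, smul_eq_mul, Complex.real_smul]
    push_cast
    have : (-2 * Real.pi * t * ξ * Complex.I : ℂ)
        = -2 * Real.pi * Complex.I * (2 ^ n * t * ξ / 2 ^ n) := by
      field_simp
    rw [this]
    ring
  · have h0 := hGc 0
    rw [fourierCoeff_eq_integral, Real.fourier_real_eq_integral_exp_smul] at h0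
    simp only [neg_zero, fourier_zero, one_mul, Int.cast_zero, mul_zero, Complex.ofReal_zero,
      zero_mul, Complex.exp_zero, one_smul] at h0
    have hle : ∀ x, ‖F x‖ ≤ ‖G x‖ := by
      intro x
      have hGs := (hG x).summable.norm
      have hs : Summable fun m : ℤ => ‖f (rep x + m)‖ := by
        refine hGs.congr fun m => ?_
        simp only [f, g, ContinuousMap.coe_mk, Complex.norm_real, norm_abs_eq_norm]
      have : (‖G x‖ : ℝ) = ∑' m : ℤ, ‖f (rep x + m)‖ := by
        rw [← (hG x).tsum_eq]
        have e : ∀ m : ℤ, g (rep x + m) = ((‖f (rep x + m)‖ : ℝ) : ℂ) := by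
          intro m
          simp only [f, g, ContinuousMap.coe_mk, Complex.norm_real, Real.norm_eq_abs]
        simp only [e]
        rw [← Complex.ofReal_tsum, Complex.norm_real, Real.norm_eq_abs,
          abs_of_nonneg (tsum_nonneg fun _ => norm_nonneg _)]
      rw [this, ← (hF x).tsum_eq]
      exact norm_tsum_le_tsum_norm hs
    have hGnn : ∀ x, G x = ((‖G x‖ : ℝ) : ℂ) := by
      intro x
      rw [← (hG x).tsum_eq]
      simp only [g, ContinuousMap.coe_mk]
      rw [← Complex.ofReal_tsum, Complex.norm_real, Real.norm_eq_abs,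
          abs_of_nonneg (tsum_nonneg fun _ => abs_nonneg _)]
    have hI : ∫ x, ‖G x‖ = ∫ t, |φ t| := by
      have e1 : ∫ x, G x = ((∫ x, ‖G x‖ : ℝ) : ℂ) := by
        rw [← integral_complex_ofReal]; exact integral_congr_ae (ae_of_all _ hGnn)
      have e2 : ∫ t, g t = ((∫ t, |φ t| : ℝ) : ℂ) := by
        simp only [g, ContinuousMap.coe_mk]
        rw [integral_complex_ofReal]
        congr 1
        simp only [abs_mul, abs_of_pos h2]
        rw [integral_const_mul, Measure.integral_comp_mul_left (fun t => |φ t|),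
          abs_of_pos (inv_pos.2 h2), smul_eq_mul, mul_inv_cancel_left₀ h2.ne']
      exact_mod_cast e1.symm.trans (h0.trans e2)
    rw [← hI]
    exact integral_mono (F.continuous.norm.integrable_of_compact _)
      (G.continuous.norm.integrable_of_compact _) hle

theorem continuous_dilatedKernel (φ : SchwartzMap ℝ ℝ) (n : ℕ) :
    Continuous (dilatedKernel φ n) := by
  obtain ⟨F, hF, -, -⟩ := exists_dilatedKernel_periodization φ n
  have : dilatedKernel φ n = fun x => (F x).re := by
    ext x; rw [hF, Complex.ofReal_re]
  rw [this]
  exact Complex.continuous_re.comp F.continuous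

/-- The periodized dilated kernels as continuous maps. -/
def kernelMap (φ : SchwartzMap ℝ ℝ) (n : ℕ) : C(Circ, ℝ) :=
  ⟨dilatedKernel φ n, continuous_dilatedKernel φ n⟩

theorem isApproxIdentity_kernelMap (φ : SchwartzMap ℝ ℝ) (hφ : ∫ t, φ t = 1) :
    IsApproxIdentity (kernelMap φ) where
  bound := by
    refine ⟨∫ t, |φ t|, fun n => ?_⟩
    obtain ⟨F, hF, -, hb⟩ := exists_dilatedKernel_periodization φ n
    refine le_trans (le_of_eq ?_) hb
    refine integral_congr_ae (ae_of_all _ fun x => ?_)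
    simp only [hF, Complex.norm_real, Real.norm_eq_abs]
    rfl
  coeff := by
    intro ξ
    have h : ∀ n, fourierCoeff (fun x => (kernelMap φ n x : ℂ)) ξ = ∫ t : ℝ,
        Complex.exp (-2 * Real.pi * Complex.I * (t * ξ / 2 ^ n)) * φ t := by
      intro n
      obtain ⟨F, hF, hc, -⟩ := exists_dilatedKernel_periodization φ n
      rw [← hc]
      congr 1
      ext x
      exact (hF x).symm
    simp only [h]
    have h1 : (1 : ℂ) = ∫ t : ℝ, (φ t : ℂ) := by rw [integral_complex_ofReal, hφ]; simp
    rw [h1]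
    refine tendsto_integral_of_dominated_convergence (fun t => |φ t|) (fun n => ?_)
      φ.integrable.abs (fun n => ae_of_all _ fun t => ?_) (ae_of_all _ fun t => ?_)
    · have := φ.continuous
      exact Continuous.aestronglyMeasurable (by fun_prop)
    · have : (-2 * Real.pi * Complex.I * (t * ξ / 2 ^ n) : ℂ)
          = ((-2 * Real.pi * (t * ξ / 2 ^ n) : ℝ) : ℂ) * Complex.I := by push_cast; ring
      rw [norm_mul, this, Complex.norm_exp_ofReal_mul_I, one_mul, Complex.norm_real,
        Real.norm_eq_abs]
    · have hz : Tendsto (fun n : ℕ => (t * ξ / 2 ^ n : ℂ)) atTop (𝓝 0) := by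
        have := (tendsto_pow_atTop_nhds_zero_of_lt_one (r := (2⁻¹ : ℝ)) (by norm_num)
          (by norm_num)).const_mul (t * ξ)
        rw [mul_zero] at this
        have h' := (Complex.continuous_ofReal.tendsto _).comp this
        refine (h'.congr fun n => ?_).trans (by simp)
        simp [div_eq_mul_inv]
      have : Tendsto (fun n : ℕ => Complex.exp (-2 * Real.pi * Complex.I * (t * ξ / 2 ^ n)) * φ t)
          atTop (𝓝 (Complex.exp (-2 * Real.pi * Complex.I * 0) * φ t)) :=
        (((hz.const_mul _).cexp).mul_const _)
      simpa using this

theorem kernelMap_nonneg {φ : SchwartzMap ℝ ℝ} (hφ : ∀ t, 0 ≤ φ t) (n : ℕ) (x : Circ) :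
    0 ≤ kernelMap φ n x :=
  tsum_nonneg fun _ => mul_nonneg (by positivity) (hφ _)

theorem exists_nonneg_schwartz : ∃ φ : SchwartzMap ℝ ℝ, (∀ t, 0 ≤ φ t) ∧ ∫ t, φ t = 1 := by
  let f : ContDiffBump (0 : ℝ) := ⟨1, 2, one_pos, one_lt_two⟩
  refine ⟨(f.hasCompactSupport_normed (μ := volume)).toSchwartzMap f.contDiff_normed,
    fun t => ?_, ?_⟩
  · exact f.nonneg_normed t
  · exact f.integral_normed

end Periodization

/-! ### Convolution of a kernel with a finite signed measure -/

section MeasureConv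

theorem continuous_integral_sub (D : C(Circ, ℝ)) (ρ : Measure Circ) [IsFiniteMeasure ρ] :
    Continuous fun x => ∫ y, D (x - y) ∂ρ := by
  refine continuous_of_dominated (bound := fun _ => ‖D‖) (fun x => ?_) (fun x => ?_)
    (integrable_const _) (ae_of_all _ fun y => ?_)
  · exact Continuous.aestronglyMeasurable (by fun_prop)
  · exact ae_of_all _ fun y => D.norm_coe_le_norm _
  · fun_prop

theorem integrable_fourier_mul_conv (D : C(Circ, ℝ)) (ρ : Measure Circ) [IsFiniteMeasure ρ]
    (ξ : ℤ) : MeasureTheory.Integrable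
      (fun p : Circ × Circ => (fourier (-ξ) p.1 : ℂ) * (D (p.1 - p.2) : ℂ)) (volume.prod ρ) :=
  Continuous.integrable_of_compact _ (by fun_prop)

theorem fourierCoeff_integral_sub (D : C(Circ, ℝ)) (ρ : Measure Circ) [IsFiniteMeasure ρ] (ξ : ℤ) :
    fourierCoeff (fun x => ((∫ y, D (x - y) ∂ρ : ℝ) : ℂ)) ξ
      = fourierCoeff (fun x => (D x : ℂ)) ξ * ∫ y, fourier (-ξ) y ∂ρ := by
  rw [fourierCoeff_eq_integral, fourierCoeff_eq_integral]
  simp only [← integral_complex_ofReal, ← integral_const_mul]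
  rw [integral_integral_swap (integrable_fourier_mul_conv D ρ ξ)]
  refine integral_congr_ae (ae_of_all _ fun y => ?_)
  simp only
  rw [← integral_add_right_eq_self _ y, ← integral_mul_const]
  refine integral_congr_ae (ae_of_all _ fun x => ?_)
  simp only [add_sub_cancel_right, fourier_add_apply]
  ring

theorem integral_abs_integral_sub_le (D : C(Circ, ℝ)) (ρ : Measure Circ) [IsFiniteMeasure ρ] :
    ∫ x, |∫ y, D (x - y) ∂ρ| ≤ (∫ x, |D x|) * ρ.real Set.univ := by
  have hint : MeasureTheory.Integrable (fun p : Circ × Circ => |D (p.1 - p.2)|) (volume.prod ρ) :=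
    Continuous.integrable_of_compact _ (by fun_prop)
  calc ∫ x, |∫ y, D (x - y) ∂ρ| ≤ ∫ x, ∫ y, |D (x - y)| ∂ρ := by
        refine integral_mono_of_nonneg (ae_of_all _ fun x => abs_nonneg _)
          hint.integral_prod_left (ae_of_all _ fun x => ?_)
        exact abs_integral_le_integral_abs
    _ = ∫ y, ∫ x, |D (x - y)| ∂volume ∂ρ := integral_integral_swap hint
    _ = ∫ y, ∫ x, |D x| ∂volume ∂ρ := by
        refine integral_congr_ae (ae_of_all _ fun y => ?_)
        exact integral_sub_right_eq_self (fun x => |D x|) y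
    _ = _ := by simp [mul_comm]

theorem signedIntegral_sub_eq (D : C(Circ, ℝ)) (μ : SignedMeasure Circ) (x : Circ) :
    ∫ᵛ y, D (x - y) ∂<•μ = ∫ y, D (x - y) ∂μ.toJordanDecomposition.posPart
      - ∫ y, D (x - y) ∂μ.toJordanDecomposition.negPart :=
  signedIntegral_eq_sub μ (Continuous.integrable_of_compact _ (by fun_prop))

/-- The convolution `D ∗ μ` of a continuous kernel and a finite signed measure on the circle. -/
def measureConv (D : C(Circ, ℝ)) (μ : SignedMeasure Circ) : C(Circ, ℝ) where
  toFun x := ∫ᵛ y, D (x - y) ∂<•μ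
  continuous_toFun := by
    simp only [signedIntegral_sub_eq]
    exact (continuous_integral_sub D _).sub (continuous_integral_sub D _)

theorem measureConv_apply (D : C(Circ, ℝ)) (μ : SignedMeasure Circ) (x : Circ) :
    measureConv D μ x = ∫ᵛ y, D (x - y) ∂<•μ := rfl

theorem measureConv_kernelMap (φ : SchwartzMap ℝ ℝ) (n : ℕ) (μ : SignedMeasure Circ) :
    ⇑(measureConv (kernelMap φ n) μ) = mollify φ n μ := rfl

theorem fourierCoeff_measureConv (D : C(Circ, ℝ)) (μ : SignedMeasure Circ) (ξ : ℤ) :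
    fourierCoeff (fun x => (measureConv D μ x : ℂ)) ξ
      = fourierCoeff (fun x => (D x : ℂ)) ξ * measureCoeff μ ξ := by
  have h1 : (fun x => (measureConv D μ x : ℂ)) =
      (fun x => ((∫ y, D (x - y) ∂μ.toJordanDecomposition.posPart : ℝ) : ℂ)) -
      (fun x => ((∫ y, D (x - y) ∂μ.toJordanDecomposition.negPart : ℝ) : ℂ)) := by
    ext x
    rw [measureConv_apply, signedIntegral_sub_eq]
    simp
  have hP := continuous_integral_sub D μ.toJordanDecomposition.posPart
  have hN := continuous_integral_sub D μ.toJordanDecomposition.negPart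
  rw [h1, measureCoeff, signedIntegral_eq_sub μ (Continuous.integrable_of_compact _ (by fun_prop)),
    mul_sub, ← fourierCoeff_integral_sub, ← fourierCoeff_integral_sub]
  simp only [fourierCoeff_eq_integral, Pi.sub_apply, mul_sub]
  exact integral_sub (Continuous.integrable_of_compact _ (by fun_prop))
    (Continuous.integrable_of_compact _ (by fun_prop))

theorem integral_abs_measureConv_le (D : C(Circ, ℝ)) (μ : SignedMeasure Circ) :
    ∫ x, |measureConv D μ x| ≤ (∫ x, |D x|) * μ.totalVariation.real Set.univ := by
  have hP := continuous_integral_sub D μ.toJordanDecomposition.posPart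
  have hN := continuous_integral_sub D μ.toJordanDecomposition.negPart
  rw [SignedMeasure.totalVariation, measureReal_add_apply, mul_add]
  refine le_trans ?_ (add_le_add (integral_abs_integral_sub_le D _)
    (integral_abs_integral_sub_le D _))
  rw [← integral_add (Continuous.integrable_of_compact _ hP.abs)
    (Continuous.integrable_of_compact _ hN.abs)]
  refine integral_mono (Continuous.integrable_of_compact _ (by fun_prop))
    (Continuous.integrable_of_compact _ (by fun_prop)) fun x => ?_
  simp only [measureConv_apply, signedIntegral_sub_eq]
  exact abs_sub _ _

/-- Mollifying a nonnegative measure with a nonnegative kernel gives a nonnegative function. -/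
theorem measureConv_nonneg {D : C(Circ, ℝ)} (hD : ∀ x, 0 ≤ D x) {μ : SignedMeasure Circ}
    (hμ : 0 ≤ μ) (x : Circ) : 0 ≤ measureConv D μ x := by
  have hμ' : VectorMeasure.restrict 0 Set.univ ≤ VectorMeasure.restrict μ Set.univ :=
    (VectorMeasure.le_restrict_univ_iff_le 0 μ).2 hμ
  have h := SignedMeasure.toMeasureOfZeroLE_toSignedMeasure μ hμ'
  rw [measureConv_apply, ← h, VectorMeasure.integral_toSignedMeasure]
  exact integral_nonneg fun y => hD _

end MeasureConv

/-! ### Parseval's identity and recovering a density from its Fourier coefficients -/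

section Parseval

open scoped ENNReal ComplexConjugate

theorem hasSum_sq_fourierCoeff_of_memLp {f : Circ → ℂ} (hf : MemLp f 2) :
    HasSum (fun ξ => ‖fourierCoeff f ξ‖ ^ 2) (∫ x, ‖f x‖ ^ 2) := by
  have hf' : MemLp f 2 AddCircle.haarAddCircle := hf.haarAddCircle
  have h := hasSum_sq_fourierCoeff (hf'.toLp f)
  have h1 : ∀ ξ, fourierCoeff (hf'.toLp f) ξ = fourierCoeff f ξ := fun ξ =>
    congrFun (fourierCoeff_congr_ae hf'.coeFn_toLp) ξ
  simp only [h1] at h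
  convert h using 1
  rw [← haarAddCircle_eq_volume]
  refine integral_congr_ae ?_
  filter_upwards [hf'.coeFn_toLp] with x hx
  rw [hx]

/-- Parseval's identity for a pair of functions. -/
theorem hasSum_conj_fourierCoeff_mul {f g : Circ → ℂ} (hf : MemLp f 2) (hg : MemLp g 2) :
    HasSum (fun ξ => conj (fourierCoeff f ξ) * fourierCoeff g ξ) (∫ x, conj (f x) * g x) := by
  have hf' : MemLp f 2 AddCircle.haarAddCircle := hf.haarAddCircle
  have hg' : MemLp g 2 AddCircle.haarAddCircle := hg.haarAddCircle
  have h := fourierBasis.hasSum_inner_mul_inner (hf'.toLp f) (hg'.toLp g)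
  have h1 : ∀ ξ, fourierBasis.repr (hf'.toLp f) ξ = fourierCoeff f ξ := fun ξ =>
    (fourierBasis_repr _ ξ).trans (congrFun (fourierCoeff_congr_ae hf'.coeFn_toLp) ξ)
  have h2 : ∀ ξ, fourierBasis.repr (hg'.toLp g) ξ = fourierCoeff g ξ := fun ξ =>
    (fourierBasis_repr _ ξ).trans (congrFun (fourierCoeff_congr_ae hg'.coeFn_toLp) ξ)
  convert! h using 1
  · ext ξ
    rw [← fourierBasis.repr_apply_apply, h2, ← inner_conj_symm, ← fourierBasis.repr_apply_apply, h1]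
  · rw [MeasureTheory.L2.inner_def, ← haarAddCircle_eq_volume]
    refine integral_congr_ae ?_
    filter_upwards [hf'.coeFn_toLp, hg'.coeFn_toLp] with x hx hy
    rw [hx, hy]
    simp [mul_comm]

theorem integral_sq_le_of_eLpNorm_le {f : Circ → ℂ} (hf : MemLp f 2) {B : ℝ≥0∞} (hB : B ≠ ⊤)
    (h : eLpNorm f 2 ≤ B) : ∫ x, ‖f x‖ ^ 2 ≤ B.toReal ^ 2 := by
  rw [hf.eLpNorm_eq_integral_rpow_norm two_ne_zero ENNReal.ofNat_ne_top] at h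
  have h0 : (0 : ℝ) ≤ ∫ x, ‖f x‖ ^ 2 := integral_nonneg fun x => by positivity
  simp only [ENNReal.toReal_ofNat, Real.rpow_ofNat] at h
  rw [ENNReal.ofReal_le_iff_le_toReal hB] at h
  calc ∫ x, ‖f x‖ ^ 2 = ((∫ x, ‖f x‖ ^ 2) ^ (2⁻¹ : ℝ)) ^ 2 := by
        rw [← Real.rpow_natCast, ← Real.rpow_mul h0]; norm_num
    _ ≤ _ := by gcongr

theorem tendsto_eLpNorm_two_of_integral {f : ℕ → Circ → ℂ} (hf : ∀ n, MemLp (f n) 2)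
    (h : Tendsto (fun n => ∫ x, ‖f n x‖ ^ 2) atTop (𝓝 0)) :
    Tendsto (fun n => eLpNorm (f n) 2 volume) atTop (𝓝 0) := by
  have : ∀ n, eLpNorm (f n) 2 volume = ENNReal.ofReal ((∫ x, ‖f n x‖ ^ 2) ^ (2⁻¹ : ℝ)) := by
    intro n
    rw [(hf n).eLpNorm_eq_integral_rpow_norm two_ne_zero ENNReal.ofNat_ne_top]
    simp
  simp only [this]
  have h2 := (h.rpow_const (p := (2⁻¹ : ℝ)) (Or.inr (by norm_num)))
  rw [Real.zero_rpow (by norm_num)] at h2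
  simpa using ENNReal.tendsto_ofReal h2

theorem fourierCoeff_sub_of_integrable {f g : Circ → ℂ} (hf : MeasureTheory.Integrable f)
    (hg : MeasureTheory.Integrable g) (ξ : ℤ) :
    fourierCoeff (f - g) ξ = fourierCoeff f ξ - fourierCoeff g ξ := by
  simp only [fourierCoeff_eq_integral, Pi.sub_apply, mul_sub]
  exact integral_sub
    (hf.bdd_mul (c := 1) (ContinuousMap.continuous _).aestronglyMeasurable
      (ae_of_all _ fun x => (norm_fourier_apply _ _).le))
    (hg.bdd_mul (c := 1) (ContinuousMap.continuous _).aestronglyMeasurable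
      (ae_of_all _ fun x => (norm_fourier_apply _ _).le))

theorem memLp_continuousMap (h : C(Circ, ℂ)) (q : ℝ≥0∞) : MemLp h q (volume : Measure Circ) :=
  MemLp.of_bound h.continuous.aestronglyMeasurable ‖h‖ (ae_of_all _ h.norm_coe_le_norm)

/-- If continuous functions `h l` are bounded in `L^q`, `q ≥ 2`, and their Fourier coefficients
converge to `c` while staying dominated by a multiple of `‖c‖`, then `c` is the sequence of Fourier
coefficients of a function in `L^q`. -/
theorem exists_memLp_of_tendsto_coeff {h : ℕ → C(Circ, ℂ)} {c : ℤ → ℂ} {K : ℝ}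
    (hK : ∀ l ξ, ‖fourierCoeff (h l) ξ‖ ≤ K * ‖c ξ‖)
    (hlim : ∀ ξ, Tendsto (fun l => fourierCoeff (h l) ξ) atTop (𝓝 (c ξ)))
    {q : ℝ≥0∞} (hq : 2 ≤ q) {B : ℝ≥0∞} (hB : B ≠ ⊤)
    (hb : ∀ l, eLpNorm (h l) q volume ≤ B) :
    ∃ f : Circ → ℂ, MemLp f q ∧ ∀ ξ, fourierCoeff f ξ = c ξ := by
  have hb2 : ∀ l, ∫ x, ‖h l x‖ ^ 2 ≤ B.toReal ^ 2 := fun l =>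
    integral_sq_le_of_eLpNorm_le (memLp_continuousMap _ _) hB
      ((eLpNorm_le_eLpNorm_of_exponent_le hq (h l).continuous.aestronglyMeasurable).trans (hb l))
  have hsum : Summable fun ξ => ‖c ξ‖ ^ 2 := by
    refine summable_of_sum_le (c := B.toReal ^ 2) (fun ξ => by positivity) fun S => ?_
    refine le_of_tendsto (tendsto_finsetSum S fun ξ _ => ((hlim ξ).norm.pow 2))
      (Eventually.of_forall fun l => ?_)
    exact (sum_le_hasSum S (fun _ _ => by positivity)
      (hasSum_sq_fourierCoeff_of_memLp (memLp_continuousMap (h l) 2))).trans (hb2 l)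
  -- `F` is the function in `L²` with Fourier coefficients `c`; dominated convergence gives
  -- `h l → F` in `L²`, and Fatou's lemma then transfers the `L^q` bound to `F`.
  let v : lp (fun _ : ℤ => ℂ) 2 := ⟨c, memℓp_gen (by simpa using hsum)⟩
  let F := (fourierBasis (T := (1 : ℝ))).repr.symm v
  have hFc : ∀ ξ, fourierCoeff F ξ = c ξ := by
    intro ξ
    rw [← fourierBasis_repr]
    simp only [F, LinearIsometryEquiv.apply_symm_apply]
    rfl
  have hF2 : MemLp F 2 (volume : Measure Circ) := (Lp.memLp F).of_haarAddCircle
  have hFint : MeasureTheory.Integrable F (volume : Measure Circ) :=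
    hF2.integrable (by norm_num)
  have hd : ∀ l, MemLp (h l - F : Circ → ℂ) 2 := fun l => (memLp_continuousMap (h l) 2).sub hF2
  have hconv : Tendsto (fun l => ∫ x, ‖(h l - F : Circ → ℂ) x‖ ^ 2) atTop (𝓝 0) := by
    have h1 : ∀ l, ∫ x, ‖(h l - F : Circ → ℂ) x‖ ^ 2
        = ∑' ξ, ‖fourierCoeff (h l) ξ - c ξ‖ ^ 2 := by
      intro l
      rw [← (hasSum_sq_fourierCoeff_of_memLp (hd l)).tsum_eq]
      refine tsum_congr fun ξ => ?_
      rw [fourierCoeff_sub_of_integrable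
        ((h l).continuous.integrable_of_compact _) hFint, hFc]
    simp only [h1]
    have h0 : (0 : ℝ) = ∑' _ : ℤ, (0 : ℝ) := by simp
    rw [h0]
    refine tendsto_tsum_of_dominated_convergence (hsum.mul_left ((K + 1) ^ 2)) (fun ξ => ?_)
      (Eventually.of_forall fun l ξ => ?_)
    · have := ((hlim ξ).sub_const (c ξ)).norm.pow 2
      simpa using this
    · rw [Real.norm_of_nonneg (by positivity), ← mul_pow]
      refine pow_le_pow_left₀ (norm_nonneg _) ?_ 2
      refine (norm_sub_le _ _).trans ?_
      rw [add_mul, one_mul]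
      gcongr
      exact hK l ξ
  have hm : TendstoInMeasure (volume : Measure Circ) (fun l => (h l : Circ → ℂ)) atTop F :=
    tendstoInMeasure_of_tendsto_eLpNorm two_ne_zero
      (fun l => (h l).continuous.aestronglyMeasurable) hF2.1
      (tendsto_eLpNorm_two_of_integral hd hconv)
  refine ⟨F, ⟨hF2.1, ?_⟩, hFc⟩
  exact (eLpNorm_le_of_tendstoInMeasure (Eventually.of_forall hb) hm
    (fun l => (h l).continuous.aestronglyMeasurable)).trans_lt hB.lt_top

end Parseval

/-! ### Approximate identities in `L^q` -/

section Conv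

open scoped ENNReal

/-- The convolution `D ∗ f` of a continuous real kernel and a function on the circle. -/
def circleConv (D : C(Circ, ℝ)) (f : Circ → ℂ) (x : Circ) : ℂ := ∫ y, (D (x - y) : ℂ) * f y

theorem circleConv_congr_ae (D : C(Circ, ℝ)) {f g : Circ → ℂ} (h : f =ᵐ[volume] g) :
    circleConv D f = circleConv D g := by
  ext x
  refine integral_congr_ae ?_
  filter_upwards [h] with y hy
  rw [hy]

theorem integrable_kernel_mul (D : C(Circ, ℝ)) {f : Circ → ℂ} (hf : MeasureTheory.Integrable f)
    (x : Circ) : MeasureTheory.Integrable fun y => (D (x - y) : ℂ) * f y :=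
  hf.bdd_mul (c := ‖D‖) (Continuous.aestronglyMeasurable (by fun_prop))
    (ae_of_all _ fun y => by rw [Complex.norm_real]; exact D.norm_coe_le_norm _)

theorem continuous_circleConv (D : C(Circ, ℝ)) {f : Circ → ℂ} (hf : MeasureTheory.Integrable f) :
    Continuous (circleConv D f) := by
  refine continuous_of_dominated (bound := fun y => ‖D‖ * ‖f y‖)
    (fun x => (integrable_kernel_mul D hf x).1) (fun x => ae_of_all _ fun y => ?_)
    (hf.norm.const_mul _) (ae_of_all _ fun y => ?_)
  · rw [norm_mul, Complex.norm_real]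
    exact mul_le_mul_of_nonneg_right (D.norm_coe_le_norm _) (norm_nonneg _)
  · fun_prop

theorem circleConv_sub (D : C(Circ, ℝ)) {f g : Circ → ℂ} (hf : MeasureTheory.Integrable f)
    (hg : MeasureTheory.Integrable g) :
    circleConv D (f - g) = circleConv D f - circleConv D g := by
  ext x
  simp only [circleConv, Pi.sub_apply, mul_sub]
  exact integral_sub (integrable_kernel_mul D hf x) (integrable_kernel_mul D hg x)

theorem circleConv_add (D : C(Circ, ℝ)) {f g : Circ → ℂ} (hf : MeasureTheory.Integrable f)
    (hg : MeasureTheory.Integrable g) :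
    circleConv D (f + g) = circleConv D f + circleConv D g := by
  ext x
  simp only [circleConv, Pi.add_apply, mul_add]
  exact integral_add (integrable_kernel_mul D hf x) (integrable_kernel_mul D hg x)

theorem circleConv_smul (D : C(Circ, ℝ)) (c : ℂ) (f : Circ → ℂ) :
    circleConv D (c • f) = c • circleConv D f := by
  ext x
  simp only [circleConv, Pi.smul_apply, smul_eq_mul]
  rw [← integral_const_mul]
  congr 1
  ext y
  ring

theorem circleConv_fourier (D : C(Circ, ℝ)) (ξ : ℤ) :
    circleConv D (fourier ξ) = fourierCoeff (fun x => (D x : ℂ)) ξ • (fourier ξ : Circ → ℂ) := by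
  ext x
  rw [circleConv, fourierCoeff_eq_integral, Pi.smul_apply, smul_eq_mul, ← integral_mul_const,
    ← integral_sub_left_eq_self _ _ x]
  refine integral_congr_ae (ae_of_all _ fun y => ?_)
  simp only [sub_sub_cancel]
  rw [sub_eq_add_neg, fourier_add_apply, fourier_neg_apply]
  ring

/-- Young's inequality `‖D ∗ f‖_q ≤ ‖D‖₁ ‖f‖_q`. -/
theorem eLpNorm_circleConv_le (D : C(Circ, ℝ)) {f : Circ → ℂ} {q : ℝ≥0∞} (hq : 1 ≤ q)
    (hqt : q ≠ ⊤) (hf : MemLp f q) :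
    eLpNorm (circleConv D f) q volume ≤ (∫⁻ x, ‖D x‖ₑ) * eLpNorm f q volume := by
  wlog hfm : StronglyMeasurable f generalizing f
  · obtain ⟨g, hg, hfg⟩ := hf.1
    have := this (hf.ae_eq hfg) hg
    rwa [circleConv_congr_ae D hfg, eLpNorm_congr_ae hfg]
  have hq0 : q ≠ 0 := (zero_lt_one.trans_le hq).ne'
  have hqr : 1 ≤ q.toReal := by
    rw [← ENNReal.toReal_one]; exact ENNReal.toReal_mono hqt hq
  have hqp : 0 < q.toReal := by linarith
  have hDm : Measurable fun z => ‖D z‖ₑ := D.continuous.measurable.enorm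
  set κ : Measure Circ := volume.withDensity fun z => ‖D z‖ₑ with hκ
  have hκu : κ Set.univ = ∫⁻ x, ‖D x‖ₑ := by rw [hκ, withDensity_apply _ .univ]; simp
  have hpt : ∀ x, ‖circleConv D f x‖ₑ ^ q.toReal
      ≤ (κ Set.univ) ^ (q.toReal - 1) * ∫⁻ z, ‖f (x - z)‖ₑ ^ q.toReal ∂κ := by
    intro x
    have hfx : StronglyMeasurable fun z => f (x - z) :=
      hfm.comp_measurable (measurable_const.sub measurable_id)
    have h1 : ‖circleConv D f x‖ₑ ≤ eLpNorm (fun z => f (x - z)) 1 κ := by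
      rw [eLpNorm_one_eq_lintegral_enorm, hκ, lintegral_withDensity_eq_lintegral_mul _ hDm
        hfx.enorm]
      refine (enorm_integral_le_lintegral_enorm _).trans (le_of_eq ?_)
      rw [← lintegral_sub_left_eq_self _ x]
      refine lintegral_congr fun z => ?_
      simp only [sub_sub_cancel, enorm_mul, Pi.mul_apply]
      congr 1
      rw [← ofReal_norm, Complex.norm_real, ofReal_norm]
    have h2 := eLpNorm_le_eLpNorm_mul_rpow_measure_univ hq (μ := κ)
      (hfx.aestronglyMeasurable)
    calc ‖circleConv D f x‖ₑ ^ q.toReal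
        ≤ (eLpNorm (fun z => f (x - z)) q κ
            * κ Set.univ ^ (1 / (1 : ℝ≥0∞).toReal - 1 / q.toReal)) ^ q.toReal := by
          gcongr; exact h1.trans h2
      _ = _ := by
          rw [ENNReal.mul_rpow_of_nonneg _ _ hqp.le, eLpNorm_eq_lintegral_rpow_enorm_toReal hq0 hqt,
            ← ENNReal.rpow_mul, ← ENNReal.rpow_mul, one_div_mul_cancel hqp.ne', ENNReal.rpow_one,
            mul_comm]
          congr 2
          simp only [ENNReal.toReal_one]
          field_simp
  have hint : ∫⁻ x, ‖circleConv D f x‖ₑ ^ q.toReal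
      ≤ (κ Set.univ) ^ q.toReal * ∫⁻ x, ‖f x‖ₑ ^ q.toReal := by
    have : IsFiniteMeasure κ := ⟨by
      rw [hκu]
      have := (D.continuous.integrable_of_compact (volume : Measure Circ)).2
      exact this⟩
    have hmeas : Measurable (Function.uncurry fun x z : Circ => ‖f (x - z)‖ₑ ^ q.toReal) :=
      ((hfm.measurable.comp (measurable_fst.sub measurable_snd)).enorm).pow_const _
    calc ∫⁻ x, ‖circleConv D f x‖ₑ ^ q.toReal
        ≤ ∫⁻ x, (κ Set.univ) ^ (q.toReal - 1) * ∫⁻ z, ‖f (x - z)‖ₑ ^ q.toReal ∂κ :=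
          lintegral_mono hpt
      _ = (κ Set.univ) ^ (q.toReal - 1) * ∫⁻ x, ∫⁻ z, ‖f (x - z)‖ₑ ^ q.toReal ∂κ := by
          exact lintegral_const_mul _ hmeas.lintegral_prod_right'
      _ = (κ Set.univ) ^ (q.toReal - 1) * ∫⁻ z, ∫⁻ x, ‖f (x - z)‖ₑ ^ q.toReal ∂volume ∂κ := by
          rw [lintegral_lintegral_swap hmeas.aemeasurable]
      _ = (κ Set.univ) ^ (q.toReal - 1) * ((∫⁻ x, ‖f x‖ₑ ^ q.toReal) * κ Set.univ) := by
          congr 1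
          rw [← lintegral_const]
          refine lintegral_congr fun z => ?_
          exact lintegral_sub_right_eq_self (fun x => ‖f x‖ₑ ^ q.toReal) z
      _ = _ := by
          rw [mul_comm (∫⁻ x, ‖f x‖ₑ ^ q.toReal), ← mul_assoc]
          congr 1
          nth_rewrite 2 [← ENNReal.rpow_one (κ Set.univ)]
          rw [← ENNReal.rpow_add_of_nonneg _ _ (by linarith) zero_le_one]
          congr 1
          ring
  rw [eLpNorm_eq_lintegral_rpow_enorm_toReal hq0 hqt,
    eLpNorm_eq_lintegral_rpow_enorm_toReal hq0 hqt, ← hκu]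
  calc (∫⁻ x, ‖circleConv D f x‖ₑ ^ q.toReal) ^ (1 / q.toReal)
      ≤ ((κ Set.univ) ^ q.toReal * ∫⁻ x, ‖f x‖ₑ ^ q.toReal) ^ (1 / q.toReal) := by
        gcongr
    _ = _ := by
        rw [ENNReal.mul_rpow_of_nonneg _ _ (by positivity), ← ENNReal.rpow_mul,
          mul_one_div_cancel hqp.ne', ENNReal.rpow_one]

theorem IsApproxIdentity.lintegral_le {D : ℕ → C(Circ, ℝ)} (hD : IsApproxIdentity D) :
    ∃ K : NNReal, ∀ n, ∫⁻ x, ‖D n x‖ₑ ≤ K := by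
  obtain ⟨K, hK⟩ := hD.bound
  refine ⟨K.toNNReal, fun n => ?_⟩
  rw [← ofReal_integral_norm_eq_lintegral_enorm ((D n).continuous.integrable_of_compact _)]
  exact ENNReal.ofReal_le_ofReal (hK n)

/-- For an approximate identity `D`, the convolutions `D n ∗ f` converge to `f` in `L^q`. -/
theorem tendsto_eLpNorm_circleConv_sub {D : ℕ → C(Circ, ℝ)} (hD : IsApproxIdentity D)
    {q : ℝ≥0∞} (hq : 1 ≤ q) (hqt : q ≠ ⊤) {f : Circ → ℂ} (hf : MemLp f q) :
    Tendsto (fun n => eLpNorm (circleConv (D n) f - f) q volume) atTop (𝓝 0) := by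
  have : Fact (1 ≤ q) := ⟨hq⟩
  obtain ⟨K, hK⟩ := hD.lintegral_le
  -- The class of functions for which the conclusion holds is a closed subspace of `L^q`
  -- containing the characters.
  let S : Submodule ℂ (Lp ℂ q (AddCircle.haarAddCircle (T := (1 : ℝ)))) :=
    { carrier := {g | Tendsto (fun n => eLpNorm (circleConv (D n) g - (g : Circ → ℂ)) q volume)
        atTop (𝓝 0)}
      zero_mem' := by
        have h0 : ((0 : Lp ℂ q (AddCircle.haarAddCircle (T := (1 : ℝ)))) : Circ → ℂ)
            =ᵐ[volume] 0 := by
          rw [← haarAddCircle_eq_volume]; exact Lp.coeFn_zero _ _ _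
        refine tendsto_const_nhds.congr fun n => ?_
        rw [circleConv_congr_ae _ h0, eLpNorm_congr_ae (EventuallyEq.sub EventuallyEq.rfl h0)]
        have : circleConv (D n) 0 = 0 := by ext x; simp [circleConv]
        simp [this]
      add_mem' := by
        intro g h hg hh
        have ha : ((g + h : Lp ℂ q (AddCircle.haarAddCircle (T := (1 : ℝ)))) : Circ → ℂ)
            =ᵐ[volume] (g : Circ → ℂ) + h := by
          rw [← haarAddCircle_eq_volume]; exact Lp.coeFn_add _ _
        have mg : MemLp g q (volume : Measure Circ) := (Lp.memLp g).of_haarAddCircle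
        have mh : MemLp h q (volume : Measure Circ) := (Lp.memLp h).of_haarAddCircle
        have ig := mg.integrable hq
        have ih := mh.integrable hq
        have hgh := Tendsto.add hg hh
        rw [add_zero] at hgh
        refine tendsto_of_tendsto_of_tendsto_of_le_of_le tendsto_const_nhds hgh
          (fun _ => zero_le) fun n => ?_
        simp only
        rw [circleConv_congr_ae _ ha, eLpNorm_congr_ae (EventuallyEq.sub EventuallyEq.rfl ha),
          circleConv_add _ ig ih, add_sub_add_comm]
        exact eLpNorm_add_le
          ((continuous_circleConv _ ig).aestronglyMeasurable.sub mg.1)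
          ((continuous_circleConv _ ih).aestronglyMeasurable.sub mh.1) hq
      smul_mem' := by
        intro c g hg
        have ha : ((c • g : Lp ℂ q (AddCircle.haarAddCircle (T := (1 : ℝ)))) : Circ → ℂ)
            =ᵐ[volume] c • (g : Circ → ℂ) := by
          rw [← haarAddCircle_eq_volume]; exact Lp.coeFn_smul _ _
        have hcg := ENNReal.Tendsto.const_mul (a := ‖c‖ₑ) hg (Or.inr enorm_ne_top)
        rw [mul_zero] at hcg
        refine hcg.congr fun n => ?_
        rw [circleConv_congr_ae _ ha, eLpNorm_congr_ae (EventuallyEq.sub EventuallyEq.rfl ha),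
          circleConv_smul, ← smul_sub, eLpNorm_const_smul] }
  have hmemS : ∀ g : Lp ℂ q (AddCircle.haarAddCircle (T := (1 : ℝ))), g ∈ S ↔
      Tendsto (fun n => eLpNorm (circleConv (D n) g - (g : Circ → ℂ)) q volume) atTop (𝓝 0) :=
    fun g => Iff.rfl
  have hSf : ∀ ξ, fourierLp q ξ ∈ S := by
    intro ξ
    have ha : (fourierLp q ξ : Circ → ℂ) =ᵐ[volume] fourier ξ := by
      rw [← haarAddCircle_eq_volume]; exact coeFn_fourierLp q ξ
    have h1 := ((hD.coeff ξ).sub_const 1).enorm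
    rw [sub_self, enorm_zero] at h1
    have h2 := ENNReal.Tendsto.mul_const (b := eLpNorm (fourier ξ : Circ → ℂ) q volume) h1
      (Or.inr (memLp_continuousMap _ q).2.ne)
    rw [zero_mul] at h2
    refine (hmemS _).2 (h2.congr fun n => ?_)
    rw [circleConv_congr_ae _ ha, eLpNorm_congr_ae (EventuallyEq.sub EventuallyEq.rfl ha),
      circleConv_fourier, ← eLpNorm_const_smul, sub_smul, one_smul]
  have hSc : IsClosed (S : Set (Lp ℂ q (AddCircle.haarAddCircle (T := (1 : ℝ))))) := by
    refine isClosed_of_closure_subset fun g hg => ?_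
    refine (hmemS _).2 (ENNReal.tendsto_atTop_zero.2 fun ε hε => ?_)
    have hK2 : (K + 2 : ℝ≥0∞) ≠ ⊤ := by finiteness
    have hδ : 0 < ε / (K + 2) := ENNReal.div_pos hε.ne' hK2
    set δ := ε / (K + 2)
    obtain ⟨h, hhS, hgh⟩ := EMetric.mem_closure_iff.1 hg δ hδ
    obtain ⟨N, hN⟩ := ENNReal.tendsto_atTop_zero.1 ((hmemS _).1 hhS) δ hδ
    refine ⟨N, fun n hn => ?_⟩
    have mg : MemLp g q (volume : Measure Circ) := (Lp.memLp g).of_haarAddCircle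
    have mh : MemLp h q (volume : Measure Circ) := (Lp.memLp h).of_haarAddCircle
    have ig := mg.integrable hq
    have ih := mh.integrable hq
    have hd : eLpNorm ((g : Circ → ℂ) - (h : Circ → ℂ)) q volume ≤ δ := by
      have hvol : ∀ F : Circ → ℂ, eLpNorm F q volume = eLpNorm F q AddCircle.haarAddCircle :=
        fun F => by rw [haarAddCircle_eq_volume]
      rw [Lp.edist_def] at hgh
      rw [hvol]
      exact hgh.le
    have e : circleConv (D n) g - (g : Circ → ℂ)
        = circleConv (D n) ((g : Circ → ℂ) - (h : Circ → ℂ))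
        + ((circleConv (D n) h - (h : Circ → ℂ)) + ((h : Circ → ℂ) - (g : Circ → ℂ))) := by
      rw [circleConv_sub _ ig ih]; abel
    have m1 := (continuous_circleConv (D n) (ig.sub ih)).aestronglyMeasurable (μ := volume)
    have m2 := ((continuous_circleConv (D n) ih).aestronglyMeasurable (μ := volume)).sub mh.1
    calc eLpNorm (circleConv (D n) g - (g : Circ → ℂ)) q volume
        ≤ K * δ + (δ + δ) := by
          rw [e]
          refine (eLpNorm_add_le m1 (m2.add (mh.1.sub mg.1)) hq).trans (add_le_add ?_ ?_)
          · exact (eLpNorm_circleConv_le (D n) hq hqt (mg.sub mh)).trans (mul_le_mul' (hK n) hd)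
          · refine (eLpNorm_add_le m2 (mh.1.sub mg.1) hq).trans (add_le_add (hN n hn) ?_)
            rwa [eLpNorm_sub_comm]
      _ = (K + 2) * δ := by ring
      _ = ε := ENNReal.mul_div_cancel (by positivity) hK2
  have hS : S = ⊤ := top_le_iff.1 (by
    rw [← span_fourierLp_closure_eq_top hqt]
    exact Submodule.topologicalClosure_minimal _
      (Submodule.span_le.2 (Set.range_subset_iff.2 hSf)) hSc)
  have hf' : MemLp f q AddCircle.haarAddCircle := hf.haarAddCircle
  have hfS : hf'.toLp f ∈ S := by rw [hS]; trivial
  have ha : (hf'.toLp f : Circ → ℂ) =ᵐ[volume] f := by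
    rw [← haarAddCircle_eq_volume]; exact hf'.coeFn_toLp
  refine ((hmemS _).1 hfS).congr fun n => ?_
  rw [circleConv_congr_ae _ ha, eLpNorm_congr_ae (EventuallyEq.sub EventuallyEq.rfl ha)]

end Conv

/-! ### A Cauchy–Schwarz inequality for cubes -/

section Cube

/-- Jensen's inequality for the powers `2 ^ m`, with a probability density `w` as weight. -/
theorem pow_integral_mul_le {X : Type*} [TopologicalSpace X] [CompactSpace X] [MeasurableSpace X]
    [BorelSpace X] (ρ : Measure X) [IsFiniteMeasure ρ] {w : X → ℝ} (hw : Continuous w)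
    (hw0 : ∀ x, 0 ≤ w x) (hw1 : ∫ x, w x ∂ρ = 1) (m : ℕ) {g : X → ℝ} (hg : Continuous g) :
    (∫ x, w x * g x ∂ρ) ^ 2 ^ m ≤ ∫ x, w x * g x ^ 2 ^ m ∂ρ := by
  induction m generalizing g with
  | zero => simp
  | succ m ih =>
    have hcs : (∫ x, w x * g x ∂ρ) ^ 2 ≤ ∫ x, w x * g x ^ 2 ∂ρ := by
      obtain ⟨c, hc⟩ : ∃ c, c = ∫ x, w x * g x ∂ρ := ⟨_, rfl⟩
      have h0 : 0 ≤ ∫ x, w x * (g x - c) ^ 2 ∂ρ :=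
        integral_nonneg fun x => mul_nonneg (hw0 x) (sq_nonneg _)
      have e : ∫ x, w x * (g x - c) ^ 2 ∂ρ
          = ∫ x, w x * g x ^ 2 ∂ρ - 2 * c * ∫ x, w x * g x ∂ρ + c ^ 2 * ∫ x, w x ∂ρ := by
        rw [← integral_const_mul, ← integral_const_mul, ← integral_sub, ← integral_add]
        · exact integral_congr_ae (ae_of_all _ fun x => by ring)
        all_goals exact Continuous.integrable_of_compact _ (by fun_prop)
      rw [e, ← hc, hw1] at h0
      rw [← hc]
      nlinarith
    calc (∫ x, w x * g x ∂ρ) ^ 2 ^ (m + 1) = ((∫ x, w x * g x ∂ρ) ^ 2) ^ 2 ^ m := by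
          rw [← pow_mul, pow_succ']
      _ ≤ (∫ x, w x * g x ^ 2 ∂ρ) ^ 2 ^ m := by gcongr
      _ ≤ ∫ x, w x * (g x ^ 2) ^ 2 ^ m ∂ρ := ih (hg.pow 2)
      _ = _ := by simp only [← pow_mul, ← pow_succ']

/-- The translate `f(· + a)`. -/
def circShift (a : Circ) (f : C(Circ, ℝ)) : C(Circ, ℝ) := ⟨fun x => f (x + a), by fun_prop⟩

/-- The multiplicative derivative `x ↦ f(x) f(x + v)`. -/
def shiftMul (f : C(Circ, ℝ)) (v : Circ) : C(Circ, ℝ) := ⟨fun x => f x * f (x + v), by fun_prop⟩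

theorem continuous_circShift (f : C(Circ, ℝ)) : Continuous fun a => circShift a f :=
  (ContinuousMap.curry ⟨fun p : Circ × Circ => f (p.2 + p.1), by fun_prop⟩).continuous

theorem continuous_shiftMul (f : C(Circ, ℝ)) : Continuous (shiftMul f) :=
  (ContinuousMap.curry ⟨fun p : Circ × Circ => f p.2 * f (p.2 + p.1), by fun_prop⟩).continuous

theorem continuous_integral_mul_add (ψ f : C(Circ, ℝ)) :
    Continuous fun y => ∫ a, ψ a * f (y + a) := by
  refine continuous_of_dominated (bound := fun _ => ‖ψ‖ * ‖f‖) (fun x => ?_) (fun x => ?_)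
    (integrable_const _) (ae_of_all _ fun y => by fun_prop)
  · exact Continuous.aestronglyMeasurable (by fun_prop)
  · refine ae_of_all _ fun y => ?_
    rw [norm_mul]
    exact mul_le_mul (ψ.norm_coe_le_norm _) (f.norm_coe_le_norm _) (norm_nonneg _) (norm_nonneg _)

/-- The averaging operator `f ↦ ∫ ψ(a) f(· + a) da`. -/
def averageOp (ψ : C(Circ, ℝ)) : C(Circ, ℝ) →L[ℝ] C(Circ, ℝ) :=
  LinearMap.mkContinuous
    { toFun := fun f => ⟨fun y => ∫ a, ψ a * f (y + a), continuous_integral_mul_add ψ f⟩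
      map_add' := fun f g => by
        ext y
        simp only [ContinuousMap.coe_mk, ContinuousMap.add_apply, mul_add]
        exact integral_add (Continuous.integrable_of_compact _ (by fun_prop))
          (Continuous.integrable_of_compact _ (by fun_prop))
      map_smul' := fun c f => by
        ext y
        simp only [ContinuousMap.coe_mk, ContinuousMap.smul_apply, smul_eq_mul, RingHom.id_apply]
        rw [← integral_const_mul]
        exact integral_congr_ae (ae_of_all _ fun x => by ring) }
    ‖ψ‖ (fun f => by
      refine (ContinuousMap.norm_le _ (by positivity)).2 fun y => ?_
      refine (norm_integral_le_of_norm_le_const (C := ‖ψ‖ * ‖f‖) (ae_of_all _ fun a => ?_)).trans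
        (by simp)
      rw [norm_mul]
      exact mul_le_mul (ψ.norm_coe_le_norm _) (f.norm_coe_le_norm _) (norm_nonneg _)
        (norm_nonneg _))

theorem averageOp_apply (ψ f : C(Circ, ℝ)) (y : Circ) :
    averageOp ψ f y = ∫ a, ψ a * f (y + a) := rfl

/-- The autocorrelation `v ↦ ∫ ψ(a) ψ(a + v) da`. -/
def autocorr (ψ : C(Circ, ℝ)) : C(Circ, ℝ) :=
  ⟨fun v => ∫ a, ψ a * ψ (v + a), continuous_integral_mul_add ψ ψ⟩

theorem autocorr_apply (ψ : C(Circ, ℝ)) (v : Circ) :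
    autocorr ψ v = ∫ a, ψ a * ψ (v + a) := rfl

theorem autocorr_nonneg {ψ : C(Circ, ℝ)} (h : ∀ x, 0 ≤ ψ x) (v : Circ) : 0 ≤ autocorr ψ v :=
  integral_nonneg fun _ => mul_nonneg (h _) (h _)

/-- Integrating against the autocorrelation amounts to integrating a function of the difference of
two independent variables of density `ψ`. -/
theorem integral_autocorr_mul (ψ : C(Circ, ℝ)) {E : Circ → ℝ} (hE : Continuous E) :
    ∫ v, autocorr ψ v * E v = ∫ p : Circ × Circ, (ψ p.1 * ψ p.2) * E (p.2 - p.1) := by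
  have h1 : MeasureTheory.Integrable
      (fun p : Circ × Circ => ψ p.2 * ψ (p.1 + p.2) * E p.1) (volume.prod volume) :=
    Continuous.integrable_of_compact _ (by fun_prop)
  have h2 : MeasureTheory.Integrable
      (fun p : Circ × Circ => (ψ p.1 * ψ p.2) * E (p.2 - p.1)) (volume.prod volume) :=
    Continuous.integrable_of_compact _ (by fun_prop)
  simp only [autocorr_apply, ← integral_mul_const]
  rw [integral_integral_swap h1]
  refine Eq.trans ?_ (integral_prod _ h2).symm
  refine integral_congr_ae (ae_of_all _ fun a => ?_)
  simp only
  rw [← integral_sub_right_eq_self _ a]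
  simp

theorem integral_autocorr {ψ : C(Circ, ℝ)} (h1 : ∫ x, ψ x = 1) : ∫ v, autocorr ψ v = 1 := by
  have h := integral_autocorr_mul ψ (E := fun _ => 1) continuous_const
  simp only [mul_one] at h
  rw [h]
  refine (integral_prod_mul (fun x => ψ x) (fun x => ψ x)).trans ?_
  rw [h1, one_mul]

theorem averageOp_circShift (ψ f : C(Circ, ℝ)) (a : Circ) :
    averageOp ψ (circShift a f) = circShift a (averageOp ψ f) := by
  ext y
  simp only [averageOp_apply, circShift, ContinuousMap.coe_mk]
  refine integral_congr_ae (ae_of_all _ fun b => ?_)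
  simp only
  congr 2
  abel

theorem averageOp_pow_circShift (ψ : C(Circ, ℝ)) (j : ℕ) (f : C(Circ, ℝ)) (a : Circ) :
    (averageOp ψ ^ j) (circShift a f) = circShift a ((averageOp ψ ^ j) f) := by
  induction j generalizing f with
  | zero => rfl
  | succ j ih =>
    simp only [pow_succ, ContinuousLinearMap.mul_def, ContinuousLinearMap.comp_apply,
      averageOp_circShift, ih]

theorem sq_averageOp_pow_le {ψ : C(Circ, ℝ)} (h : ∀ x, 0 ≤ ψ x) (h1 : ∫ x, ψ x = 1) (j : ℕ)
    (f : C(Circ, ℝ)) (y : Circ) :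
    ((averageOp ψ ^ j) f y) ^ 2 ≤ (averageOp ψ ^ j) (f * f) y := by
  induction j generalizing y with
  | zero => simp [sq]
  | succ j ih =>
    rw [pow_succ' (averageOp ψ), ContinuousLinearMap.mul_def, ContinuousLinearMap.comp_apply,
      ContinuousLinearMap.comp_apply]
    have hJ := pow_integral_mul_le (volume : Measure Circ) ψ.continuous h h1 1
      (g := fun a => ((averageOp ψ ^ j) f) (y + a)) (by fun_prop)
    simp only [pow_one] at hJ
    refine hJ.trans ?_
    rw [averageOp_apply]
    exact integral_mono (Continuous.integrable_of_compact _ (by fun_prop))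
      (Continuous.integrable_of_compact _ (by fun_prop)) fun a =>
        mul_le_mul_of_nonneg_left (ih _) (h a)

theorem continuous_integral_averageOp_pow (ψ : C(Circ, ℝ)) (j M : ℕ) :
    Continuous fun f : C(Circ, ℝ) => ∫ y, ((averageOp ψ ^ j) f y) ^ M := by
  have h : Continuous fun f : C(Circ, ℝ) => ((averageOp ψ ^ j) f) ^ M :=
    ((averageOp ψ ^ j).continuous).pow M
  have hI : Continuous fun f : C(Circ, ℝ) => ∫ y, f y := by
    refine (LipschitzWith.of_dist_le_mul (K := 1) fun f g => ?_).continuous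
    rw [NNReal.coe_one, one_mul, dist_eq_norm, dist_eq_norm,
      ← integral_sub (f.continuous.integrable_of_compact _) (g.continuous.integrable_of_compact _)]
    exact (norm_integral_le_of_norm_le_const (C := ‖f - g‖)
      (ae_of_all _ fun x => (f - g).norm_coe_le_norm x)).trans (by simp)
  exact hI.comp h

/-- One step of the iterated Cauchy–Schwarz argument: averaging the `2^j`-th moment of the averages
of `f · f(· + v)` against the autocorrelation dominates the next moment. -/
theorem integral_averageOp_pow_succ_le {ψ : C(Circ, ℝ)} (h : ∀ x, 0 ≤ ψ x) (h1 : ∫ x, ψ x = 1)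
    (j : ℕ) (f : C(Circ, ℝ)) :
    ∫ y, ((averageOp ψ ^ (j + 1)) f y) ^ 2 ^ (j + 1)
      ≤ ∫ v, autocorr ψ v * ∫ y, ((averageOp ψ ^ j) (shiftMul f v) y) ^ 2 ^ j := by
  have hc := continuous_integral_averageOp_pow ψ j (2 ^ j)
  have hE := integral_autocorr_mul ψ (hc.comp (continuous_shiftMul f))
  simp only [Function.comp_apply] at hE
  rw [hE]
  -- `v` is the difference `p.2 - p.1` of two independent variables of density `ψ`; translating by
  -- `p.1` turns `f · f(· + v)` into the product `P p` of two independent translates.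
  let P : Circ × Circ → C(Circ, ℝ) := fun p => circShift p.1 f * circShift p.2 f
  have hP : Continuous P :=
    ((continuous_circShift f).comp continuous_fst).mul
      ((continuous_circShift f).comp continuous_snd)
  have hw : Continuous fun p : Circ × Circ => ψ p.1 * ψ p.2 := by fun_prop
  have hw1 : ∫ p : Circ × Circ, ψ p.1 * ψ p.2 = 1 := by
    refine (integral_prod_mul (fun x => ψ x) (fun x => ψ x)).trans ?_
    rw [h1, one_mul]
  have hshift : ∀ p : Circ × Circ, ∫ y, ((averageOp ψ ^ j) (shiftMul f (p.2 - p.1)) y) ^ 2 ^ j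
      = ∫ y, ((averageOp ψ ^ j) (P p) y) ^ 2 ^ j := by
    intro p
    have e : P p = circShift p.1 (shiftMul f (p.2 - p.1)) := by
      ext x
      simp only [P, circShift, shiftMul, ContinuousMap.mul_apply, ContinuousMap.coe_mk]
      congr 2
      abel
    rw [e, averageOp_pow_circShift]
    exact (integral_add_right_eq_self
      (fun y => ((averageOp ψ ^ j) (shiftMul f (p.2 - p.1)) y) ^ 2 ^ j) p.1).symm
  simp only [hshift, ← integral_const_mul]
  have hAP : Continuous fun q : (Circ × Circ) × Circ => (averageOp ψ ^ j) (P q.1) q.2 := by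
    have : Continuous fun p => (averageOp ψ ^ j) (P p) := (averageOp ψ ^ j).continuous.comp hP
    fun_prop
  rw [integral_integral_swap (μ := (volume : Measure (Circ × Circ)))
    (f := fun p y => ψ p.1 * ψ p.2 * ((averageOp ψ ^ j) (P p) y) ^ 2 ^ j)
    (Continuous.integrable_of_compact _ (by fun_prop))]
  refine integral_mono (Continuous.integrable_of_compact _ (by fun_prop)) ?_ fun y => ?_
  · exact MeasureTheory.Integrable.integral_prod_right
      (f := fun q : (Circ × Circ) × Circ =>
        ψ q.1.1 * ψ q.1.2 * ((averageOp ψ ^ j) (P q.1) q.2) ^ 2 ^ j)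
      (Continuous.integrable_of_compact _ (by fun_prop))
  · -- The average over `p` of the products `P p` is `(averageOp ψ f)²`.
    have hbar : ∫ p : Circ × Circ, (ψ p.1 * ψ p.2) • P p = averageOp ψ f * averageOp ψ f := by
      ext z
      have hint : MeasureTheory.Integrable (fun p : Circ × Circ => (ψ p.1 * ψ p.2) • P p) :=
        Continuous.integrable_of_compact _ (hw.smul hP)
      rw [ContinuousMap.integral_apply hint z]
      simp only [ContinuousMap.smul_apply, smul_eq_mul, ContinuousMap.mul_apply, averageOp_apply, P,
        circShift, ContinuousMap.coe_mk]
      refine Eq.trans ?_ (integral_prod_mul (fun a => ψ a * f (z + a)) (fun a => ψ a * f (z + a)))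
      exact integral_congr_ae (ae_of_all _ fun p => by ring)
    have hcomm : ∫ p : Circ × Circ, (ψ p.1 * ψ p.2) * (averageOp ψ ^ j) (P p) y
        = (averageOp ψ ^ j) (averageOp ψ f * averageOp ψ f) y := by
      have hint : MeasureTheory.Integrable (fun p : Circ × Circ => (ψ p.1 * ψ p.2) • P p) :=
        Continuous.integrable_of_compact _ (hw.smul hP)
      rw [← hbar, ← ContinuousLinearMap.integral_comp_comm _ hint,
        ContinuousMap.integral_apply ((averageOp ψ ^ j).integrable_comp hint)]
      simp
    simp only
    calc ((averageOp ψ ^ (j + 1)) f y) ^ 2 ^ (j + 1)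
        = (((averageOp ψ ^ j) (averageOp ψ f) y) ^ 2) ^ 2 ^ j := by
          rw [← pow_mul, ← pow_succ', pow_succ (averageOp ψ), ContinuousLinearMap.mul_def,
            ContinuousLinearMap.comp_apply]
      _ ≤ ((averageOp ψ ^ j) (averageOp ψ f * averageOp ψ f) y) ^ 2 ^ j := by
          gcongr
          exact sq_averageOp_pow_le h h1 j _ y
      _ ≤ _ := by
          rw [← hcomm]
          exact pow_integral_mul_le (volume : Measure (Circ × Circ)) hw
            (fun p => mul_nonneg (h _) (h _)) hw1 j (by fun_prop)

/-- Splitting off the first direction of a cube product. -/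
theorem cubeProduct_cons (k : ℕ) (f : C(Circ, ℝ)) (x v : Circ) (u : Fin k → Circ) :
    cubeProduct (k + 1) f x (Fin.cons v u) = cubeProduct k (shiftMul f v) x u := by
  unfold cubeProduct
  have huniv : (Finset.univ : Finset (Finset (Fin (k + 1))))
      = (insert 0 (Finset.univ.image Fin.succ)).powerset := by
    rw [show insert 0 (Finset.univ.image Fin.succ) = (Finset.univ : Finset (Fin (k + 1))) by
      ext i; cases i using Fin.cases <;> simp, Finset.powerset_univ]
  have hinj : Set.InjOn (Finset.image (Fin.succ : Fin k → Fin (k + 1)))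
      (Finset.univ : Finset (Finset (Fin k))) :=
    (Finset.image_injective (Fin.succ_injective k)).injOn
  rw [huniv, Finset.prod_powerset_insert (by simp), Finset.powerset_image, Finset.powerset_univ,
    Finset.prod_image hinj, Finset.prod_image hinj, ← Finset.prod_mul_distrib]
  refine Finset.prod_congr rfl fun s _ => ?_
  have h0 : (0 : Fin (k + 1)) ∉ s.image Fin.succ := by simp
  rw [Finset.sum_insert h0, Finset.sum_image (Fin.succ_injective k).injOn]
  simp only [Fin.cons_zero, Fin.cons_succ, shiftMul, ContinuousMap.coe_mk]
  congr 2
  abel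

theorem continuous_cubeProduct (k : ℕ) {f : Circ → ℝ} (hf : Continuous f) :
    Continuous fun p : Circ × (Fin k → Circ) => cubeProduct k f p.1 p.2 := by
  unfold cubeProduct
  fun_prop

/-- The weight `∏_{i < j} χ(u_i)` on the directions of a cube, with `χ` the autocorrelation of
`ψ`. -/
def cubeWeight (ψ : C(Circ, ℝ)) (k j : ℕ) (u : Fin k → Circ) : ℝ :=
  ∏ i : Fin k, if i.val < j then autocorr ψ (u i) else 1

theorem continuous_cubeWeight (ψ : C(Circ, ℝ)) (k j : ℕ) : Continuous (cubeWeight ψ k j) := by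
  unfold cubeWeight
  refine continuous_finsetProd _ fun i _ => ?_
  split_ifs
  · fun_prop
  · fun_prop

theorem cubeWeight_cons_zero (ψ : C(Circ, ℝ)) (k : ℕ) (v : Circ) (u : Fin k → Circ) :
    cubeWeight ψ (k + 1) 0 (Fin.cons v u) = cubeWeight ψ k 0 u := by
  simp [cubeWeight]

theorem cubeWeight_cons_succ (ψ : C(Circ, ℝ)) (k j : ℕ) (v : Circ) (u : Fin k → Circ) :
    cubeWeight ψ (k + 1) (j + 1) (Fin.cons v u) = autocorr ψ v * cubeWeight ψ k j u := by
  simp [cubeWeight, Fin.prod_univ_succ]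

/-- The weighted cube average of `f`. -/
def cubeAverage (ψ : C(Circ, ℝ)) (k j : ℕ) (f : C(Circ, ℝ)) : ℝ :=
  ∫ x : Circ, ∫ u : Fin k → Circ, cubeWeight ψ k j u * cubeProduct k f x u

/-- A continuous function on the torus `𝕋^{k+1}` is integrated by splitting off the first
coordinate. -/
theorem integral_pi_cons (k : ℕ) {F : (Fin (k + 1) → Circ) → ℝ} (hF : Continuous F) :
    ∫ u, F u = ∫ v : Circ, ∫ u : Fin k → Circ, F (Fin.cons v u) := by
  have hmp := (volume_preserving_piFinSuccAbove (fun _ : Fin (k + 1) => Circ) 0).symm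
  rw [← hmp.integral_comp (MeasurableEquiv.measurableEmbedding _)]
  have hc : Continuous fun p : Circ × (Fin k → Circ) => F (Fin.cons p.1 p.2) := by fun_prop
  refine Eq.trans ?_ (integral_prod (fun p : Circ × (Fin k → Circ) => F (Fin.cons p.1 p.2))
    (Continuous.integrable_of_compact _ hc))
  refine integral_congr_ae (ae_of_all _ fun p => ?_)
  simp [MeasurableEquiv.piFinSuccAbove, Fin.insertNthEquiv]

/-- If the weight splits off a factor `w` in the first direction, then so does the cube average. -/
theorem cubeAverage_step (ψ : C(Circ, ℝ)) (k j : ℕ) (f : C(Circ, ℝ)) {w : Circ → ℝ}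
    (hw : Continuous w) {j' : ℕ}
    (hcons : ∀ v u, cubeWeight ψ (k + 1) j (Fin.cons v u) = w v * cubeWeight ψ k j' u) :
    MeasureTheory.Integrable (fun v => w v * cubeAverage ψ k j' (shiftMul f v)) ∧
      cubeAverage ψ (k + 1) j f = ∫ v, w v * cubeAverage ψ k j' (shiftMul f v) := by
  have hW := continuous_cubeWeight ψ k j'
  have hbig : Continuous fun p : (Circ × Circ) × (Fin k → Circ) =>
      w p.1.1 * (cubeWeight ψ k j' p.2 * cubeProduct k (shiftMul f p.1.1) p.1.2 p.2) := by
    have : Continuous fun p : (Circ × Circ) × (Fin k → Circ) =>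
        cubeProduct k (shiftMul f p.1.1) p.1.2 p.2 := by
      simp only [cubeProduct, shiftMul, ContinuousMap.coe_mk]
      fun_prop
    fun_prop
  have hI1 := (Continuous.integrable_of_compact
    (((volume : Measure Circ).prod (volume : Measure Circ)).prod
      (volume : Measure (Fin k → Circ))) hbig).integral_prod_left
  simp only [integral_const_mul] at hI1
  have hI2 := hI1.integral_prod_left
  simp only [integral_const_mul] at hI2
  refine ⟨hI2, ?_⟩
  have h1 : cubeAverage ψ (k + 1) j f
      = ∫ x, ∫ v, w v * ∫ u, cubeWeight ψ k j' u * cubeProduct k (shiftMul f v) x u := by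
    refine integral_congr_ae (ae_of_all _ fun x => ?_)
    have hc : Continuous fun u : Fin (k + 1) → Circ =>
        cubeWeight ψ (k + 1) j u * cubeProduct (k + 1) f x u :=
      (continuous_cubeWeight ψ (k + 1) j).mul
        ((continuous_cubeProduct (k + 1) f.continuous).comp (by fun_prop : Continuous
          fun u : Fin (k + 1) → Circ => (x, u)))
    simp only
    rw [integral_pi_cons k hc]
    refine integral_congr_ae (ae_of_all _ fun v => ?_)
    simp only [hcons, cubeProduct_cons, mul_assoc, integral_const_mul]
  rw [h1, ← integral_integral_swap hI1]
  refine integral_congr_ae (ae_of_all _ fun v => ?_)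
  simp only [cubeAverage, integral_const_mul]

/-- Iterated Cauchy–Schwarz: the weighted cube average dominates the moment of order `2 ^ j` of the
`j`-fold `ψ`-average of `f`, raised to the power `2 ^ (k - j)`. -/
theorem pow_integral_averageOp_le_cubeAverage {ψ : C(Circ, ℝ)} (h : ∀ x, 0 ≤ ψ x)
    (h1 : ∫ x, ψ x = 1) (k j : ℕ) (hj : j ≤ k) (f : C(Circ, ℝ)) :
    (∫ y, ((averageOp ψ ^ j) f y) ^ 2 ^ j) ^ 2 ^ (k - j) ≤ cubeAverage ψ k j f := by
  induction k generalizing j f with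
  | zero =>
    obtain rfl : j = 0 := by omega
    simp [cubeAverage, cubeWeight, cubeProduct, Subsingleton.elim (default : Finset (Fin 0)) ∅]
  | succ k ih =>
    have hmass : (volume : Measure Circ).real Set.univ = 1 := by simp
    cases j with
    -- No weighted direction is left: the plain Cauchy–Schwarz inequality for the mean of `f`.
    | zero =>
      obtain ⟨hI, hS⟩ := cubeAverage_step ψ k 0 f (w := fun _ => 1) continuous_const (j' := 0)
        (fun v u => by rw [cubeWeight_cons_zero, one_mul])
      have hg : Continuous fun v => ∫ y, shiftMul f v y := by
        have := (continuous_integral_averageOp_pow ψ 0 1).comp (continuous_shiftMul f)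
        simpa [Function.comp_def] using this
      have hJ := pow_integral_mul_le (volume : Measure Circ) (w := fun _ => 1) continuous_const
        (fun _ => zero_le_one) (by simp) k hg
      have hsq : ∫ v, ∫ y, shiftMul f v y = (∫ y, f y) ^ 2 := by
        simp only [shiftMul, ContinuousMap.coe_mk]
        rw [integral_integral_swap (Continuous.integrable_of_compact _ (by fun_prop))]
        simp only [integral_const_mul]
        have : ∀ y, ∫ x, f (y + x) = ∫ x, f x := fun y =>
          integral_add_left_eq_self (fun x => f x) y
        simp only [this, integral_mul_const]
        ring
      rw [hS]
      simp only [one_mul, hsq] at hJ hI ⊢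
      calc _ = ((∫ y, f y) ^ 2) ^ 2 ^ k := by simp [← pow_mul, ← pow_succ']
        _ ≤ _ := hJ
        _ ≤ _ := integral_mono (Continuous.integrable_of_compact _ (hg.pow _)) hI fun v => by
            have := ih 0 (by omega) (shiftMul f v)
            simpa using this
    | succ j =>
      obtain ⟨hI, hS⟩ := cubeAverage_step ψ k (j + 1) f (autocorr ψ).continuous (j' := j)
        (fun v u => cubeWeight_cons_succ ψ k j v u)
      have hg : Continuous fun v => ∫ y, ((averageOp ψ ^ j) (shiftMul f v) y) ^ 2 ^ j :=
        (continuous_integral_averageOp_pow ψ j (2 ^ j)).comp (continuous_shiftMul f)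
      have hJ := pow_integral_mul_le (volume : Measure Circ) (autocorr ψ).continuous
        (autocorr_nonneg h) (integral_autocorr h1) (k - j) hg
      rw [hS, Nat.succ_sub_succ]
      calc _ ≤ (∫ v, autocorr ψ v * ∫ y, ((averageOp ψ ^ j) (shiftMul f v) y) ^ 2 ^ j)
              ^ 2 ^ (k - j) := by
            refine pow_le_pow_left₀ (integral_nonneg fun y => ?_)
              (integral_averageOp_pow_succ_le h h1 j f) _
            rw [pow_succ' 2 j, pow_mul]
            exact pow_nonneg (sq_nonneg _) _
        _ ≤ _ := hJ
        _ ≤ _ := integral_mono (Continuous.integrable_of_compact _ (by fun_prop)) hI fun v =>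
            mul_le_mul_of_nonneg_left (ih j (by omega) (shiftMul f v)) (autocorr_nonneg h v)

end Cube

/-! ### Fourier decay of the cube measure produces a density -/

section CubeDecay

open scoped ComplexConjugate

/-- Averaging multiplies the Fourier coefficient at `ξ` by `ψ̂(-ξ)`. -/
theorem fourierCoeff_integral_mul_add (ψ f : C(Circ, ℝ)) (ξ : ℤ) :
    fourierCoeff (fun y => ((averageOp ψ f y : ℝ) : ℂ)) ξ
      = fourierCoeff (fun x => (ψ x : ℂ)) (-ξ) * fourierCoeff (fun x => (f x : ℂ)) ξ := by
  simp only [fourierCoeff_eq_integral, averageOp_apply, ← integral_complex_ofReal, neg_neg]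
  rw [← integral_mul_const]
  simp only [← integral_const_mul]
  have hI : MeasureTheory.Integrable (fun p : Circ × Circ =>
      (fourier (-ξ) p.1 : ℂ) * ((ψ p.2 * f (p.1 + p.2) : ℝ) : ℂ)) (volume.prod volume) :=
    Continuous.integrable_of_compact _ (by fun_prop)
  rw [integral_integral_swap hI]
  refine integral_congr_ae (ae_of_all _ fun a => ?_)
  dsimp only
  rw [← integral_sub_right_eq_self _ a]
  refine integral_congr_ae (ae_of_all _ fun y => ?_)
  simp only [sub_eq_add_neg, neg_add_cancel_right, fourier_add_apply, fourier_neg_apply, neg_neg]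
  push_cast
  ring

theorem fourierCoeff_neg_eq_conj (f : C(Circ, ℝ)) (ξ : ℤ) :
    fourierCoeff (fun x => (f x : ℂ)) (-ξ) = conj (fourierCoeff (fun x => (f x : ℂ)) ξ) := by
  simp only [fourierCoeff_eq_integral, ← integral_conj, map_mul, Complex.conj_ofReal, fourier_neg,
    Complex.conj_conj]

theorem fourierCoeff_averageOp_pow (ψ : C(Circ, ℝ)) (j : ℕ) (f : C(Circ, ℝ)) (ξ : ℤ) :
    fourierCoeff (fun y => (((averageOp ψ ^ j) f y : ℝ) : ℂ)) ξ
      = fourierCoeff (fun x => (ψ x : ℂ)) (-ξ) ^ j * fourierCoeff (fun x => (f x : ℂ)) ξ := by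
  induction j with
  | zero => simp
  | succ j ih =>
    rw [pow_succ' (averageOp ψ), ContinuousLinearMap.mul_def, ContinuousLinearMap.comp_apply,
      fourierCoeff_integral_mul_add, ih]
    ring

theorem fourierCoeff_autocorr (ψ : C(Circ, ℝ)) (ξ : ℤ) :
    fourierCoeff (fun v => (autocorr ψ v : ℂ)) ξ
      = ((‖fourierCoeff (fun x => (ψ x : ℂ)) ξ‖ ^ 2 : ℝ) : ℂ) := by
  rw [show (fun v => (autocorr ψ v : ℂ)) = fun v => ((averageOp ψ ψ v : ℝ) : ℂ) from rfl,
    fourierCoeff_integral_mul_add, fourierCoeff_neg_eq_conj, Complex.conj_mul']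
  push_cast
  rfl

theorem norm_fourierCoeff_le_one {ψ : C(Circ, ℝ)} (h : ∀ x, 0 ≤ ψ x) (h1 : ∫ x, ψ x = 1) (ξ : ℤ) :
    ‖fourierCoeff (fun x => (ψ x : ℂ)) ξ‖ ≤ 1 := by
  refine (norm_fourierCoeff_le _ ξ).trans (le_of_eq ?_)
  refine Eq.trans (integral_congr_ae (ae_of_all _ fun x => ?_)) h1
  simp only [Complex.norm_real, Real.norm_of_nonneg (h x)]

/-- The complexification of a real continuous function. -/
def toComplex {X : Type*} [TopologicalSpace X] (f : C(X, ℝ)) : C(X, ℂ) :=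
  ⟨fun x => (f x : ℂ), by fun_prop⟩

/-- The Fourier series of an autocorrelation converges uniformly: its coefficients `|ψ̂(ξ)|²` are
summable. -/
theorem hasSum_autocorr (ψ : C(Circ, ℝ)) :
    HasSum (fun ξ : ℤ => ((‖fourierCoeff (fun x => (ψ x : ℂ)) ξ‖ ^ 2 : ℝ) : ℂ) •
      (fourier ξ : C(Circ, ℂ))) (toComplex (autocorr ψ)) := by
  have hs := (hasSum_sq_fourierCoeff_of_memLp (memLp_continuousMap (toComplex ψ) 2)).summable
  have h := hasSum_fourier_series_of_summable (f := toComplex (autocorr ψ))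
    ((Complex.summable_ofReal.2 hs).congr fun ξ => (fourierCoeff_autocorr ψ ξ).symm)
  refine h.congr_fun fun ξ => ?_
  congr 1
  exact (fourierCoeff_autocorr ψ ξ).symm

/-- The product over the directions `i < j` of a function on the circle. -/
def directionProd (k j : ℕ) (P : C(Circ, ℂ)) : C(Circ × (Fin k → Circ), ℂ) :=
  ∏ i : Fin k, if i.val < j then P.comp ⟨fun p : Circ × (Fin k → Circ) => p.2 i, by fun_prop⟩ else 1

theorem continuous_directionProd (k j : ℕ) : Continuous (directionProd k j) := by
  unfold directionProd
  refine continuous_finsetProd _ fun i _ => ?_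
  split_ifs
  · exact ContinuousMap.continuous_precomp _
  · exact continuous_const

theorem directionProd_apply (k j : ℕ) (P : C(Circ, ℂ)) (p : Circ × (Fin k → Circ)) :
    directionProd k j P p = ∏ i : Fin k, if i.val < j then P (p.2 i) else 1 := by
  rw [directionProd, ContinuousMap.prod_apply]
  refine Finset.prod_congr rfl fun i _ => ?_
  split_ifs <;> simp

/-- A decay of order `s` in the Euclidean norm dominates a product of decays of order `s / j` in
the first `j` coordinates. -/
theorem rpow_neg_le_prod {k j : ℕ} (hj : 1 ≤ j) (hjk : j ≤ k) {s : ℝ} (hs : 0 ≤ s)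
    (η : Fin k → ℤ) :
    (1 + Real.sqrt (∑ i, (η i : ℝ) ^ 2)) ^ (-s)
      ≤ ∏ i : Fin k, if i.val < j then (1 + |(η i : ℝ)|) ^ (-(s / j)) else 1 := by
  set R := Real.sqrt (∑ i, (η i : ℝ) ^ 2)
  have hR : 0 ≤ R := Real.sqrt_nonneg _
  have hle : ∀ i, |(η i : ℝ)| ≤ R := fun i => Real.abs_le_sqrt
    (Finset.single_le_sum (f := fun i => (η i : ℝ) ^ 2) (fun i _ => sq_nonneg _)
      (Finset.mem_univ i))
  have hj0 : (j : ℝ) ≠ 0 := by positivity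
  calc (1 + R) ^ (-s) = ∏ i : Fin k, if i.val < j then (1 + R) ^ (-(s / j)) else 1 := by
        rw [Finset.prod_ite, Finset.prod_const_one, mul_one, Finset.prod_const]
        have hc : (Finset.univ.filter fun i : Fin k => i.val < j).card = j := by
          rw [Fin.card_filter_val_lt, min_eq_right hjk]
        rw [hc, ← Real.rpow_natCast, ← Real.rpow_mul (by positivity)]
        congr 1
        field_simp
    _ ≤ _ := by
        refine Finset.prod_le_prod (fun i _ => ?_) fun i _ => ?_
        · split_ifs <;> positivity
        · split_ifs
          · exact Real.rpow_le_rpow_of_nonpos (by positivity) (by linarith [hle i])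
              (by rw [neg_nonpos]; positivity)
          · exact le_rfl

theorem summable_one_add_abs_rpow {t : ℝ} (ht : 1 < t) :
    Summable fun ξ : ℤ => (1 + |(ξ : ℝ)|) ^ (-t) := by
  refine summable_of_isBigO (Real.summable_abs_int_rpow ht) ?_
  refine Asymptotics.IsBigO.of_bound 1 ?_
  have : ∀ᶠ ξ : ℤ in cofinite, ξ ≠ 0 := by
    simpa using (Set.finite_singleton (0 : ℤ)).compl_mem_cofinite
  filter_upwards [this] with ξ hξ
  have h0 : 0 < |(ξ : ℝ)| := abs_pos.2 (by exact_mod_cast hξ)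
  rw [one_mul, Real.norm_of_nonneg (by positivity), Real.norm_of_nonneg (by positivity)]
  exact Real.rpow_le_rpow_of_nonpos h0 (by linarith) (by linarith)

/-- Fourier decay of order `s > j` of a measure on the torus bounds, uniformly in the probability
density `ψ`, the integral of the weight `∏_{i < j} χ(u_i)`. -/
theorem norm_signedIntegral_directionProd_le {k j : ℕ} (hj : 1 ≤ j) (hjk : j ≤ k) {s : ℝ}
    (hs : (j : ℝ) < s) {ν : SignedMeasure (Circ × (Fin k → Circ))} {C : ℝ}
    (hC : ∀ η : Fin k → ℤ,
      ‖cubeFourier ν η‖ ≤ C * (1 + Real.sqrt (∑ i, (η i : ℝ) ^ 2)) ^ (-s)) :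
    ∃ A : ℝ, ∀ ψ : C(Circ, ℝ), (∀ x, 0 ≤ ψ x) → ∫ x, ψ x = 1 →
      ‖signedIntegralCLM ν (directionProd k j (toComplex (autocorr ψ)))‖ ≤ A := by
  have hC0 : 0 ≤ C := by
    have := (norm_nonneg _).trans (hC 0)
    simpa using this
  have hj0 : (0 : ℝ) < j := by exact_mod_cast hj
  have hs0 : 0 ≤ s := by linarith
  set t := s / j with ht
  have ht1 : 1 < t := by rw [ht, one_lt_div hj0]; exact hs
  have hsum := summable_one_add_abs_rpow ht1
  set Z := max 1 (∑' ξ : ℤ, (1 + |(ξ : ℝ)|) ^ (-t)) with hZ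
  refine ⟨C * Z ^ k, fun ψ h h1 => ?_⟩
  set c : ℤ → ℝ := fun ξ => ‖fourierCoeff (fun x => (ψ x : ℂ)) ξ‖ ^ 2 with hc
  have hc0 : ∀ ξ, 0 ≤ c ξ := fun ξ => by positivity
  have hc1 : ∀ ξ, c ξ ≤ 1 := fun ξ => pow_le_one₀ (norm_nonneg _) (norm_fourierCoeff_le_one h h1 ξ)
  -- It suffices to bound the integrals of the partial sums of the Fourier series.
  have hlim : Tendsto (fun S : Finset ℤ => signedIntegralCLM ν (directionProd k j
      (∑ ξ ∈ S, ((c ξ : ℝ) : ℂ) • (fourier ξ : C(Circ, ℂ))))) atTop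
      (𝓝 (signedIntegralCLM ν (directionProd k j (toComplex (autocorr ψ))))) :=
    ((signedIntegralCLM ν).continuous.comp (continuous_directionProd k j)).continuousAt.tendsto.comp
      (hasSum_autocorr ψ)
  refine le_of_tendsto hlim.norm (Eventually.of_forall fun S => ?_)
  let T : Fin k → Finset ℤ := fun i => if i.val < j then S else {0}
  let d : Fin k → ℤ → ℝ := fun i ξ => if i.val < j then c ξ else 1
  have hd0 : ∀ i ξ, 0 ≤ d i ξ := fun i ξ => by
    simp only [d]; split_ifs; exacts [hc0 ξ, zero_le_one]
  have hd1 : ∀ i ξ, d i ξ ≤ 1 := fun i ξ => by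
    simp only [d]; split_ifs; exacts [hc1 ξ, le_rfl]
  let e : (Fin k → ℤ) → C(Circ × (Fin k → Circ), ℂ) := fun η =>
    ⟨fun p => ∏ i, fourier (η i) (p.2 i), by fun_prop⟩
  have hexp : directionProd k j (∑ ξ ∈ S, ((c ξ : ℝ) : ℂ) • (fourier ξ : C(Circ, ℂ)))
      = ∑ η ∈ Fintype.piFinset T, ((∏ i, d i (η i) : ℝ) : ℂ) • e η := by
    ext p
    rw [directionProd_apply, ContinuousMap.sum_apply]
    have hfac : ∀ i : Fin k, (if i.val < j then
        (∑ ξ ∈ S, ((c ξ : ℝ) : ℂ) • (fourier ξ : C(Circ, ℂ))) (p.2 i) else 1)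
        = ∑ ξ ∈ T i, ((d i ξ : ℝ) : ℂ) * fourier ξ (p.2 i) := by
      intro i
      simp only [T, d]
      split_ifs
      · rw [ContinuousMap.sum_apply]
        rfl
      · simp
    simp only [hfac]
    rw [Finset.prod_univ_sum]
    refine Finset.sum_congr rfl fun η _ => ?_
    rw [ContinuousMap.smul_apply, smul_eq_mul, Finset.prod_mul_distrib]
    push_cast
    rfl
  have hcoef : ∀ η, ‖signedIntegralCLM ν (e η)‖
      ≤ C * ∏ i : Fin k, if i.val < j then (1 + |(η i : ℝ)|) ^ (-t) else 1 := by
    intro η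
    have h2 : signedIntegralCLM ν (e η) = cubeFourier ν (-η) := by
      simp only [cubeFourier, signedIntegralCLM_apply, e, ContinuousMap.coe_mk, Pi.neg_apply,
        neg_neg]
    rw [h2]
    refine (hC (-η)).trans ?_
    simp only [Pi.neg_apply, Int.cast_neg, neg_sq]
    exact mul_le_mul_of_nonneg_left (rpow_neg_le_prod hj hjk hs0 η) hC0
  rw [hexp, map_sum]
  calc ‖∑ η ∈ Fintype.piFinset T, signedIntegralCLM ν (((∏ i, d i (η i) : ℝ) : ℂ) • e η)‖
      ≤ ∑ η ∈ Fintype.piFinset T,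
          C * ∏ i : Fin k, if i.val < j then (1 + |(η i : ℝ)|) ^ (-t) else 1 := by
        refine norm_sum_le_of_le _ fun η _ => ?_
        rw [map_smul, norm_smul, Complex.norm_real,
          Real.norm_of_nonneg (Finset.prod_nonneg fun i _ => hd0 i _)]
        refine (mul_le_of_le_one_left (norm_nonneg _) ?_).trans (hcoef η)
        exact Finset.prod_le_one (fun i _ => hd0 i _) fun i _ => hd1 i _
    _ = C * ∏ i : Fin k, ∑ ξ ∈ T i, if i.val < j then (1 + |(ξ : ℝ)|) ^ (-t) else 1 := by
        rw [← Finset.mul_sum, Finset.prod_univ_sum]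
    _ ≤ C * ∏ _i : Fin k, Z := by
        refine mul_le_mul_of_nonneg_left (Finset.prod_le_prod (fun i _ => ?_) fun i _ => ?_) hC0
        · exact Finset.sum_nonneg fun ξ _ => by split_ifs <;> positivity
        · simp only [T]
          split_ifs
          · exact (hsum.sum_le_tsum S fun ξ _ => by positivity).trans (le_max_right _ _)
          · simp [hZ]
    _ = C * Z ^ k := by simp

theorem integral_kernelMap (φ : SchwartzMap ℝ ℝ) (hφ : ∫ t, φ t = 1) (n : ℕ) :
    ∫ x, kernelMap φ n x = 1 := by
  obtain ⟨F, hF, hc, -⟩ := exists_dilatedKernel_periodization φ n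
  have h := hc 0
  rw [fourierCoeff_eq_integral] at h
  simp only [neg_zero, fourier_zero, one_mul, hF, Int.cast_zero, mul_zero, zero_div,
    Complex.exp_zero] at h
  rw [integral_complex_ofReal, integral_complex_ofReal, hφ] at h
  exact_mod_cast h

open scoped ENNReal in
/-- A crude bound: for `B ≥ 1` a root of `B` is at most `B`. -/
theorem eLpNorm_two_pow_le {h : C(Circ, ℝ)} {j : ℕ} {B : ℝ} (hB : 1 ≤ B)
    (hh : ∫ x, h x ^ 2 ^ (j + 1) ≤ B) :
    eLpNorm (toComplex h) ((2 : ℝ≥0∞) ^ (j + 1)) volume ≤ ENNReal.ofReal B := by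
  have hq0 : ((2 : ℝ≥0∞) ^ (j + 1)) ≠ 0 := by simp
  have hqt : ((2 : ℝ≥0∞) ^ (j + 1)) ≠ ⊤ := by finiteness
  rw [(memLp_continuousMap (toComplex h) _).eLpNorm_eq_integral_rpow_norm hq0 hqt]
  refine ENNReal.ofReal_le_ofReal ?_
  have e : ∫ x, ‖toComplex h x‖ ^ ((2 : ℝ≥0∞) ^ (j + 1)).toReal = ∫ x, h x ^ 2 ^ (j + 1) := by
    refine integral_congr_ae (ae_of_all _ fun x => ?_)
    simp only [toComplex, ContinuousMap.coe_mk, Complex.norm_real, Real.norm_eq_abs,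
      ENNReal.toReal_pow, ENNReal.toReal_ofNat]
    have : ((2 : ℝ) ^ (j + 1)) = ((2 ^ (j + 1) : ℕ) : ℝ) := by push_cast; rfl
    rw [this, Real.rpow_natCast, Even.pow_abs]
    exact ⟨2 ^ j, by ring⟩
  rw [e]
  have h0 : 0 ≤ ∫ x, h x ^ 2 ^ (j + 1) := integral_nonneg fun x => by
    rw [pow_succ' 2 j, pow_mul]
    exact pow_nonneg (sq_nonneg _) _
  have hr : (1 : ℝ) ≤ ((2 : ℝ≥0∞) ^ (j + 1)).toReal := by
    simp only [ENNReal.toReal_pow, ENNReal.toReal_ofNat]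
    exact one_le_pow₀ one_le_two
  calc (∫ x, h x ^ 2 ^ (j + 1)) ^ (((2 : ℝ≥0∞) ^ (j + 1)).toReal)⁻¹
      ≤ B ^ (((2 : ℝ≥0∞) ^ (j + 1)).toReal)⁻¹ := Real.rpow_le_rpow h0 hh (by positivity)
    _ ≤ B ^ (1 : ℝ) := Real.rpow_le_rpow_of_exponent_le hB (inv_le_one_of_one_le₀ hr)
    _ = B := Real.rpow_one B

open scoped ENNReal in
/-- If `△^k μ` exists with Fourier decay of order larger than `j ≥ 1`, then `μ` has the Fourier
coefficients of a function in `L^{2^j}`. -/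
theorem exists_memLp_of_cubeDecay {k j : ℕ} (hj : 1 ≤ j) (hjk : j ≤ k) {s : ℝ}
    (hs : (j : ℝ) < s) {φ : SchwartzMap ℝ ℝ} (hφ : ∫ t, φ t = 1) {μ : SignedMeasure Circ}
    {ν : SignedMeasure (Circ × (Fin k → Circ))} (hν : IsCubeMeasure φ μ k ν) {C : ℝ}
    (hC : ∀ η : Fin k → ℤ,
      ‖cubeFourier ν η‖ ≤ C * (1 + Real.sqrt (∑ i, (η i : ℝ) ^ 2)) ^ (-s)) :
    ∃ f : Circ → ℂ, MemLp f ((2 : ℝ≥0∞) ^ j) ∧ ∀ ξ, fourierCoeff f ξ = measureCoeff μ ξ := by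
  obtain ⟨A, hA⟩ := norm_signedIntegral_directionProd_le hj hjk hs hC
  obtain ⟨ψ₀, hψ0, hψ1⟩ := exists_nonneg_schwartz
  set ψ : ℕ → C(Circ, ℝ) := kernelMap ψ₀ with hψ
  have hp : ∀ l x, 0 ≤ ψ l x := fun l x => kernelMap_nonneg hψ0 l x
  have hp1 : ∀ l, ∫ x, ψ l x = 1 := integral_kernelMap ψ₀ hψ1
  let f : ℕ → C(Circ, ℝ) := fun n => measureConv (kernelMap φ n) μ
  set B := max 1 (A + 1) with hBdef
  -- The bound `A` for the limit holds, up to `1`, for some mollification of index `n ≥ l`.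
  have hchoose : ∀ l, ∃ n, l ≤ n ∧ cubeAverage (ψ l) k j (f n) ≤ B := by
    intro l
    let g : C(Circ × (Fin k → Circ), ℝ) :=
      ⟨fun p => cubeWeight (ψ l) k j p.2, (continuous_cubeWeight _ _ _).comp continuous_snd⟩
    have hlim : Tendsto (fun n => cubeAverage (ψ l) k j (f n)) atTop (𝓝 (∫ᵛ p, g p ∂<•ν)) := hν g
    have hle : ∫ᵛ p, g p ∂<•ν ≤ A := by
      refine (le_abs_self _).trans ?_
      rw [← Real.norm_eq_abs, ← Complex.norm_real, ← signedIntegral_ofReal ν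
        (g.continuous.integrable_of_compact _)]
      refine le_of_eq_of_le ?_ (hA (ψ l) (hp l) (hp1 l))
      rw [signedIntegralCLM_apply]
      congr 2
      ext p
      rw [directionProd_apply]
      simp only [g, cubeWeight, ContinuousMap.coe_mk, toComplex]
      push_cast
      refine Finset.prod_congr rfl fun i _ => ?_
      split_ifs <;> simp
    have hev : ∀ᶠ n in atTop, cubeAverage (ψ l) k j (f n) < A + 1 :=
      hlim.eventually_lt_const (by linarith)
    obtain ⟨n, hn1, hn2⟩ := (hev.and (eventually_ge_atTop l)).exists
    exact ⟨n, hn2, hn1.le.trans (le_max_right _ _)⟩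
  choose N hN hNB using hchoose
  have hNt : Tendsto N atTop atTop := tendsto_atTop_mono hN tendsto_id
  obtain ⟨i, rfl⟩ : ∃ i, j = i + 1 := ⟨j - 1, by omega⟩
  -- These averages of mollifications are bounded in `L^{2^j}`, and their Fourier coefficients
  -- converge to those of `μ`.
  let h : ℕ → C(Circ, ℂ) := fun l => toComplex ((averageOp (ψ l) ^ (i + 1)) (f (N l)))
  have hb : ∀ l, eLpNorm (h l) ((2 : ℝ≥0∞) ^ (i + 1)) volume ≤ ENNReal.ofReal B := by
    intro l
    refine eLpNorm_two_pow_le (le_max_left _ _) ?_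
    have h2 := (pow_integral_averageOp_le_cubeAverage (hp l) (hp1 l) k (i + 1) hjk (f (N l))).trans
      (hNB l)
    -- A moment above `max 1 (A + 1)` is at most its own power, which the cube average bounds.
    by_contra hcon
    rw [not_le] at hcon
    have h3 : (1 : ℝ) ≤ ∫ y, ((averageOp (ψ l) ^ (i + 1)) (f (N l)) y) ^ 2 ^ (i + 1) :=
      (le_max_left _ _).trans hcon.le
    have h4 := le_self_pow₀ h3 (n := 2 ^ (k - (i + 1))) (by positivity)
    linarith
  have hcoef : ∀ l ξ, fourierCoeff (h l) ξ = fourierCoeff (fun x => (ψ l x : ℂ)) (-ξ) ^ (i + 1) *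
      (fourierCoeff (fun x => (kernelMap φ (N l) x : ℂ)) ξ * measureCoeff μ ξ) := by
    intro l ξ
    rw [← fourierCoeff_measureConv]
    exact fourierCoeff_averageOp_pow (ψ l) (i + 1) (f (N l)) ξ
  obtain ⟨K, hK⟩ := (isApproxIdentity_kernelMap φ hφ).bound
  refine exists_memLp_of_tendsto_coeff (h := h) (c := measureCoeff μ) (K := K) (fun l ξ => ?_)
    (fun ξ => ?_) (q := (2 : ℝ≥0∞) ^ (i + 1)) ?_ ENNReal.ofReal_ne_top hb
  · rw [hcoef, norm_mul, norm_mul, norm_pow]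
    refine (mul_le_of_le_one_left (by positivity)
      (pow_le_one₀ (norm_nonneg _) (norm_fourierCoeff_le_one (hp l) (hp1 l) _))).trans ?_
    refine mul_le_mul_of_nonneg_right ((norm_fourierCoeff_le _ ξ).trans ?_) (norm_nonneg _)
    simp only [Complex.norm_real, Real.norm_eq_abs]
    exact hK _
  · simp only [hcoef]
    have l1 := ((isApproxIdentity_kernelMap ψ₀ hψ1).coeff (-ξ)).pow (i + 1)
    have l2 := (((isApproxIdentity_kernelMap φ hφ).coeff ξ).comp hNt).mul_const (measureCoeff μ ξ)
    have l3 := l1.mul l2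
    rw [one_pow, one_mul, one_mul] at l3
    exact l3
  · calc (2 : ℝ≥0∞) = 2 ^ 1 := (pow_one _).symm
      _ ≤ 2 ^ (i + 1) := pow_le_pow_right₀ one_le_two (by omega)

end CubeDecay

/-! ### Multilinear estimates for the counting form -/

section Counting

open scoped ENNReal NNReal

/-- The product of the measure on the circle and of Lebesgue measure on the unit interval, on which
the integrand of `countForm` lives. -/
def stripMeasure : Measure (Circ × ℝ) :=
  (volume : Measure Circ).prod (volume.restrict (Set.Ioc 0 1))

theorem measurable_circ_coe : Measurable ((↑) : ℝ → Circ) :=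
  AddCircle.measurable_mk'

theorem measurable_translate (c : ℝ) :
    Measurable fun p : Circ × ℝ => p.1 - ((p.2 * c : ℝ) : Circ) :=
  measurable_fst.sub (measurable_circ_coe.comp (measurable_snd.mul_const c))

/-- For `r ∈ [0,1]` and `d ≠ 0` the point `x + r d` winds around the circle boundedly often. -/
theorem exists_lintegral_translate_le {d : ℝ} (hd : d ≠ 0) :
    ∃ C : ℝ≥0, ∀ G : Circ → ℝ≥0∞, Measurable G → ∀ x : Circ,
      ∫⁻ r in Set.Ioc (0 : ℝ) 1, G (x + ((r * d : ℝ) : Circ)) ≤ C * ∫⁻ y, G y := by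
  obtain ⟨N, hN⟩ := exists_nat_gt |d|
  set S := Finset.Icc (-(N : ℤ)) N
  refine ⟨(|d⁻¹|.toNNReal) * S.card, fun G hG x => ?_⟩
  set H : ℝ → ℝ≥0∞ := fun t => G (x + (t : Circ))
  have hH : Measurable H := hG.comp (measurable_const.add measurable_circ_coe)
  set E : Set ℝ := ⋃ z ∈ S, Set.Ioc (z : ℝ) (z + 1)
  have hE : MeasurableSet E := Finset.measurableSet_biUnion _ fun _ _ => measurableSet_Ioc
  have hsub : Set.Ioc (0 : ℝ) 1 ⊆ (fun r => r * d) ⁻¹' E := by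
    intro r hr
    have h1 : |r * d| < N := by
      rw [abs_mul, abs_of_pos hr.1]
      exact (mul_le_of_le_one_left (abs_nonneg d) hr.2).trans_lt hN
    rw [abs_lt] at h1
    have h2 := Int.ceil_lt_add_one (r * d)
    have h3 := Int.le_ceil (r * d)
    have h4 : ⌈r * d⌉ ≤ (N : ℤ) := Int.ceil_le.2 (by exact_mod_cast h1.2.le)
    have h5 : -(N : ℤ) < ⌈r * d⌉ := Int.lt_ceil.2 (by exact_mod_cast h1.1)
    simp only [Set.mem_preimage, E, Set.mem_iUnion]
    refine ⟨⌈r * d⌉ - 1, ?_, ?_⟩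
    · simp only [S, Finset.mem_Icc]; omega
    · push_cast; constructor <;> linarith
  have hunit : ∀ z : ℤ, ∫⁻ t in Set.Ioc (z : ℝ) (z + 1), H t = ∫⁻ y, G y := by
    intro z
    have h := UnitAddCircle.lintegral_preimage (z : ℝ) (fun y => G (x + y))
    exact h.trans (lintegral_add_left_eq_self _ x)
  calc ∫⁻ r in Set.Ioc (0 : ℝ) 1, H (r * d)
      ≤ ∫⁻ r in (fun r => r * d) ⁻¹' E, H (r * d) := lintegral_mono_set hsub
    _ = ∫⁻ t in E, H t ∂(Measure.map (fun r => r * d) volume) :=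
        (setLIntegral_map hE hH (measurable_mul_const d)).symm
    _ = ENNReal.ofReal |d⁻¹| * ∫⁻ t in E, H t := by
        rw [Real.map_volume_mul_right hd, Measure.restrict_smul, lintegral_smul_measure,
          smul_eq_mul]
    _ ≤ ENNReal.ofReal |d⁻¹| * ∑ z ∈ S, ∫⁻ t in Set.Ioc (z : ℝ) (z + 1), H t := by
        gcongr
        exact (lintegral_biUnion_finset ((Set.pairwise_disjoint_Ioc_intCast ℝ).set_pairwise _)
          (fun _ _ => measurableSet_Ioc) _).le
    _ = _ := by
        simp only [hunit, Finset.sum_const, nsmul_eq_mul]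
        push_cast
        rw [mul_assoc]; rfl

/-- The bilinear estimate on `L¹ × L¹`: the change of variables `(x, r) ↦ (x - r b, x - r c)` is
nondegenerate. -/
theorem exists_lintegral_pair_le {b c : ℝ} (h : b ≠ c) :
    ∃ C : ℝ≥0, ∀ G H : Circ → ℝ≥0∞, Measurable G → Measurable H →
      ∫⁻ p, G (p.1 - ((p.2 * b : ℝ) : Circ)) * H (p.1 - ((p.2 * c : ℝ) : Circ)) ∂stripMeasure
        ≤ C * ((∫⁻ y, G y) * ∫⁻ y, H y) := by
  obtain ⟨C, hC⟩ := exists_lintegral_translate_le (sub_ne_zero.2 h)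
  refine ⟨C, fun G H hG hH => ?_⟩
  have m1 : Measurable fun p : Circ × ℝ =>
      G (p.1 - ((p.2 * b : ℝ) : Circ)) * H (p.1 - ((p.2 * c : ℝ) : Circ)) :=
    (hG.comp (measurable_translate b)).mul (hH.comp (measurable_translate c))
  have m2 : Measurable fun p : Circ × ℝ => G p.1 * H (p.1 + ((p.2 * (b - c) : ℝ) : Circ)) :=
    (hG.comp measurable_fst).mul (hH.comp (measurable_fst.add
      (measurable_circ_coe.comp (measurable_snd.mul_const _))))
  calc _ = ∫⁻ r in Set.Ioc (0 : ℝ) 1, ∫⁻ x : Circ,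
        G (x - ((r * b : ℝ) : Circ)) * H (x - ((r * c : ℝ) : Circ)) :=
        lintegral_prod_symm _ m1.aemeasurable
    _ = ∫⁻ r in Set.Ioc (0 : ℝ) 1, ∫⁻ x : Circ, G x * H (x + ((r * (b - c) : ℝ) : Circ)) := by
        refine lintegral_congr fun r => ?_
        rw [← lintegral_add_right_eq_self _ ((r * b : ℝ) : Circ)]
        refine lintegral_congr fun x => ?_
        rw [add_sub_cancel_right, mul_sub, AddCircle.coe_sub, add_sub_assoc]
    _ = ∫⁻ x : Circ, ∫⁻ r in Set.Ioc (0 : ℝ) 1, G x * H (x + ((r * (b - c) : ℝ) : Circ)) := by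
        rw [lintegral_lintegral_swap]
        exact (m2.comp measurable_swap).aemeasurable
    _ ≤ ∫⁻ x : Circ, G x * (C * ∫⁻ y, H y) := by
        refine lintegral_mono fun x => ?_
        have m3 : Measurable fun r : ℝ => H (x + ((r * (b - c) : ℝ) : Circ)) :=
          hH.comp (measurable_const.add (measurable_circ_coe.comp (measurable_id.mul_const _)))
        rw [lintegral_const_mul _ m3]
        gcongr
        exact hC H hH x
    _ = _ := by
        rw [lintegral_mul_const _ hG]; ring

/-- Hölder's inequality for the cyclic pairs `F_i F_{i+1}` reduces the multilinear estimate to the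
bilinear one. -/
theorem exists_lintegral_prod_translates_le {k : ℕ} (hk : 1 ≤ k) {b : Fin (k + 1) → ℝ}
    (hb : Function.Injective b) :
    ∃ C : ℝ≥0, ∀ F : Fin (k + 1) → Circ → ℝ≥0∞, (∀ i, Measurable (F i)) →
      ∫⁻ p, ∏ i, F i (p.1 - ((p.2 * b i : ℝ) : Circ)) ∂stripMeasure
        ≤ C * ∏ i, (∫⁻ y, F i y ^ ((k + 1 : ℝ) / 2)) ^ (2 / (k + 1 : ℝ)) := by
  have hne : ∀ i : Fin (k + 1), b i ≠ b (i + 1) := fun i h => by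
    have h1 := hb h
    rw [left_eq_add, Fin.one_eq_zero_iff] at h1
    omega
  choose C hC using fun i => exists_lintegral_pair_le (hne i)
  have hk0 : (0 : ℝ) < k + 1 := by positivity
  refine ⟨∏ i, C i ^ (1 / (k + 1 : ℝ)), fun F hF => ?_⟩
  set p : ℝ := (k + 1 : ℝ) / 2 with hp
  have hp0 : 0 < p := by positivity
  set T : Fin (k + 1) → Circ × ℝ → Circ := fun i q => q.1 - ((q.2 * b i : ℝ) : Circ)
  have hrot : ∀ X : Fin (k + 1) → ℝ≥0∞, ∏ i, X (i + 1) = ∏ i, X i := fun X =>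
    Equiv.prod_comp (Equiv.addRight (1 : Fin (k + 1))) X
  have hhalf : ∀ x : ℝ≥0∞, (x ^ p) ^ (1 / (k + 1 : ℝ)) * (x ^ p) ^ (1 / (k + 1 : ℝ)) = x := by
    intro x
    rw [← ENNReal.rpow_mul, ← ENNReal.rpow_add_of_nonneg _ _ (by positivity) (by positivity),
      show p * (1 / (k + 1 : ℝ)) + p * (1 / (k + 1 : ℝ)) = 1 by rw [hp]; field_simp; norm_num,
      ENNReal.rpow_one]
  have hT : ∀ i, Measurable (T i) := fun i => measurable_translate (b i)
  calc ∫⁻ q, ∏ i, F i (T i q) ∂stripMeasure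
      = ∫⁻ q, ∏ i, (F i (T i q) ^ p * F (i + 1) (T (i + 1) q) ^ p) ^ (1 / (k + 1 : ℝ))
          ∂stripMeasure := by
        refine lintegral_congr fun q => ?_
        simp only [ENNReal.mul_rpow_of_nonneg _ _ (one_div_pos.2 hk0).le]
        rw [Finset.prod_mul_distrib,
          hrot fun i => (F i (T i q) ^ p) ^ (1 / (k + 1 : ℝ)), ← Finset.prod_mul_distrib]
        exact Finset.prod_congr rfl fun i _ => (hhalf _).symm
    _ ≤ ∏ i, (∫⁻ q, F i (T i q) ^ p * F (i + 1) (T (i + 1) q) ^ p ∂stripMeasure)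
          ^ (1 / (k + 1 : ℝ)) := by
        refine ENNReal.lintegral_prod_norm_pow_le _ (fun i _ => ?_) ?_ fun i _ => by positivity
        · exact ((((hF i).comp (hT i)).pow_const p).mul
            (((hF (i + 1)).comp (hT (i + 1))).pow_const p)).aemeasurable
        · simp only [Finset.sum_const, Finset.card_univ, Fintype.card_fin, nsmul_eq_mul]
          push_cast
          field_simp
    _ ≤ ∏ i, (C i * ((∫⁻ y, F i y ^ p) * ∫⁻ y, F (i + 1) y ^ p)) ^ (1 / (k + 1 : ℝ)) := by
        refine Finset.prod_le_prod' fun i _ => ?_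
        gcongr
        exact hC i _ _ ((hF i).pow_const p) ((hF (i + 1)).pow_const p)
    _ = _ := by
        simp only [ENNReal.mul_rpow_of_nonneg _ _ (one_div_pos.2 hk0).le, Finset.prod_mul_distrib]
        rw [hrot fun i => (∫⁻ y, F i y ^ p) ^ (1 / (k + 1 : ℝ)), ← Finset.prod_mul_distrib,
          ENNReal.ofNNReal_finsetProd]
        congr 1
        · exact Finset.prod_congr rfl fun i _ =>
            (ENNReal.coe_rpow_of_nonneg _ (one_div_pos.2 hk0).le).symm
        · refine Finset.prod_congr rfl fun i _ => ?_
          rw [← ENNReal.rpow_add_of_nonneg _ _ (by positivity) (by positivity)]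
          congr 1
          ring

theorem enorm_finsetProd {ι 𝕜 : Type*} [NormedField 𝕜] (s : Finset ι) (f : ι → 𝕜) :
    ‖∏ i ∈ s, f i‖ₑ = ∏ i ∈ s, ‖f i‖ₑ := by
  simp only [← ofReal_norm, norm_prod]
  exact ENNReal.ofReal_prod_of_nonneg fun _ _ => norm_nonneg _

/-- The counting form is bounded on `L^q` for every `q ≥ (k+1)/2`. -/
theorem exists_lintegral_prod_translates_le_eLpNorm {k : ℕ} (hk : 1 ≤ k) {b : Fin (k + 1) → ℝ}
    (hb : Function.Injective b) {q : ℝ≥0∞} (hq : ENNReal.ofReal ((k + 1 : ℝ) / 2) ≤ q) :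
    ∃ C : ℝ≥0, ∀ F : Fin (k + 1) → Circ → ℝ, (∀ i, Measurable (F i)) →
      ∫⁻ p, ‖∏ i, F i (p.1 - ((p.2 * b i : ℝ) : Circ))‖ₑ ∂stripMeasure
        ≤ C * ∏ i, eLpNorm (F i) q volume := by
  obtain ⟨C, hC⟩ := exists_lintegral_prod_translates_le hk hb
  refine ⟨C, fun F hF => ?_⟩
  have hp0 : (0 : ℝ) < (k + 1 : ℝ) / 2 := by positivity
  have h := hC (fun i y => ‖F i y‖ₑ) fun i => (hF i).enorm
  simp only [enorm_finsetProd]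
  refine h.trans ?_
  gcongr with i
  refine le_trans (le_of_eq ?_)
    (eLpNorm_le_eLpNorm_of_exponent_le hq (hF i).aestronglyMeasurable)
  rw [eLpNorm_eq_lintegral_rpow_enorm_toReal (by simpa using hp0) ENNReal.ofReal_ne_top,
    ENNReal.toReal_ofReal hp0.le, one_div_div]

end Counting

/-! ### Convergence of the counting form along `L^q` convergence -/

section CountLp

open scoped ENNReal NNReal

/-- A telescoping bound for the difference of two products. -/
theorem abs_prod_sub_prod_le {n : ℕ} (a b : Fin n → ℝ) :
    |∏ i, a i - ∏ i, b i|
      ≤ ∑ i, ∏ j, if j = i then |a j - b j| else |a j| + |b j| := by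
  induction n with
  | zero => simp
  | succ n ih =>
    have h := ih (fun i => a i.succ) fun i => b i.succ
    have hb : |∏ i : Fin n, b i.succ| ≤ ∏ i : Fin n, (|a i.succ| + |b i.succ|) := by
      rw [Finset.abs_prod]
      exact Finset.prod_le_prod (fun _ _ => abs_nonneg _)
        fun i _ => le_add_of_nonneg_left (abs_nonneg _)
    simp only [Fin.prod_univ_succ, Fin.sum_univ_succ, if_true, Fin.succ_ne_zero, if_false,
      (Fin.succ_ne_zero _).symm, Fin.succ_inj]
    rw [← Finset.mul_sum]
    calc |a 0 * ∏ i : Fin n, a i.succ - b 0 * ∏ i : Fin n, b i.succ|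
        = |(a 0 - b 0) * ∏ i : Fin n, b i.succ
            + a 0 * (∏ i : Fin n, a i.succ - ∏ i : Fin n, b i.succ)| := by congr 1; ring
      _ ≤ |a 0 - b 0| * |∏ i : Fin n, b i.succ|
            + |a 0| * |∏ i : Fin n, a i.succ - ∏ i : Fin n, b i.succ| := by
          rw [← abs_mul, ← abs_mul]; exact abs_add_le _ _
      _ ≤ _ := by
          gcongr
          exact le_add_of_nonneg_right (abs_nonneg _)

variable {k : ℕ} {b : Fin (k + 1) → ℝ}

theorem measurable_prod_translate (b : Fin (k + 1) → ℝ) {F : Fin (k + 1) → Circ → ℝ}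
    (hF : ∀ i, Measurable (F i)) :
    Measurable fun p : Circ × ℝ => ∏ i, F i (p.1 - ((p.2 * b i : ℝ) : Circ)) :=
  Finset.measurable_fun_prod _ fun i _ => (hF i).comp (measurable_translate (b i))

theorem measurable_weight (g : C(Circ × Circ, ℂ)) :
    Measurable fun p : Circ × ℝ => g (p.1, (p.2 : Circ)) :=
  g.continuous.measurable.comp
    (measurable_fst.prodMk (measurable_circ_coe.comp measurable_snd))

theorem integrable_countForm_integrand (hk : 1 ≤ k) (hb : Function.Injective b) {q : ℝ≥0∞}
    (hq : ENNReal.ofReal ((k + 1 : ℝ) / 2) ≤ q) (g : C(Circ × Circ, ℂ))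
    {F : Fin (k + 1) → Circ → ℝ} (hF : ∀ i, Measurable (F i)) (hFq : ∀ i, MemLp (F i) q) :
    MeasureTheory.Integrable (fun p : Circ × ℝ => g (p.1, (p.2 : Circ)) *
      ∏ i, ((F i (p.1 - ((p.2 * b i : ℝ) : Circ)) : ℝ) : ℂ)) stripMeasure := by
  obtain ⟨C, hC⟩ := exists_lintegral_prod_translates_le_eLpNorm hk hb hq
  have h1 : MeasureTheory.Integrable
      (fun p : Circ × ℝ => ∏ i, F i (p.1 - ((p.2 * b i : ℝ) : Circ))) stripMeasure := by
    refine ⟨(measurable_prod_translate b hF).aestronglyMeasurable, (hC F hF).trans_lt ?_⟩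
    exact ENNReal.mul_lt_top ENNReal.coe_lt_top (ENNReal.prod_lt_top fun i _ => (hFq i).2)
  have h2 := h1.ofReal (𝕜 := ℂ)
  simp only [RCLike.ofReal_prod] at h2
  exact h2.bdd_mul (measurable_weight g).aestronglyMeasurable
    (ae_of_all _ fun p => g.norm_coe_le_norm _)

theorem countForm_eq_integral (g : Circ × Circ → ℂ) {F : Fin (k + 1) → Circ → ℝ}
    (h : MeasureTheory.Integrable (fun p : Circ × ℝ => g (p.1, (p.2 : Circ)) *
      ∏ i, ((F i (p.1 - ((p.2 * b i : ℝ) : Circ)) : ℝ) : ℂ)) stripMeasure) :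
    countForm b g F = ∫ p, g (p.1, (p.2 : Circ)) *
      ∏ i, ((F i (p.1 - ((p.2 * b i : ℝ) : Circ)) : ℝ) : ℂ) ∂stripMeasure := by
  unfold stripMeasure at h ⊢
  rw [integral_prod _ h]
  simp only [countForm, intervalIntegral.integral_of_le zero_le_one]

/-- The counting form is locally Lipschitz on `L^q`. -/
theorem exists_enorm_countForm_sub_le (hk : 1 ≤ k) (hb : Function.Injective b) {q : ℝ≥0∞}
    (hq : ENNReal.ofReal ((k + 1 : ℝ) / 2) ≤ q) (hq1 : 1 ≤ q) :
    ∃ C : ℝ≥0, ∀ (g : C(Circ × Circ, ℂ)) (h f : Circ → ℝ), Measurable h → Measurable f →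
      MemLp h q → MemLp f q →
      ‖countForm b g (fun _ => h) - countForm b g (fun _ => f)‖ₑ
        ≤ ‖g‖ₑ * (C * (eLpNorm (h - f) q volume *
            (eLpNorm (h - f) q volume + 2 * eLpNorm f q volume) ^ k)) := by
  obtain ⟨C, hC⟩ := exists_lintegral_prod_translates_le_eLpNorm hk hb hq
  refine ⟨(k + 1) * C, fun g h f mh mf hh hf => ?_⟩
  have i1 := integrable_countForm_integrand hk hb hq g (F := fun _ => h) (fun _ => mh) fun _ => hh
  have i2 := integrable_countForm_integrand hk hb hq g (F := fun _ => f) (fun _ => mf) fun _ => hf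
  rw [countForm_eq_integral _ i1, countForm_eq_integral _ i2, ← integral_sub i1 i2]
  set δ := eLpNorm (h - f) q volume
  set M := δ + 2 * eLpNorm f q volume
  -- The factors of the `i`-th term of the telescoping bound for a difference of products.
  set W : Fin (k + 1) → Fin (k + 1) → Circ → ℝ := fun i j y =>
    if j = i then |h y - f y| else |h y| + |f y| with hW
  have mW : ∀ i j, Measurable (W i j) := by
    intro i j
    simp only [hW]
    split_ifs
    · exact (mh.sub mf).abs
    · exact mh.abs.add mf.abs
  have hWn : ∀ i j, eLpNorm (W i j) q volume ≤ if j = i then δ else M := by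
    intro i j
    simp only [hW]
    split_ifs
    · exact (eLpNorm_norm (h - f)).le
    · have e1 : eLpNorm h q volume ≤ δ + eLpNorm f q volume := by
        have := eLpNorm_add_le (hh.sub hf).1 hf.1 hq1
        rwa [sub_add_cancel] at this
      calc eLpNorm (fun y => |h y| + |f y|) q volume
          ≤ eLpNorm (fun y => |h y|) q volume + eLpNorm (fun y => |f y|) q volume :=
            eLpNorm_add_le mh.abs.aestronglyMeasurable mf.abs.aestronglyMeasurable hq1
        _ = eLpNorm h q volume + eLpNorm f q volume :=
            congrArg₂ _ (eLpNorm_norm h) (eLpNorm_norm f)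
        _ ≤ M := by
            refine (add_le_add_left e1 _).trans (le_of_eq ?_)
            simp only [M]; ring
  refine (enorm_integral_le_lintegral_enorm _).trans ?_
  calc _ ≤ ∫⁻ p, ‖g‖ₑ * ∑ i, ‖∏ j, W i j (p.1 - ((p.2 * b j : ℝ) : Circ))‖ₑ ∂stripMeasure := by
        refine lintegral_mono fun p => ?_
        rw [← mul_sub, enorm_mul]
        refine mul_le_mul' ?_ ?_
        · exact enorm_le_iff_norm_le.2 (g.norm_coe_le_norm _)
        · have e := abs_prod_sub_prod_le (fun j => h (p.1 - ((p.2 * b j : ℝ) : Circ)))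
            fun j => f (p.1 - ((p.2 * b j : ℝ) : Circ))
          have e2 : ∀ i, 0 ≤ ∏ j, W i j (p.1 - ((p.2 * b j : ℝ) : Circ)) := fun i =>
            Finset.prod_nonneg fun j _ => by simp only [hW]; split_ifs <;> positivity
          rw [← Complex.ofReal_prod, ← Complex.ofReal_prod, ← Complex.ofReal_sub, ← ofReal_norm,
            Complex.norm_real, Real.norm_eq_abs]
          refine (ENNReal.ofReal_le_ofReal e).trans (le_of_eq ?_)
          rw [ENNReal.ofReal_sum_of_nonneg fun i _ => e2 i]
          exact Finset.sum_congr rfl fun i _ => by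
            rw [← ofReal_norm, Real.norm_of_nonneg (e2 i)]
    _ = ‖g‖ₑ * ∑ i, ∫⁻ p, ‖∏ j, W i j (p.1 - ((p.2 * b j : ℝ) : Circ))‖ₑ ∂stripMeasure := by
        rw [lintegral_const_mul, lintegral_finsetSum]
        · exact fun i _ => (measurable_prod_translate b (mW i)).enorm
        · exact Finset.measurable_fun_sum _ fun i _ => (measurable_prod_translate b (mW i)).enorm
    _ ≤ ‖g‖ₑ * ∑ _i : Fin (k + 1), C * (δ * M ^ k) := by
        gcongr with i
        refine (hC _ (mW i)).trans ?_
        gcongr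
        refine (Finset.prod_le_prod' fun j _ => hWn i j).trans (le_of_eq ?_)
        rw [← Finset.mul_prod_erase _ _ (Finset.mem_univ i), if_pos rfl]
        congr 1
        rw [Finset.prod_congr rfl fun j hj => if_neg (Finset.ne_of_mem_erase hj),
          Finset.prod_const, Finset.card_erase_of_mem (Finset.mem_univ i)]
        simp
    _ = _ := by
        simp only [Finset.sum_const, Finset.card_univ, Fintype.card_fin, nsmul_eq_mul]
        push_cast
        ring

theorem tendsto_countForm_of_tendsto_eLpNorm (hk : 1 ≤ k) (hb : Function.Injective b) {q : ℝ≥0∞}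
    (hq : ENNReal.ofReal ((k + 1 : ℝ) / 2) ≤ q) (hq1 : 1 ≤ q) {h : ℕ → Circ → ℝ} {f : Circ → ℝ}
    (mh : ∀ n, Measurable (h n)) (mf : Measurable f) (hh : ∀ n, MemLp (h n) q) (hf : MemLp f q)
    (hlim : Tendsto (fun n => eLpNorm (h n - f) q volume) atTop (𝓝 0)) (g : C(Circ × Circ, ℂ)) :
    Tendsto (fun n => countForm b g (fun _ => h n)) atTop (𝓝 (countForm b g fun _ => f)) := by
  obtain ⟨C, hC⟩ := exists_enorm_countForm_sub_le hk hb hq hq1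
  rw [tendsto_iff_edist_tendsto_0]
  simp only [edist_eq_enorm_sub]
  refine tendsto_of_tendsto_of_tendsto_of_le_of_le tendsto_const_nhds ?_ (fun _ => zero_le)
    fun n => hC g (h n) f (mh n) mf (hh n) hf
  have hA : 2 * eLpNorm f q volume ≠ ⊤ := ENNReal.mul_ne_top (by simp) hf.2.ne
  have h1 : Tendsto (fun n => (eLpNorm (h n - f) q volume + 2 * eLpNorm f q volume) ^ k) atTop
      (𝓝 ((0 + 2 * eLpNorm f q volume) ^ k)) :=
    ENNReal.Tendsto.pow (hlim.add tendsto_const_nhds)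
  have h2 := ENNReal.Tendsto.mul hlim (Or.inr (ENNReal.pow_ne_top (by simpa using hA))) h1
    (Or.inr ENNReal.zero_ne_top)
  have h3 := ENNReal.Tendsto.const_mul (a := ‖g‖ₑ)
    (ENNReal.Tendsto.const_mul (a := (C : ℝ≥0∞)) h2 (Or.inr ENNReal.coe_ne_top))
    (Or.inr enorm_ne_top)
  simpa using h3

theorem continuous_mollify (ψ : SchwartzMap ℝ ℝ) (n : ℕ) (μ : SignedMeasure Circ) :
    Continuous (mollify ψ n μ) :=
  (measureConv (kernelMap ψ n) μ).continuous

theorem exists_lintegral_mollify_le (hk : 1 ≤ k) (hb : Function.Injective b) {q : ℝ≥0∞}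
    (hq : ENNReal.ofReal ((k + 1 : ℝ) / 2) ≤ q) {ψ : SchwartzMap ℝ ℝ} {μ : SignedMeasure Circ}
    {B : ℝ≥0} (hB : ∀ n, eLpNorm (mollify ψ n μ) q volume ≤ B) :
    ∃ M : ℝ≥0, ∀ n,
      ∫⁻ p, ‖∏ i, mollify ψ n μ (p.1 - ((p.2 * b i : ℝ) : Circ))‖ₑ ∂stripMeasure ≤ M := by
  obtain ⟨C, hC⟩ := exists_lintegral_prod_translates_le_eLpNorm hk hb hq
  refine ⟨C * B ^ (k + 1), fun n => ?_⟩
  refine (hC (fun _ => mollify ψ n μ) fun _ => (continuous_mollify ψ n μ).measurable).trans ?_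
  rw [Finset.prod_const, Finset.card_univ, Fintype.card_fin]
  push_cast
  gcongr
  exact hB n

/-- Mollifying a measure is the same as mollifying a function with the same Fourier coefficients. -/
theorem measureConv_eq_circleConv {μ : SignedMeasure Circ} {f : Circ → ℂ}
    (hf : MeasureTheory.Integrable f) (h : ∀ ξ, fourierCoeff f ξ = measureCoeff μ ξ)
    (D : C(Circ, ℝ)) (x : Circ) : (measureConv D μ x : ℂ) = circleConv D f x := by
  have e := signedIntegral_eq_integral_of_coeff hf (fun n => (h n).symm)
    (toComplex (D.comp ⟨fun y => x - y, by fun_prop⟩))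
  rw [measureConv_apply, ← signedIntegral_ofReal μ
    (Continuous.integrable_of_compact _ (by fun_prop : Continuous fun y => D (x - y)))]
  exact e

/-- If `μ` has a density in `L^q`, the counting forms of its mollifications converge, to a limit
which does not depend on the mollifier. -/
theorem exists_tendsto_countForm_of_density (hk : 1 ≤ k) (hb : Function.Injective b) {q : ℝ≥0∞}
    (hq : ENNReal.ofReal ((k + 1 : ℝ) / 2) ≤ q) (hq1 : 1 ≤ q) (hqt : q ≠ ⊤)
    {μ : SignedMeasure Circ} {f : Circ → ℂ} (hf : MemLp f q)
    (h : ∀ ξ, fourierCoeff f ξ = measureCoeff μ ξ) (g : C(Circ × Circ, ℂ)) :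
    ∃ l : ℂ, ∀ ψ : SchwartzMap ℝ ℝ, ∫ t, ψ t = 1 →
      Tendsto (fun n => countForm b g (fun _ => mollify ψ n μ)) atTop (𝓝 l) := by
  -- The limit is the counting form of the real part of a measurable representative of `f`.
  obtain ⟨f', hf', hff'⟩ := hf.1
  have hre : Measurable fun x => (f' x).re := Complex.measurable_re.comp hf'.measurable
  have hre2 : MemLp (fun x => (f' x).re) q volume := ((memLp_congr_ae hff').1 hf).re
  refine ⟨countForm b g fun _ x => (f' x).re, fun ψ hψ => ?_⟩
  refine tendsto_countForm_of_tendsto_eLpNorm hk hb hq hq1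
    (fun n => (continuous_mollify ψ n μ).measurable) hre
    (fun n => ?_) hre2 ?_ g
  · exact (memLp_continuousMap (toComplex (measureConv (kernelMap ψ n) μ)) q).re
  · refine tendsto_of_tendsto_of_tendsto_of_le_of_le tendsto_const_nhds
      (tendsto_eLpNorm_circleConv_sub (isApproxIdentity_kernelMap ψ hψ) hq1 hqt hf)
      (fun _ => zero_le) fun n => eLpNorm_mono_ae ?_
    filter_upwards [hff'] with x hx
    rw [Pi.sub_apply, Pi.sub_apply, ← measureConv_eq_circleConv (hf.integrable hq1) h,
      ← measureConv_kernelMap, hx]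
    refine le_trans (le_of_eq ?_) (Complex.abs_re_le_norm _)
    rw [Complex.sub_re, Complex.ofReal_re, Real.norm_eq_abs]

theorem exists_eLpNorm_mollify_le_of_density {q : ℝ≥0∞} (hq1 : 1 ≤ q) (hqt : q ≠ ⊤)
    {μ : SignedMeasure Circ} {f : Circ → ℂ} (hf : MemLp f q)
    (h : ∀ ξ, fourierCoeff f ξ = measureCoeff μ ξ) {ψ : SchwartzMap ℝ ℝ} (hψ : ∫ t, ψ t = 1) :
    ∃ B : ℝ≥0, ∀ n, eLpNorm (mollify ψ n μ) q volume ≤ B := by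
  obtain ⟨K, hK⟩ := (isApproxIdentity_kernelMap ψ hψ).lintegral_le
  refine ⟨K * (eLpNorm f q volume).toNNReal, fun n => ?_⟩
  push_cast
  rw [ENNReal.coe_toNNReal hf.2.ne]
  refine le_trans (le_of_eq ?_) ((eLpNorm_circleConv_le (kernelMap ψ n) hq1 hqt hf).trans
    (mul_le_mul_left (hK n) _))
  refine eLpNorm_congr_norm_ae (ae_of_all _ fun x => ?_)
  rw [← measureConv_eq_circleConv (hf.integrable hq1) h, Complex.norm_real, measureConv_kernelMap]

theorem exists_eLpNorm_one_mollify_le (μ : SignedMeasure Circ) {ψ : SchwartzMap ℝ ℝ}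
    (hψ : ∫ t, ψ t = 1) : ∃ B : ℝ≥0, ∀ n, eLpNorm (mollify ψ n μ) 1 volume ≤ B := by
  obtain ⟨K, hK⟩ := (isApproxIdentity_kernelMap ψ hψ).bound
  refine ⟨(K * μ.totalVariation.real Set.univ).toNNReal, fun n => ?_⟩
  rw [eLpNorm_one_eq_lintegral_enorm, ← ofReal_integral_norm_eq_lintegral_enorm
    ((continuous_mollify ψ n μ).integrable_of_compact _)]
  refine ENNReal.ofReal_le_ofReal ((integral_abs_measureConv_le (kernelMap ψ n) μ).trans ?_)
  exact mul_le_mul_of_nonneg_right (hK n) measureReal_nonneg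

end CountLp

/-! ### From convergent functionals to measures -/

section LimitMeasure

open scoped ENNReal NNReal

variable {X Y : Type*} [TopologicalSpace X] [CompactSpace X] [T2Space X] [MeasurableSpace X]
  [BorelSpace X] [MeasurableSpace Y]

/-- Weak compactness: along an ultrafilter the push-forwards of densities of bounded mass converge
to a finite measure. -/
theorem exists_limit_measure_of_nonneg {π : Measure Y} {T : Y → X} (hT : Measurable T)
    {P : ℕ → Y → ℝ} (hP : ∀ n, Measurable (P n)) (h0 : ∀ n y, 0 ≤ P n y) {M : ℝ≥0}
    (hM : ∀ n, ∫⁻ y, ‖P n y‖ₑ ∂π ≤ M) :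
    ∃ ρ : Measure X, IsFiniteMeasure ρ ∧ ∀ g : C(X, ℂ),
      Tendsto (fun n => ∫ y, (P n y : ℂ) * g (T y) ∂π) (hyperfilter ℕ) (𝓝 (∫ x, g x ∂ρ)) := by
  have hmass : ∀ n, (Measure.map T (π.withDensity fun y => ‖P n y‖ₑ)) Set.univ ≤ M := fun n => by
    rw [Measure.map_apply hT MeasurableSet.univ, Set.preimage_univ,
      withDensity_apply _ MeasurableSet.univ, Measure.restrict_univ]
    exact hM n
  let ρ : ℕ → FiniteMeasure X := fun n =>
    ⟨Measure.map T (π.withDensity fun y => ‖P n y‖ₑ), ⟨(hmass n).trans_lt ENNReal.coe_lt_top⟩⟩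
  have hρ : ∀ n, ρ n ∈ {μ : FiniteMeasure X | μ.mass ≤ M} := fun n => by
    rw [Set.mem_ofPred_eq, ← ENNReal.coe_le_coe, FiniteMeasure.ennreal_mass]
    exact hmass n
  obtain ⟨σ, -, hσ⟩ :=
    (isCompact_setOfPred_finiteMeasure_le_of_compactSpace X M).ultrafilter_le_nhds'
    ((hyperfilter ℕ).map ρ) (Ultrafilter.mem_map.2 (Filter.univ_mem' hρ))
  have hσ' : Tendsto ρ (hyperfilter ℕ) (𝓝 σ) := hσ
  refine ⟨σ, inferInstance, fun g => ?_⟩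
  have h := (FiniteMeasure.tendsto_iff_forall_integral_rclike_tendsto ℂ).1 hσ'
    (BoundedContinuousFunction.mkOfCompact g)
  refine h.congr fun n => ?_
  change ∫ x, g x ∂(Measure.map T (π.withDensity fun y => ‖P n y‖ₑ)) = _
  rw [integral_map hT.aemeasurable g.continuous.aestronglyMeasurable,
    integral_withDensity_eq_integral_toReal_smul (hP n).enorm (ae_of_all _ fun _ => enorm_lt_top)]
  refine integral_congr_ae (ae_of_all _ fun y => ?_)
  simp only [toReal_enorm, Real.norm_of_nonneg (h0 n y), Complex.real_smul]

/-- If densities of bounded mass are such that their integrals against each continuous function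
converge, the limit functional is integration against a finite signed measure. -/
theorem exists_limit_signedMeasure {π : Measure Y} {T : Y → X} (hT : Measurable T)
    {P : ℕ → Y → ℝ} (hP : ∀ n, Measurable (P n)) {M : ℝ≥0}
    (hM : ∀ n, ∫⁻ y, ‖P n y‖ₑ ∂π ≤ M) {l : C(X, ℂ) → ℂ}
    (hl : ∀ g : C(X, ℂ), Tendsto (fun n => ∫ y, (P n y : ℂ) * g (T y) ∂π) atTop (𝓝 (l g))) :
    ∃ ν : SignedMeasure X, ∀ g : C(X, ℂ), l g = ∫ᵛ x, g x ∂<•ν := by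
  have hint : ∀ n, MeasureTheory.Integrable (P n) π := fun n =>
    ⟨(hP n).aestronglyMeasurable, (hM n).trans_lt ENNReal.coe_lt_top⟩
  have hle : ∀ {x y : ℝ}, 0 ≤ x → x ≤ |y| → ‖x‖ₑ ≤ ‖y‖ₑ := fun h0 h => by
    rw [enorm_le_iff_norm_le, Real.norm_of_nonneg h0]; exact h
  -- The positive and the negative parts of the densities have limits along the ultrafilter.
  obtain ⟨ρ₁, f₁, h₁⟩ := exists_limit_measure_of_nonneg hT (P := fun n y => max (P n y) 0)
    (fun n => (hP n).max measurable_const) (fun n y => le_max_right _ _) (M := M)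
    (fun n => (lintegral_mono fun y => hle (le_max_right _ _)
      (max_le (le_abs_self _) (abs_nonneg _))).trans (hM n))
  obtain ⟨ρ₂, f₂, h₂⟩ := exists_limit_measure_of_nonneg hT (P := fun n y => max (-P n y) 0)
    (fun n => (hP n).neg.max measurable_const) (fun n y => le_max_right _ _) (M := M)
    (fun n => (lintegral_mono fun y => hle (le_max_right _ _)
      (max_le (neg_le_abs _) (abs_nonneg _))).trans (hM n))
  refine ⟨ρ₁.toSignedMeasure - ρ₂.toSignedMeasure, fun g => ?_⟩
  have e : ∫ᵛ x, g x ∂<•(ρ₁.toSignedMeasure - ρ₂.toSignedMeasure)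
      = ∫ x, g x ∂ρ₁ - ∫ x, g x ∂ρ₂ := by
    rw [VectorMeasure.integral_sub_vectorMeasure, VectorMeasure.integral_toSignedMeasure,
      VectorMeasure.integral_toSignedMeasure]
    · simpa [VectorMeasure.Integrable] using g.continuous.integrable_of_compact ρ₁
    · simpa [VectorMeasure.Integrable] using g.continuous.integrable_of_compact ρ₂
  rw [e]
  refine tendsto_nhds_unique ((hl g).mono_left Nat.hyperfilter_le_atTop) ?_
  refine ((h₁ g).sub (h₂ g)).congr fun n => ?_
  have hb : ∀ {Q : Y → ℝ}, MeasureTheory.Integrable Q π →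
      MeasureTheory.Integrable (fun y => (Q y : ℂ) * g (T y)) π := fun hQ =>
    hQ.ofReal.mul_bdd (c := ‖g‖) (g.continuous.measurable.comp hT).aestronglyMeasurable
      (ae_of_all _ fun y => g.norm_coe_le_norm _)
  rw [← integral_sub (hb (hint n).pos_part) (hb (hint n).neg_part)]
  refine integral_congr_ae (ae_of_all _ fun y => ?_)
  simp only
  rw [← sub_mul, ← Complex.ofReal_sub, max_zero_sub_max_neg_zero_eq_self]

end LimitMeasure

section Intersection

open scoped ENNReal NNReal

variable {k : ℕ} {b : Fin (k + 1) → ℝ}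

/-- The counting form as the integral of `g` against a density on the strip; a continuous function
lies in `L^∞`, so no exponent has to be chosen. -/
theorem countForm_mollify_eq (hk : 1 ≤ k) (hb : Function.Injective b) (g : C(Circ × Circ, ℂ))
    (ψ : SchwartzMap ℝ ℝ) (n : ℕ) (μ : SignedMeasure Circ) :
    countForm b g (fun _ => mollify ψ n μ)
      = ∫ p, ((∏ i, mollify ψ n μ (p.1 - ((p.2 * b i : ℝ) : Circ)) : ℝ) : ℂ)
          * g (p.1, (p.2 : Circ)) ∂stripMeasure := by
  have hm : MemLp (mollify ψ n μ) ⊤ volume :=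
    (memLp_continuousMap (toComplex (measureConv (kernelMap ψ n) μ)) ⊤).re
  rw [countForm_eq_integral _ (integrable_countForm_integrand hk hb le_top g
    (fun _ => (continuous_mollify ψ n μ).measurable) fun _ => hm)]
  refine integral_congr_ae (ae_of_all _ fun p => ?_)
  simp only [Complex.ofReal_prod, mul_comm]

/-- Mass bounds for the densities, and convergence of the counting forms to a limit which does not
depend on the mollifier, produce the measure `∩^{k+1} μ`. Independence of the mollifier is what
gives positivity: the limit may be computed with a nonnegative mollifier. -/
theorem exists_intersection_measure (hk : 1 ≤ k) (hb : Function.Injective b)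
    {μ : SignedMeasure Circ}
    (hM : ∀ ψ : SchwartzMap ℝ ℝ, ∫ t, ψ t = 1 → ∃ M : ℝ≥0, ∀ n,
      ∫⁻ p, ‖∏ i, mollify ψ n μ (p.1 - ((p.2 * b i : ℝ) : Circ))‖ₑ ∂stripMeasure ≤ M)
    (hl : ∀ g : C(Circ × Circ, ℂ), ∃ l : ℂ, ∀ ψ : SchwartzMap ℝ ℝ, ∫ t, ψ t = 1 →
      Tendsto (fun n => countForm b g (fun _ => mollify ψ n μ)) atTop (𝓝 l))
    {φ : SchwartzMap ℝ ℝ} (hφ : ∫ t, φ t = 1) :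
    ∃ L : C(Circ × Circ, ℂ) →L[ℂ] ℂ,
      (∀ g : C(Circ × Circ, ℂ),
        Tendsto (fun n : ℕ => countForm b g (fun _ => mollify φ n μ)) atTop (𝓝 (L g))) ∧
      (∃! ν : SignedMeasure (Circ × Circ), ∀ g : C(Circ × Circ, ℂ), L g = ∫ᵛ p, g p ∂<•ν) ∧
      (0 ≤ μ → ∀ ν : SignedMeasure (Circ × Circ),
        (∀ g : C(Circ × Circ, ℂ), L g = ∫ᵛ p, g p ∂<•ν) → 0 ≤ ν) := by
  choose l hl using hl
  have hT : Measurable fun p : Circ × ℝ => (p.1, (p.2 : Circ)) :=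
    measurable_fst.prodMk (measurable_circ_coe.comp measurable_snd)
  have hP : ∀ (ψ : SchwartzMap ℝ ℝ) (n : ℕ), Measurable fun p : Circ × ℝ =>
      ∏ i, mollify ψ n μ (p.1 - ((p.2 * b i : ℝ) : Circ)) := fun ψ n =>
    measurable_prod_translate b (F := fun _ => mollify ψ n μ)
      fun _ => (continuous_mollify ψ n μ).measurable
  have hl' : ∀ (ψ : SchwartzMap ℝ ℝ), ∫ t, ψ t = 1 → ∀ g : C(Circ × Circ, ℂ), Tendsto (fun n =>
      ∫ p, ((∏ i, mollify ψ n μ (p.1 - ((p.2 * b i : ℝ) : Circ)) : ℝ) : ℂ)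
          * g (p.1, (p.2 : Circ)) ∂stripMeasure) atTop (𝓝 (l g)) := fun ψ hψ g =>
    (hl g ψ hψ).congr fun n => countForm_mollify_eq hk hb g ψ n μ
  have hext : ∀ ν₁ ν₂ : SignedMeasure (Circ × Circ),
      (∀ g : C(Circ × Circ, ℂ), ∫ᵛ p, g p ∂<•ν₁ = ∫ᵛ p, g p ∂<•ν₂) → ν₁ = ν₂ := by
    refine fun ν₁ ν₂ h => signedMeasure_ext_of_integral fun g => ?_
    have h1 := h (toComplex g)
    simp only [toComplex, ContinuousMap.coe_mk] at h1
    rw [signedIntegral_ofReal _ (g.continuous.integrable_of_compact _),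
      signedIntegral_ofReal _ (g.continuous.integrable_of_compact _)] at h1
    exact_mod_cast h1
  obtain ⟨M, hMφ⟩ := hM φ hφ
  obtain ⟨ν, hν⟩ := exists_limit_signedMeasure hT (hP φ) hMφ (hl' φ hφ)
  refine ⟨signedIntegralCLM ν, fun g => ?_, ⟨ν, fun g => rfl, fun ν' h => ?_⟩, fun hμ ν' h => ?_⟩
  · rw [signedIntegralCLM_apply, ← hν]
    exact hl g φ hφ
  · exact (hext _ _ h).symm
  · obtain ⟨ψ, hψ0, hψ⟩ := exists_nonneg_schwartz
    obtain ⟨M', hMψ⟩ := hM ψ hψ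
    obtain ⟨ρ, hρ, hρl⟩ := exists_limit_measure_of_nonneg hT (hP ψ)
      (fun n p => Finset.prod_nonneg fun i _ =>
        measureConv_nonneg (kernelMap_nonneg hψ0 n) hμ _) hMψ
    have e : ν' = ρ.toSignedMeasure := by
      refine hext _ _ fun g => ?_
      rw [← h g, signedIntegralCLM_apply, ← hν g, VectorMeasure.integral_toSignedMeasure]
      exact tendsto_nhds_unique ((hl' ψ hψ g).mono_left Nat.hyperfilter_le_atTop) (hρl g)
    rw [e]
    exact Measure.zero_le_toSignedMeasure ρ

end Intersection

/-! ### Reduction to characters -/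

section Characters

open scoped ENNReal NNReal

/-- The product character `(x, r) ↦ e(j x) e(l r)`. -/
def prodFourier (j l : ℤ) : C(Circ × Circ, ℂ) :=
  ⟨fun p => fourier j p.1 * fourier l p.2, by fun_prop⟩

/-- Trigonometric polynomials are dense in the continuous functions on the two-dimensional torus. -/
theorem eq_top_of_prodFourier_mem {S : Submodule ℂ C(Circ × Circ, ℂ)}
    (hS : IsClosed (S : Set C(Circ × Circ, ℂ))) (h : ∀ j l, prodFourier j l ∈ S) : S = ⊤ := by
  let e : C(Circ × Circ, UnitAddTorus (Fin 2)) :=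
    ⟨(Homeomorph.finTwoArrow (X := Circ)).symm,
      (Homeomorph.finTwoArrow (X := Circ)).symm.continuous⟩
  let e' : C(UnitAddTorus (Fin 2), Circ × Circ) :=
    ⟨(Homeomorph.finTwoArrow (X := Circ)), (Homeomorph.finTwoArrow (X := Circ)).continuous⟩
  let Φ : C(UnitAddTorus (Fin 2), ℂ) →ₗ[ℂ] C(Circ × Circ, ℂ) :=
    (ContinuousMap.compRightAlgHom ℂ ℂ e).toLinearMap
  have hΦ : Continuous Φ := ContinuousMap.compRightAlgHom_continuous ℂ ℂ e
  have hmem : ∀ n, UnitAddTorus.mFourier n ∈ S.comap Φ := by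
    intro n
    rw [Submodule.mem_comap]
    convert! h (n 0) (n 1) using 1
    ext p
    change ∏ i, (fourier (n i) (e p i) : ℂ) = _
    rw [Fin.prod_univ_two]
    rfl
  have htop : S.comap Φ = ⊤ := top_le_iff.1 (by
    rw [← UnitAddTorus.span_mFourier_closure_eq_top]
    exact Submodule.topologicalClosure_minimal _
      (Submodule.span_le.2 (Set.range_subset_iff.2 hmem)) (hS.preimage hΦ))
  refine eq_top_iff.2 fun g _ => ?_
  have h1 : g.comp e' ∈ S.comap Φ := by rw [htop]; trivial
  rw [Submodule.mem_comap] at h1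
  convert! h1 using 1

/-- Integration of `g(x, r)` against the density `P` on the strip, as a functional of `g`. -/
def stripCLM {P : Circ × ℝ → ℝ} (hP : MeasureTheory.Integrable P stripMeasure) :
    C(Circ × Circ, ℂ) →L[ℂ] ℂ :=
  have hT : Measurable fun p : Circ × ℝ => (p.1, (p.2 : Circ)) :=
    measurable_fst.prodMk (measurable_circ_coe.comp measurable_snd)
  have hint : ∀ g : C(Circ × Circ, ℂ),
      MeasureTheory.Integrable (fun p => (P p : ℂ) * g (p.1, (p.2 : Circ))) stripMeasure := fun g =>
    hP.ofReal.mul_bdd (c := ‖g‖) (g.continuous.measurable.comp hT).aestronglyMeasurable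
      (ae_of_all _ fun y => g.norm_coe_le_norm _)
  LinearMap.mkContinuous
    { toFun := fun g => ∫ p, (P p : ℂ) * g (p.1, (p.2 : Circ)) ∂stripMeasure
      map_add' := fun g h => by
        rw [← integral_add (hint g) (hint h)]
        simp only [ContinuousMap.add_apply, mul_add]
      map_smul' := fun c g => by
        simp only [ContinuousMap.smul_apply, smul_eq_mul, RingHom.id_apply, ← integral_const_mul]
        congr 1
        ext p
        ring }
    (∫ p, ‖P p‖ ∂stripMeasure) (fun g => by
      rw [← integral_mul_const]
      refine norm_integral_le_of_norm_le (hP.norm.mul_const _) (ae_of_all _ fun p => ?_)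
      rw [norm_mul, Complex.norm_real]
      gcongr
      exact g.norm_coe_le_norm _)

theorem stripCLM_apply {P : Circ × ℝ → ℝ} (hP : MeasureTheory.Integrable P stripMeasure)
    (g : C(Circ × Circ, ℂ)) :
    stripCLM hP g = ∫ p, (P p : ℂ) * g (p.1, (p.2 : Circ)) ∂stripMeasure := rfl

theorem norm_stripCLM_le {P : Circ × ℝ → ℝ} (hP : MeasureTheory.Integrable P stripMeasure) :
    ‖stripCLM hP‖ ≤ ∫ p, ‖P p‖ ∂stripMeasure :=
  ContinuousLinearMap.opNorm_le_bound _ (integral_nonneg fun _ => norm_nonneg _) fun g => by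
    rw [stripCLM_apply, ← integral_mul_const]
    refine norm_integral_le_of_norm_le (hP.norm.mul_const _) (ae_of_all _ fun p => ?_)
    rw [norm_mul, Complex.norm_real]
    gcongr
    exact g.norm_coe_le_norm _

/-- Bounded sequences of functionals with a common limit on characters have a common limit on all
continuous functions. -/
theorem exists_common_limit {I : Type*} [Nonempty I] (A : I → ℕ → C(Circ × Circ, ℂ) →L[ℂ] ℂ)
    (hA : ∀ i, ∃ M, ∀ n, ‖A i n‖ ≤ M)
    (h : ∀ j l, ∃ c : ℂ, ∀ i, Tendsto (fun n => A i n (prodFourier j l)) atTop (𝓝 c))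
    (g : C(Circ × Circ, ℂ)) : ∃ c : ℂ, ∀ i, Tendsto (fun n => A i n g) atTop (𝓝 c) := by
  -- For equicontinuous functionals, the set of `g` at which the differences tend to zero is a
  -- closed subspace.
  have key : ∀ i i', Tendsto (fun p : ℕ × ℕ => A i p.1 g - A i' p.2 g) atTop (𝓝 0) := by
    intro i i'
    obtain ⟨M, hM⟩ := hA i
    obtain ⟨M', hM'⟩ := hA i'
    let B : ℕ × ℕ → C(Circ × Circ, ℂ) →L[ℂ] ℂ := fun p => A i p.1 - A i' p.2
    have hB : ∃ C, ∀ p, ‖B p‖ ≤ C :=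
      ⟨M + M', fun p => (norm_sub_le (A i p.1) (A i' p.2)).trans (add_le_add (hM _) (hM' _))⟩
    have heq : Equicontinuous ((↑) ∘ B) :=
      ((NormedSpace.equicontinuous_TFAE (fun p => B p)).out 5 1).1 hB
    let S : Submodule ℂ C(Circ × Circ, ℂ) :=
      { carrier := {g | Tendsto (fun p => B p g) atTop (𝓝 0)}
        zero_mem' := by simp
        add_mem' := fun ha hb => by
          have := Tendsto.add ha hb
          simp only [add_zero, ← map_add] at this
          exact this
        smul_mem' := fun c a ha => by
          have := Tendsto.const_smul ha c
          simp only [smul_zero, ← map_smul] at this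
          exact this }
    have hSc : IsClosed (S : Set C(Circ × Circ, ℂ)) :=
      heq.isClosed_setOfPred_tendsto (f := fun _ => 0) continuous_const
    have hS : S = ⊤ := eq_top_of_prodFourier_mem hSc fun j l => by
      obtain ⟨c, hc⟩ := h j l
      have h1 := ((hc i).comp tendsto_fst).sub ((hc i').comp tendsto_snd)
      rw [sub_self, prod_atTop_atTop_eq] at h1
      exact h1
    have : g ∈ S := by rw [hS]; trivial
    exact this
  obtain ⟨i₀⟩ := ‹Nonempty I›
  have hc : CauchySeq fun n => A i₀ n g := by
    rw [cauchySeq_iff_tendsto_dist_atTop_0]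
    simpa only [dist_eq_norm, norm_zero] using (key i₀ i₀).norm
  obtain ⟨c, hc⟩ := cauchySeq_tendsto_of_complete hc
  refine ⟨c, fun i => ?_⟩
  have h1 := ((key i i₀).comp tendsto_atTop_diagonal).add hc
  rw [zero_add] at h1
  exact h1.congr fun n => by simp

theorem exists_tendsto_countForm_of_prodFourier {k : ℕ} {b : Fin (k + 1) → ℝ} (hk : 1 ≤ k)
    (hb : Function.Injective b) {μ : SignedMeasure Circ}
    (hM : ∀ ψ : SchwartzMap ℝ ℝ, ∫ t, ψ t = 1 → ∃ M : ℝ≥0, ∀ n,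
      ∫⁻ p, ‖∏ i, mollify ψ n μ (p.1 - ((p.2 * b i : ℝ) : Circ))‖ₑ ∂stripMeasure ≤ M)
    (h : ∀ j l, ∃ c : ℂ, ∀ ψ : SchwartzMap ℝ ℝ, ∫ t, ψ t = 1 → Tendsto
      (fun n => countForm b (prodFourier j l) (fun _ => mollify ψ n μ)) atTop (𝓝 c))
    (g : C(Circ × Circ, ℂ)) :
    ∃ c : ℂ, ∀ ψ : SchwartzMap ℝ ℝ, ∫ t, ψ t = 1 →
      Tendsto (fun n => countForm b g (fun _ => mollify ψ n μ)) atTop (𝓝 c) := by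
  let I := {ψ : SchwartzMap ℝ ℝ // ∫ t, ψ t = 1}
  have hne : Nonempty I := by
    obtain ⟨ψ, -, hψ⟩ := exists_nonneg_schwartz
    exact ⟨⟨ψ, hψ⟩⟩
  have hP : ∀ (i : I) (n : ℕ), MeasureTheory.Integrable (fun p : Circ × ℝ =>
      ∏ s, mollify i.1 n μ (p.1 - ((p.2 * b s : ℝ) : Circ))) stripMeasure := fun i n => by
    obtain ⟨M, hM⟩ := hM i.1 i.2
    exact ⟨(measurable_prod_translate b (F := fun _ => mollify i.1 n μ) fun _ =>
      (continuous_mollify i.1 n μ).measurable).aestronglyMeasurable,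
      (hM n).trans_lt ENNReal.coe_lt_top⟩
  have hA : ∀ (i : I) (n : ℕ) (g : C(Circ × Circ, ℂ)),
      stripCLM (hP i n) g = countForm b g (fun _ => mollify i.1 n μ) := fun i n g =>
    (countForm_mollify_eq hk hb g i.1 n μ).symm
  obtain ⟨c, hc⟩ := exists_common_limit (fun i n => stripCLM (hP i n)) (fun i => by
    obtain ⟨M, hM⟩ := hM i.1 i.2
    refine ⟨M, fun n => (norm_stripCLM_le _).trans ?_⟩
    rw [integral_norm_eq_lintegral_enorm (hP i n).1]
    exact ENNReal.toReal_le_coe_of_le_coe (hM n)) (fun j l => by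
    obtain ⟨c, hc⟩ := h j l
    exact ⟨c, fun i => (hc i.1 i.2).congr fun n => (hA i n _).symm⟩) g
  exact ⟨c, fun ψ hψ => (hc ⟨ψ, hψ⟩).congr fun n => hA ⟨ψ, hψ⟩ n g⟩

end Characters

/-! ### The bilinear counting form on the frequency side -/

section Bilinear

open scoped ENNReal NNReal ComplexConjugate

theorem signedIntegral_re {X : Type*} [MeasurableSpace X] (μ : SignedMeasure X) {f : X → ℂ}
    (hf : MeasureTheory.Integrable f μ.totalVariation) :
    ∫ᵛ x, (f x).re ∂<•μ = (∫ᵛ x, f x ∂<•μ).re := by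
  have h1 : MeasureTheory.Integrable f μ.toJordanDecomposition.posPart :=
    hf.mono_measure (Measure.le_add_right le_rfl)
  have h2 : MeasureTheory.Integrable f μ.toJordanDecomposition.negPart :=
    hf.mono_measure (Measure.le_add_left le_rfl)
  have h3 := signedIntegral_eq_sub μ hf.re
  simp only [RCLike.re_to_complex] at h3
  rw [signedIntegral_eq_sub μ hf, h3, Complex.sub_re]
  exact congrArg₂ _ (integral_re h1) (integral_re h2)

/-- The first cube product has Fourier coefficient `|f̂(ξ)|²` at the frequency `(0; ξ)`. -/
theorem integral_re_fourier_mul_cubeProduct_one (f : C(Circ, ℝ)) (ξ : ℤ) :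
    ∫ x : Circ, ∫ u : Fin 1 → Circ, (fourier (-ξ) (u 0) : ℂ).re * cubeProduct 1 f x u
      = ‖fourierCoeff (fun x => (f x : ℂ)) ξ‖ ^ 2 := by
  have h1 : ∀ x : Circ, ∫ u : Fin 1 → Circ, (fourier (-ξ) (u 0) : ℂ).re * cubeProduct 1 f x u
      = ∫ v : Circ, (fourier (-ξ) v : ℂ).re * (f x * f (v + x)) := by
    intro x
    have hc : Continuous fun u : Fin 1 → Circ =>
        (fourier (-ξ) (u 0) : ℂ).re * cubeProduct 1 f x u :=
      (by fun_prop : Continuous fun u : Fin 1 → Circ => (fourier (-ξ) (u 0) : ℂ).re).mul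
        ((continuous_cubeProduct 1 f.continuous).comp (Continuous.prodMk_right x))
    rw [integral_pi_cons 0 hc]
    refine integral_congr_ae (ae_of_all _ fun v => ?_)
    have : ∀ u : Fin 0 → Circ, (fourier (-ξ) ((Fin.cons v u : Fin 1 → Circ) 0) : ℂ).re *
        cubeProduct 1 f x (Fin.cons v u) = (fourier (-ξ) v : ℂ).re * (f x * f (v + x)) := by
      intro u
      rw [Fin.cons_zero, cubeProduct_cons 0 f x v u, cubeProduct, Fintype.prod_unique,
        Finset.sum_eq_zero fun i _ => i.elim0, add_zero]
      simp only [shiftMul, ContinuousMap.coe_mk, add_comm]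
    simp only [this, integral_const, probReal_univ, one_smul]
  simp only [h1]
  rw [integral_integral_swap (Continuous.integrable_of_compact _ (by fun_prop))]
  have h2 := congrArg Complex.re (fourierCoeff_autocorr f ξ)
  rw [Complex.ofReal_re, fourierCoeff_eq_integral] at h2
  rw [← h2]
  have h3 : MeasureTheory.Integrable (fun v => (fourier (-ξ) v : ℂ) * (autocorr f v : ℂ)) volume :=
    Continuous.integrable_of_compact _ (by fun_prop)
  refine Eq.trans (integral_congr_ae (ae_of_all _ fun v => ?_)) (integral_re h3)
  simp only [RCLike.re_to_complex, Complex.re_mul_ofReal, autocorr_apply, integral_const_mul]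

/-- For `k = 1` the decay of the cube measure is a decay of the Fourier coefficients of `μ`, since
`|μ̂(ξ)|²` is the Fourier coefficient of `△¹ μ` at `(0; ξ)`. -/
theorem norm_measureCoeff_sq_le {φ : SchwartzMap ℝ ℝ} (hφ : ∫ t, φ t = 1) {μ : SignedMeasure Circ}
    {ν : SignedMeasure (Circ × (Fin 1 → Circ))} (hν : IsCubeMeasure φ μ 1 ν) (ξ : ℤ) :
    ‖measureCoeff μ ξ‖ ^ 2 ≤ ‖cubeFourier ν fun _ => ξ‖ := by
  have h := hν ⟨fun p => (fourier (-ξ) (p.2 0) : ℂ).re, by fun_prop⟩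
  have e : ∀ n, ∫ x : Circ, ∫ u : Fin 1 → Circ, (fourier (-ξ) (u 0) : ℂ).re *
      cubeProduct 1 (mollify φ n μ) x u
      = ‖fourierCoeff (fun x => (kernelMap φ n x : ℂ)) ξ * measureCoeff μ ξ‖ ^ 2 := fun n => by
    rw [← fourierCoeff_measureConv, ← integral_re_fourier_mul_cubeProduct_one]
    rfl
  simp only [ContinuousMap.coe_mk, e] at h
  have h2 := ((((isApproxIdentity_kernelMap φ hφ).coeff ξ).mul_const (measureCoeff μ ξ)).norm).pow 2
  rw [one_mul] at h2
  rw [tendsto_nhds_unique h2 h, signedIntegral_re ν (Continuous.integrable_of_compact _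
    (by fun_prop : Continuous fun p : Circ × (Fin 1 → Circ) => (fourier (-ξ) (p.2 0) : ℂ)))]
  refine (Complex.re_le_norm _).trans (le_of_eq ?_)
  simp [cubeFourier]

/-- The oscillatory integral `∫₀¹ e(θ r) dr`. -/
def phaseIntegral (θ : ℝ) : ℂ :=
  ∫ r in Set.Ioc (0 : ℝ) 1, Complex.exp (2 * Real.pi * Complex.I * θ * r)

theorem norm_exp_phase (θ r : ℝ) : ‖Complex.exp (2 * Real.pi * Complex.I * θ * r)‖ = 1 := by
  rw [show 2 * Real.pi * Complex.I * θ * r = ((2 * Real.pi * θ * r : ℝ) : ℂ) * Complex.I by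
    push_cast; ring]
  exact Complex.norm_exp_ofReal_mul_I _

theorem norm_phaseIntegral_le (θ : ℝ) : ‖phaseIntegral θ‖ * (1 + |θ|) ≤ 2 := by
  have h1 : ‖phaseIntegral θ‖ ≤ 1 := by
    refine (norm_integral_le_integral_norm _).trans ?_
    simp [norm_exp_phase]
  have h2 : ‖phaseIntegral θ‖ * |θ| ≤ 1 := by
    rcases eq_or_ne θ 0 with rfl | hθ
    · simp
    have hc : 2 * Real.pi * Complex.I * θ ≠ 0 := by
      simp [hθ, Real.pi_ne_zero]
    have e := integral_exp_mul_complex (a := 0) (b := 1) hc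
    rw [intervalIntegral.integral_of_le zero_le_one] at e
    rw [phaseIntegral, e, norm_div]
    have h3 : ‖Complex.exp (2 * Real.pi * Complex.I * θ * (1 : ℝ))
        - Complex.exp (2 * Real.pi * Complex.I * θ * (0 : ℝ))‖ ≤ 2 :=
      (norm_sub_le _ _).trans (by rw [norm_exp_phase, norm_exp_phase]; norm_num)
    have h4 : ‖2 * (Real.pi : ℂ) * Complex.I * θ‖ = 2 * Real.pi * |θ| := by
      simp [abs_of_pos Real.pi_pos]
    have hθ' : 0 < |θ| := abs_pos.2 hθ
    rw [h4, div_mul_eq_mul_div, div_le_one (by positivity)]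
    have := Real.pi_gt_three
    nlinarith
  linarith

/-- The phase integral along an arithmetic progression of nonzero step decays like `1/|ξ|`. -/
theorem exists_norm_phaseIntegral_le (a : ℝ) {d : ℝ} (hd : d ≠ 0) :
    ∃ B : ℝ, 0 ≤ B ∧ ∀ ξ : ℤ, ‖phaseIntegral (a + ξ * d)‖ ≤ B / (1 + |(ξ : ℝ)|) := by
  have hd' : 0 < |d| := abs_pos.2 hd
  refine ⟨2 * (1 + (1 + |a|) / |d|), by positivity, fun ξ => ?_⟩
  rw [le_div_iff₀ (by positivity)]
  set θ := a + ξ * d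
  have h1 : |(ξ : ℝ)| * |d| ≤ |θ| + |a| := by
    rw [← abs_mul, show (ξ : ℝ) * d = θ - a by simp [θ]]
    exact abs_sub _ _
  have h2 : 1 + |(ξ : ℝ)| ≤ (1 + |θ|) * (1 + (1 + |a|) / |d|) := by
    have h3 : |(ξ : ℝ)| ≤ (|θ| + |a|) / |d| := by rwa [le_div_iff₀ hd']
    have h4 : (1 + |θ|) * (1 + (1 + |a|) / |d|)
        = 1 + |θ| + (|θ| + |a|) / |d| + (1 + |θ| * |a|) / |d| := by field_simp; ring
    have h5 : 0 ≤ (1 + |θ| * |a|) / |d| := by positivity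
    have := abs_nonneg θ
    linarith
  calc ‖phaseIntegral θ‖ * (1 + |(ξ : ℝ)|)
      ≤ ‖phaseIntegral θ‖ * ((1 + |θ|) * (1 + (1 + |a|) / |d|)) := by gcongr
    _ = (‖phaseIntegral θ‖ * (1 + |θ|)) * (1 + (1 + |a|) / |d|) := by ring
    _ ≤ _ := by gcongr; exact norm_phaseIntegral_le θ

theorem fourierCoeff_translate (F : Circ → ℂ) (t : Circ) (ξ : ℤ) :
    fourierCoeff (fun x => F (x - t)) ξ = fourier (-ξ) t * fourierCoeff F ξ := by
  rw [fourierCoeff_eq_integral, fourierCoeff_eq_integral, ← integral_add_right_eq_self _ t,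
    ← integral_const_mul]
  refine integral_congr_ae (ae_of_all _ fun x => ?_)
  simp only [add_sub_cancel_right, fourier_add_apply]
  ring

/-- Parseval's identity for two translates of a function. -/
theorem hasSum_integral_fourier_mul_translates (f : C(Circ, ℝ)) (j : ℤ) (s t : Circ) :
    HasSum (fun ξ => (fourier (j + ξ) s : ℂ) * fourier (-ξ) t *
        (fourierCoeff (fun x => (f x : ℂ)) (-j - ξ) * fourierCoeff (fun x => (f x : ℂ)) ξ))
      (∫ x, (fourier j x : ℂ) * ((f (x - s) : ℂ) * f (x - t))) := by
  have h := hasSum_conj_fourierCoeff_mul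
    (memLp_continuousMap ⟨fun x => (fourier (-j) x : ℂ) * f (x - s), by fun_prop⟩ 2)
    (memLp_continuousMap ⟨fun x => (f (x - t) : ℂ), by fun_prop⟩ 2)
  simp only [ContinuousMap.coe_mk] at h
  have e1 : ∀ ξ, fourierCoeff (fun x => (fourier (-j) x : ℂ) * f (x - s)) ξ
      = fourier (-(j + ξ)) s * fourierCoeff (fun x => (f x : ℂ)) (j + ξ) := by
    intro ξ
    rw [← fourierCoeff_translate (fun x => (f x : ℂ)), fourierCoeff_eq_integral,
      fourierCoeff_eq_integral]
    refine integral_congr_ae (ae_of_all _ fun x => ?_)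
    simp only
    rw [← mul_assoc, ← fourier_add, neg_add, add_comm (-j)]
  have e2 : ∀ ξ, fourierCoeff (fun x => (f (x - t) : ℂ)) ξ
      = fourier (-ξ) t * fourierCoeff (fun x => (f x : ℂ)) ξ :=
    fun ξ => fourierCoeff_translate (fun x => (f x : ℂ)) t ξ
  convert! h using 1
  · funext ξ
    have e3 : conj (fourier (-(j + ξ)) s : ℂ) = fourier (j + ξ) s := by
      rw [fourier_neg, Complex.conj_conj]
    rw [e1, e2, map_mul, ← fourierCoeff_neg_eq_conj, e3, neg_add']
    ring
  · refine integral_congr_ae (ae_of_all _ fun x => ?_)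
    simp only [map_mul, fourier_neg, Complex.conj_conj, Complex.conj_ofReal]
    ring

theorem summable_norm_fourierCoeff_mul (f : C(Circ, ℝ)) (j : ℤ) :
    Summable fun ξ => ‖fourierCoeff (fun x => (f x : ℂ)) (-j - ξ)
      * fourierCoeff (fun x => (f x : ℂ)) ξ‖ := by
  refine (hasSum_integral_fourier_mul_translates f j 0 0).summable.norm.congr fun ξ => ?_
  rw [norm_mul, norm_mul (fourier _ _), norm_fourier_apply, norm_fourier_apply, one_mul, one_mul]

/-- The bilinear counting form at a product of characters, expanded in Fourier coefficients. -/
theorem countForm_prodFourier {b : Fin 2 → ℝ} (hb : Function.Injective b) (f : C(Circ, ℝ))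
    (j l : ℤ) :
    countForm (k := 1) b (prodFourier j l) (fun _ => f)
      = ∑' ξ : ℤ, fourierCoeff (fun x => (f x : ℂ)) (-j - ξ) * fourierCoeff (fun x => (f x : ℂ)) ξ
          * phaseIntegral ((l + j * b 0) + ξ * (b 0 - b 1)) := by
  have hm : MemLp f ⊤ volume := (memLp_continuousMap (toComplex f) ⊤).re
  have hI := integrable_countForm_integrand (k := 1) le_rfl hb le_top (prodFourier j l)
    (F := fun _ => f) (fun _ => f.continuous.measurable) fun _ => hm
  rw [countForm_eq_integral _ hI]
  unfold stripMeasure at hI ⊢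
  rw [integral_prod_symm _ hI]
  set c : ℤ → ℂ := fun ξ => fourierCoeff (fun x => (f x : ℂ)) (-j - ξ)
    * fourierCoeff (fun x => (f x : ℂ)) ξ
  set θ : ℤ → ℝ := fun ξ => (l + j * b 0) + ξ * (b 0 - b 1)
  -- Expand the integral over the circle for fixed `r`, then integrate termwise in `r`.
  have hsum : ∀ r : ℝ, HasSum (fun ξ => c ξ * Complex.exp (2 * Real.pi * Complex.I * θ ξ * r))
      (∫ x : Circ, prodFourier j l (x, (r : Circ)) *
        ∏ i, ((f (x - ((r * b i : ℝ) : Circ)) : ℝ) : ℂ)) := by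
    intro r
    have h := (hasSum_integral_fourier_mul_translates f j ((r * b 0 : ℝ) : Circ)
      ((r * b 1 : ℝ) : Circ)).mul_left (fourier l (r : Circ) : ℂ)
    convert! h using 1
    · funext ξ
      have e : (fourier l (r : Circ) : ℂ) * (fourier (j + ξ) ((r * b 0 : ℝ) : Circ)
          * fourier (-ξ) ((r * b 1 : ℝ) : Circ))
          = Complex.exp (2 * Real.pi * Complex.I * θ ξ * r) := by
        simp only [fourier_coe_apply, θ]
        rw [← Complex.exp_add, ← Complex.exp_add]
        congr 1
        push_cast
        ring
      rw [← e]
      simp only [c]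
      ring
    · rw [← integral_const_mul]
      refine integral_congr_ae (ae_of_all _ fun x => ?_)
      simp only [prodFourier, ContinuousMap.coe_mk, Fin.prod_univ_two]
      ring
  have hc : Summable fun ξ => ‖c ξ‖ := summable_norm_fourierCoeff_mul f j
  have hcont : ∀ ξ, Continuous fun r : ℝ =>
      c ξ * Complex.exp (2 * Real.pi * Complex.I * θ ξ * r) := fun ξ => by fun_prop
  have hn : ∀ ξ (r : ℝ), ‖c ξ * Complex.exp (2 * Real.pi * Complex.I * θ ξ * r)‖ = ‖c ξ‖ :=
    fun ξ r => by rw [norm_mul, norm_exp_phase, mul_one]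
  have h := hasSum_integral_of_summable_integral_norm
    (μ := (volume : Measure ℝ).restrict (Set.Ioc 0 1))
    (F := fun ξ r => c ξ * Complex.exp (2 * Real.pi * Complex.I * θ ξ * r))
    (fun ξ => ((hcont ξ).integrableOn_Icc).mono_set Set.Ioc_subset_Icc_self)
    (hc.congr fun ξ => by simp only [hn]; simp)
  simp only [integral_const_mul] at h
  rw [show (∑' ξ, c ξ * phaseIntegral (θ ξ)) = _ from h.tsum_eq]
  exact integral_congr_ae (ae_of_all _ fun r => (hsum r).tsum_eq.symm)

/-- The dominating series for the bilinear form: by the inequality of the arithmetic and geometric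
means its terms are bounded by `|c(ξ)|²/(1+|ξ|)` and its reflection. -/
theorem summable_norm_mul_phase {c : ℤ → ℂ} {C β B : ℝ} (hβ : 0 < β)
    (hc : ∀ ξ, ‖c ξ‖ ^ 2 ≤ C * (1 + |(ξ : ℝ)|) ^ (-β)) {J : ℤ → ℂ} (hB : 0 ≤ B)
    (hJ : ∀ ξ : ℤ, ‖J ξ‖ ≤ B / (1 + |(ξ : ℝ)|)) (j : ℤ) :
    Summable fun ξ => ‖c (-j - ξ)‖ * ‖c ξ‖ * ‖J ξ‖ := by
  obtain ⟨w, hws, hcw⟩ : ∃ w : ℤ → ℝ, Summable w ∧ ∀ ξ : ℤ, ‖c ξ‖ ^ 2 / (1 + |(ξ : ℝ)|) ≤ w ξ := by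
    refine ⟨fun ξ => C * (1 + |(ξ : ℝ)|) ^ (-(1 + β)),
      (summable_one_add_abs_rpow (by linarith)).mul_left C, fun ξ => ?_⟩
    have hp : 0 < 1 + |(ξ : ℝ)| := by positivity
    rw [div_le_iff₀ hp]
    refine (hc ξ).trans (le_of_eq ?_)
    rw [mul_assoc, ← Real.rpow_add_one hp.ne']
    congr 2
    ring
  have hws' : Summable fun ξ => w (-j - ξ) :=
    (Equiv.summable_iff (Equiv.subLeft (-j)) (f := w)).2 hws
  refine Summable.of_nonneg_of_le (fun ξ => by positivity) (fun ξ => ?_)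
    (((hws'.mul_left (1 + |(j : ℝ)|)).add hws).mul_left B)
  have hp : 0 < 1 + |(ξ : ℝ)| := by positivity
  have hp' : 0 < 1 + |((-j - ξ : ℤ) : ℝ)| := by positivity
  have h1 : ‖c (-j - ξ)‖ ^ 2 / (1 + |(ξ : ℝ)|) ≤ (1 + |(j : ℝ)|) * w (-j - ξ) := by
    refine le_trans ?_ (mul_le_mul_of_nonneg_left (hcw (-j - ξ)) (by positivity))
    rw [← mul_div_assoc, div_le_div_iff₀ hp hp']
    have h2 : |((-j - ξ : ℤ) : ℝ)| ≤ |(j : ℝ)| + |(ξ : ℝ)| := by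
      push_cast
      exact (abs_sub _ _).trans (by rw [abs_neg])
    have h3 : 1 + |((-j - ξ : ℤ) : ℝ)| ≤ (1 + |(j : ℝ)|) * (1 + |(ξ : ℝ)|) := by
      nlinarith [abs_nonneg (j : ℝ), abs_nonneg (ξ : ℝ)]
    nlinarith [sq_nonneg ‖c (-j - ξ)‖]
  calc ‖c (-j - ξ)‖ * ‖c ξ‖ * ‖J ξ‖
      ≤ (‖c (-j - ξ)‖ ^ 2 + ‖c ξ‖ ^ 2) * (B / (1 + |(ξ : ℝ)|)) := by
        gcongr
        · nlinarith [sq_nonneg (‖c (-j - ξ)‖ - ‖c ξ‖), sq_nonneg (‖c (-j - ξ)‖ + ‖c ξ‖)]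
        · exact hJ ξ
    _ = B * (‖c (-j - ξ)‖ ^ 2 / (1 + |(ξ : ℝ)|) + ‖c ξ‖ ^ 2 / (1 + |(ξ : ℝ)|)) := by ring
    _ ≤ _ := by gcongr; exact hcw ξ

/-- If the Fourier coefficients of `μ` decay like a negative power, the bilinear counting forms of
its mollifications converge at each product of characters, to a limit which does not depend on
the mollifier. -/
theorem exists_tendsto_countForm_of_measureCoeff {b : Fin 2 → ℝ} (hb : Function.Injective b)
    {μ : SignedMeasure Circ} {C β : ℝ} (hβ : 0 < β)
    (hc : ∀ ξ : ℤ, ‖measureCoeff μ ξ‖ ^ 2 ≤ C * (1 + |(ξ : ℝ)|) ^ (-β)) (j l : ℤ) :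
    ∃ c : ℂ, ∀ ψ : SchwartzMap ℝ ℝ, ∫ t, ψ t = 1 → Tendsto
      (fun n => countForm (k := 1) b (prodFourier j l) (fun _ => mollify ψ n μ)) atTop (𝓝 c) := by
  have hd : b 0 - b 1 ≠ 0 := sub_ne_zero.2 fun h => zero_ne_one (hb h)
  obtain ⟨B, hB, hJ⟩ := exists_norm_phaseIntegral_le (l + j * b 0) hd
  have hsum := summable_norm_mul_phase hβ hc hB hJ j
  refine ⟨∑' ξ : ℤ, measureCoeff μ (-j - ξ) * measureCoeff μ ξ
    * phaseIntegral ((l + j * b 0) + ξ * (b 0 - b 1)), fun ψ hψ => ?_⟩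
  obtain ⟨K, hK⟩ := (isApproxIdentity_kernelMap ψ hψ).bound
  have hK' : ∀ n ξ, ‖fourierCoeff (fun x => (kernelMap ψ n x : ℂ)) ξ‖ ≤ K := fun n ξ => by
    refine (norm_fourierCoeff_le _ ξ).trans ?_
    simp only [Complex.norm_real, Real.norm_eq_abs]
    exact hK n
  have hK0 : 0 ≤ K := (norm_nonneg _).trans (hK' 0 0)
  have e : ∀ n, countForm (k := 1) b (prodFourier j l) (fun _ => mollify ψ n μ) = _ := fun n =>
    countForm_prodFourier hb (measureConv (kernelMap ψ n) μ) j l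
  simp only [e, fourierCoeff_measureConv]
  refine tendsto_tsum_of_dominated_convergence (hsum.mul_left (K * K)) (fun ξ => ?_)
    (Eventually.of_forall fun n ξ => ?_)
  · have h1 := ((isApproxIdentity_kernelMap ψ hψ).coeff (-j - ξ)).mul_const
      (measureCoeff μ (-j - ξ))
    have h2 := ((isApproxIdentity_kernelMap ψ hψ).coeff ξ).mul_const (measureCoeff μ ξ)
    have h3 := (h1.mul h2).mul_const (phaseIntegral ((l + j * b 0) + ξ * (b 0 - b 1)))
    simpa only [one_mul] using h3
  · simp only [norm_mul]
    calc _ ≤ (K * ‖measureCoeff μ (-j - ξ)‖) * (K * ‖measureCoeff μ ξ‖)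
          * ‖phaseIntegral ((l + j * b 0) + ξ * (b 0 - b 1))‖ := by
          gcongr
          · exact hK' _ _
          · exact hK' _ _
      _ = _ := by ring

end Bilinear

/-! ### Existence of the intersection measure -/

/-- Mass bounds and convergence in the bilinear case, where `μ` need not have a density. -/
theorem mollify_bilinear_bounds {b : Fin 2 → ℝ} (hb : Function.Injective b) {φ : SchwartzMap ℝ ℝ}
    (hφ : ∫ t, φ t = 1) {β : ℝ} (hβ : 0 < β) {μ : SignedMeasure Circ}
    (hμ : HasCubeDecay φ μ 1 β) :
    (∀ ψ : SchwartzMap ℝ ℝ, ∫ t, ψ t = 1 → ∃ M : NNReal, ∀ n,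
      ∫⁻ p, ‖∏ i, mollify ψ n μ (p.1 - ((p.2 * b i : ℝ) : Circ))‖ₑ ∂stripMeasure ≤ M) ∧
    ∀ g : C(Circ × Circ, ℂ), ∃ l : ℂ, ∀ ψ : SchwartzMap ℝ ℝ, ∫ t, ψ t = 1 →
      Tendsto (fun n => countForm (k := 1) b g (fun _ => mollify ψ n μ)) atTop (𝓝 l) := by
  obtain ⟨ν, hν, C, hC⟩ := hμ
  have hM : ∀ ψ : SchwartzMap ℝ ℝ, ∫ t, ψ t = 1 → ∃ M : NNReal, ∀ n,
      ∫⁻ p, ‖∏ i, mollify ψ n μ (p.1 - ((p.2 * b i : ℝ) : Circ))‖ₑ ∂stripMeasure ≤ M := by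
    intro ψ hψ
    obtain ⟨B, hB⟩ := exists_eLpNorm_one_mollify_le μ hψ
    exact exists_lintegral_mollify_le (k := 1) le_rfl hb (by norm_num) hB
  refine ⟨hM, exists_tendsto_countForm_of_prodFourier (k := 1) le_rfl hb hM fun j l => ?_⟩
  refine exists_tendsto_countForm_of_measureCoeff hb (C := C) hβ (fun ξ => ?_) j l
  refine (norm_measureCoeff_sq_le hφ hν ξ).trans ((hC fun _ => ξ).trans (le_of_eq ?_))
  simp only [Finset.univ_unique, Finset.sum_const, Finset.card_singleton, one_smul,
    Real.sqrt_sq_eq_abs, Nat.cast_one]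
  congr 2
  ring

/-- Mass bounds and convergence when `k ≥ 2`: the decay forces `μ` to have a density in
`L^{2^{⌊k/2⌋}}`, and `2^{⌊k/2⌋} ≥ (k+1)/2`. -/
theorem mollify_multilinear_bounds {k : ℕ} (hk : 2 ≤ k) {b : Fin (k + 1) → ℝ}
    (hb : Function.Injective b) {φ : SchwartzMap ℝ ℝ} (hφ : ∫ t, φ t = 1) {β : ℝ}
    (hβ : (k : ℝ) < (k + 1) * β) {μ : SignedMeasure Circ} (hμ : HasCubeDecay φ μ k β) :
    (∀ ψ : SchwartzMap ℝ ℝ, ∫ t, ψ t = 1 → ∃ M : NNReal, ∀ n,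
      ∫⁻ p, ‖∏ i, mollify ψ n μ (p.1 - ((p.2 * b i : ℝ) : Circ))‖ₑ ∂stripMeasure ≤ M) ∧
    ∀ g : C(Circ × Circ, ℂ), ∃ l : ℂ, ∀ ψ : SchwartzMap ℝ ℝ, ∫ t, ψ t = 1 →
      Tendsto (fun n => countForm b g (fun _ => mollify ψ n μ)) atTop (𝓝 l) := by
  obtain ⟨ν, hν, C, hC⟩ := hμ
  set j := k / 2 with hj
  have hjk : (j : ℝ) < (k + 1 : ℝ) * β / 2 := by
    have h1 : ((2 * j : ℕ) : ℝ) ≤ k := by exact_mod_cast (by omega : 2 * j ≤ k)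
    push_cast at h1
    linarith
  obtain ⟨f, hf, hfc⟩ :=
    exists_memLp_of_cubeDecay (by omega : 1 ≤ j) (by omega : j ≤ k) hjk hφ hν hC
  have hq1 : (1 : ENNReal) ≤ 2 ^ j := one_le_pow₀ one_le_two
  have hqt : (2 : ENNReal) ^ j ≠ ⊤ := ENNReal.pow_ne_top (by simp)
  have hq : ENNReal.ofReal ((k + 1 : ℝ) / 2) ≤ 2 ^ j := by
    rw [show (2 : ENNReal) ^ j = ENNReal.ofReal (2 ^ j) by
      rw [ENNReal.ofReal_pow zero_le_two]; simp]
    refine ENNReal.ofReal_le_ofReal ?_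
    have h1 : ((k + 1 : ℕ) : ℝ) ≤ ((2 * 2 ^ j : ℕ) : ℝ) := by
      have : j < 2 ^ j := Nat.lt_two_pow_self
      exact_mod_cast (by omega : k + 1 ≤ 2 * 2 ^ j)
    push_cast at h1
    linarith
  refine ⟨fun ψ hψ => ?_, exists_tendsto_countForm_of_density (by omega) hb hq hq1 hqt hf hfc⟩
  obtain ⟨B, hB⟩ := exists_eLpNorm_mollify_le_of_density hq1 hqt hf hfc hψ
  exact exists_lintegral_mollify_le (by omega) hb hq hB

theorem mainTheorem2 (k : ℕ) (hk : 1 ≤ k) :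
    ∃ ε : ℝ, 0 < ε ∧
      ∀ (b : Fin (k + 1) → ℝ), Function.Injective b →
      ∀ (φ : SchwartzMap ℝ ℝ), ∫ t, φ t = 1 →
      ∀ (α β : ℝ), 1 - ε < α → 1 - ε < β →
      ∀ (μ : SignedMeasure Circ), HasBallBound μ α → HasCubeDecay φ μ k β →
        ∃ L : C(Circ × Circ, ℂ) →L[ℂ] ℂ,
          (∀ g : C(Circ × Circ, ℂ),
            Tendsto (fun n : ℕ => countForm b g (fun _ => mollify φ n μ)) atTop (𝓝 (L g))) ∧
          (∃! ν : SignedMeasure (Circ × Circ), ∀ g : C(Circ × Circ, ℂ), L g = ∫ᵛ p, g p ∂<•ν) ∧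
          (0 ≤ μ → ∀ ν : SignedMeasure (Circ × Circ),
            (∀ g : C(Circ × Circ, ℂ), L g = ∫ᵛ p, g p ∂<•ν) → 0 ≤ ν) := by
  have hk0 : (0 : ℝ) < k + 1 := by positivity
  -- With `ε = 1/(k+1)` the exponent `(k+1)β/2` exceeds `k/2`.
  refine ⟨1 / (k + 1), by positivity, fun b hb φ hφ α β _ hβ μ _ hμ => ?_⟩
  have hβ' : (k : ℝ) < (k + 1) * β := by
    rw [one_sub_div hk0.ne', add_sub_cancel_right, div_lt_iff₀ hk0] at hβ
    linarith
  obtain rfl | hk2 := hk.eq_or_lt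
  · have hβ0 : 0 < β := by
      push_cast at hβ'
      linarith
    obtain ⟨hM, hl⟩ := mollify_bilinear_bounds hb hφ hβ0 hμ
    exact exists_intersection_measure le_rfl hb hM hl hφ
  · obtain ⟨hM, hl⟩ := mollify_multilinear_bounds hk2 hb hφ hβ' hμ
    exact exists_intersection_measure hk hb hM hl hφ

end
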